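/- **Setting.** Let $J(q)=\sum_{j\ge -1}c(j)q^j=q^{-1}+196884q+21493760q^2+\cdots$ be the normalized elliptic modular function, and let $I=\{(j,k)\mid j\in\{-1,1,2,3,\dots\},\ 1\le k\le c(j)\}$ and $a_{jk,pq}=-(j+p)$ for $(j,k),(p,q)\in I$. Let $\mathfrak g(A)$ be the complex Lie algebra with generators $e_{jk},f_{jk},h_{jk}$ for $(j,k)\in I$ and defining relations, for all $(j,k),(p,q)\in I$, $$[h_{jk},h_{pq}]=0,\quad [h_{jk},e_{pq}]=a_{jk,pq}e_{pq},\quad [h_{jk},f_{pq}]=-a_{jk,pq}f_{pq},\quad [e_{jk},f_{pq}]=\delta_{jp}\delta_{kq}h_{jk},$$ together with $(\operatorname{ad}e_{-1\,1})^j e_{jk}=(\operatorname{ad}f_{-1\,1})^j f_{jk}=0$ for $(j,k)\in I$, $j\ge 1$. Let $\mathfrak z$ be the center of $\mathfrak g(A)$; the Monster Lie algebra is $\mathfrak m=\mathfrak g(A)/\mathfrak z$. In $\mathfrak m$ put $e_{-1}=e_{-1\,1}$, $f_{-1}=f_{-1\,1}$, $h_1=\tfrac12(h_{-1\,1}-h_{1\,1})$,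 $h_2=-\tfrac12(h_{-1\,1}+h_{1\,1})$. Let $\mathfrak{gl}_2(-1)$ be the Lie subalgebra of $\mathfrak m$ generated by $e_{-1},f_{-1},h_1,h_2$. For $(j,k)\in I$ with $j\ge1$ and $0\le\ell<j$ put $e_{\ell,jk}=(\operatorname{ad}e_{-1})^\ell e_{jk}/\ell!$ and $f_{\ell,jk}=(\operatorname{ad}f_{-1})^\ell f_{jk}/\ell!$, and let $\mathfrak{gl}_2(\ell,j,k)$ be the Lie subalgebra of $\mathfrak m$ generated by $e_{\ell,jk},f_{\ell,jk},h_1,h_2$. An element $x$ of a complex Lie algebra $\mathfrak L$ is locally $\operatorname{ad}$-nilpotent if for every $y\in\mathfrak L$ there is $n$ with $(\operatorname{ad}x)^n y=0$; then $\exp(\operatorname{ad}x)=\sum_n(\operatorname{ad}x)^n/n!$ is an automorphism of $\mathfrak L$, and $\operatorname{Inn}(\mathfrak L)$ denotes the group of automorphisms generated by all $\exp(\operatorname{ad}x)$ with $x\in\mathfrak L$ locally $\operatorname{ad}$-nilpotent. The elements $e_{-1}$ and $f_{-1}$ of $\mathfrak m$ are locally $\operatorname{ad}$-nilpotent; put $X_{-1}(u)=\exp(u\operatorname{ad}e_{-1})$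 and $Y_{-1}(u)=\exp(u\operatorname{ad}f_{-1})$ for $u\in\mathbb C$. **Statement.** 1. There is an isomorphism of Lie algebras $\varphi:\mathfrak{gl}_2(\mathbb C)\to\mathfrak{gl}_2(-1)$ with $\varphi(E_{12})=e_{-1}$, $\varphi(E_{21})=f_{-1}$, $\varphi(E_{11})=h_1$, $\varphi(E_{22})=h_2$, and an element $x\in\mathfrak m$ is locally $\operatorname{ad}$-nilpotent if and only if $x=\varphi(M)$ for some nilpotent matrix $M$. 2. $\operatorname{Inn}(\mathfrak m)=\langle X_{-1}(u),Y_{-1}(u)\mid u\in\mathbb C\rangle\cong \mathrm{SL}_2(\mathbb C)$. 3. $\operatorname{Inn}(\mathfrak{gl}_2(\ell,j,k))\cong \mathrm{PGL}_2(\mathbb C)$ for all $(j,k)\in I$ with $j\ge 1$ and all $0\le\ell<j$. -/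

import Mathlib

namespace MonsterLie

noncomputable section

/-! ### The normalized elliptic modular function -/

/-- The `q`-expansion `1 + 240 ∑ σ₃(n) qⁿ` of the Eisenstein series of weight 4. -/
def eisFour : PowerSeries ℚ :=
  PowerSeries.mk fun n => if n = 0 then 1 else 240 * (ArithmeticFunction.sigma 3 n : ℚ)

/-- The `q`-expansion `1 - 504 ∑ σ₅(n) qⁿ` of the Eisenstein series of weight 6. -/
def eisSix : PowerSeries ℚ :=
  PowerSeries.mk fun n => if n = 0 then 1 else -504 * (ArithmeticFunction.sigma 5 n : ℚ)

/-- The `q`-expansion of the normalized elliptic modular function `J = j - 744`, where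
`j = 1728 E₄³ / (E₄³ - E₆²)`. -/
def modularJ : LaurentSeries ℚ :=
  1728 * (eisFour : LaurentSeries ℚ) ^ 3 /
    ((eisFour : LaurentSeries ℚ) ^ 3 - (eisSix : LaurentSeries ℚ) ^ 2) - 744

/-- The coefficient `c(j)` of `q ^ j` in `J(q)`. -/
def c (j : ℤ) : ℚ := modularJ.coeff j


theorem coeff0 (a b : PowerSeries ℚ) : PowerSeries.coeff 0 (a * b) =
    PowerSeries.coeff 0 a * PowerSeries.coeff 0 b := by
  simp [PowerSeries.coeff_mul]
theorem coeff1 (a b : PowerSeries ℚ) : PowerSeries.coeff 1 (a * b) =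
    PowerSeries.coeff 0 a * PowerSeries.coeff 1 b + PowerSeries.coeff 1 a * PowerSeries.coeff 0 b := by
  simp [PowerSeries.coeff_mul, Finset.Nat.antidiagonal_succ]
theorem coeff2 (a b : PowerSeries ℚ) : PowerSeries.coeff 2 (a * b) =
    PowerSeries.coeff 0 a * PowerSeries.coeff 2 b + PowerSeries.coeff 1 a * PowerSeries.coeff 1 b
    + PowerSeries.coeff 2 a * PowerSeries.coeff 0 b := by
  simp [PowerSeries.coeff_mul, Finset.Nat.antidiagonal_succ]; ring
theorem coeff3 (a b : PowerSeries ℚ) : PowerSeries.coeff 3 (a * b) =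
    PowerSeries.coeff 0 a * PowerSeries.coeff 3 b + PowerSeries.coeff 1 a * PowerSeries.coeff 2 b
    + PowerSeries.coeff 2 a * PowerSeries.coeff 1 b + PowerSeries.coeff 3 a * PowerSeries.coeff 0 b := by
  simp [PowerSeries.coeff_mul, Finset.Nat.antidiagonal_succ]; ring
theorem coeff4 (a b : PowerSeries ℚ) : PowerSeries.coeff 4 (a * b) =
    PowerSeries.coeff 0 a * PowerSeries.coeff 4 b + PowerSeries.coeff 1 a * PowerSeries.coeff 3 b
    + PowerSeries.coeff 2 a * PowerSeries.coeff 2 b + PowerSeries.coeff 3 a * PowerSeries.coeff 1 b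
    + PowerSeries.coeff 4 a * PowerSeries.coeff 0 b := by
  simp [PowerSeries.coeff_mul, Finset.Nat.antidiagonal_succ]; ring

theorem s31 : ArithmeticFunction.sigma 3 1 = 1 := by decide +kernel
theorem s32 : ArithmeticFunction.sigma 3 2 = 9 := by decide +kernel
theorem s33 : ArithmeticFunction.sigma 3 3 = 28 := by decide +kernel
theorem s34 : ArithmeticFunction.sigma 3 4 = 73 := by decide +kernel
theorem s51 : ArithmeticFunction.sigma 5 1 = 1 := by decide +kernel
theorem s52 : ArithmeticFunction.sigma 5 2 = 33 := by decide +kernel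
theorem s53 : ArithmeticFunction.sigma 5 3 = 244 := by decide +kernel
theorem s54 : ArithmeticFunction.sigma 5 4 = 1057 := by decide +kernel

/-- The first coefficients of `J(q) = q⁻¹ + 196884 q + 21493760 q² + ⋯`. -/
theorem c_values : c (-1) = 1 ∧ c 0 = 0 ∧ c 1 = 196884 ∧ c 2 = 21493760 := by
  set G : PowerSeries ℚ := eisFour ^ 3 - eisSix ^ 2 with hG
  have hG0 : PowerSeries.coeff 0 G = 0 := by
    rw [hG, pow_succ, sq, sq]
    simp only [map_sub, coeff0]
    simp [eisFour, eisSix]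
  obtain ⟨H, hH⟩ : (PowerSeries.X : PowerSeries ℚ) ∣ G :=
    PowerSeries.X_dvd_iff.2 (by simpa using hG0)
  have hn : ∀ n, PowerSeries.coeff n H = PowerSeries.coeff (n + 1) G := by
    intro n; rw [hH, PowerSeries.coeff_succ_X_mul]
  have e1 : PowerSeries.coeff 0 H = 1728 ∧ PowerSeries.coeff 1 H = 1728 * (-24) ∧
      PowerSeries.coeff 2 H = 1728 * 252 ∧ PowerSeries.coeff 3 H = 1728 * (-1472) := by
    simp only [hn, hG, pow_succ, pow_zero, one_mul, map_sub, coeff0, coeff1, coeff2, coeff3, coeff4,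
      eisFour, eisSix, PowerSeries.coeff_mk, Nat.reduceAdd]
    norm_num [s31, s32, s33, s34, s51, s52, s53, s54]
  obtain ⟨H0, H1, H2, H3⟩ := e1
  have hHne : PowerSeries.constantCoeff H ≠ 0 := by
    rw [← PowerSeries.coeff_zero_eq_constantCoeff_apply, H0]; norm_num
  set P : PowerSeries ℚ := (1728 * eisFour ^ 3 - 744 * G) * H⁻¹ with hP
  have hPH : P * H = 1728 * eisFour ^ 3 - 744 * G := by
    rw [hP, mul_assoc, PowerSeries.inv_mul_cancel _ hHne, mul_one]
  have hJ : modularJ = HahnSeries.single (-1 : ℤ) (1 : ℚ) * (P : LaurentSeries ℚ) := by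
    have hGe : (eisFour : LaurentSeries ℚ) ^ 3 - (eisSix : LaurentSeries ℚ) ^ 2 =
        HahnSeries.single (1 : ℤ) (1 : ℚ) * (H : LaurentSeries ℚ) := by
      rw [← PowerSeries.coe_X, ← PowerSeries.coe_mul, ← hH, hG]
      simp
    have hHne' : (H : LaurentSeries ℚ) ≠ 0 := by
      intro h
      have : H = 0 := by
        apply HahnSeries.ofPowerSeries_injective (Γ := ℤ)
        simpa using h
      simp [this] at hHne
    have h1 : HahnSeries.single (1 : ℤ) (1 : ℚ) ≠ 0 := by simp
    have h2 : HahnSeries.single (-1 : ℤ) (1 : ℚ) * HahnSeries.single (1 : ℤ) (1 : ℚ) = 1 := by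
      simp [HahnSeries.single_mul_single]
    have hPH' := congrArg (fun x : PowerSeries ℚ => (x : LaurentSeries ℚ)) hPH
    simp only [hH, map_mul, map_sub, map_pow, map_ofNat] at hPH'
    rw [modularJ, hGe, sub_eq_iff_eq_add, div_eq_iff (mul_ne_zero h1 hHne')]
    rw [HahnSeries.ofPowerSeries_X] at hPH'
    linear_combination (-1 : LaurentSeries ℚ) * hPH' - (P : LaurentSeries ℚ) * H * h2
  have hc : ∀ n : ℕ, c ((n : ℤ) - 1) = PowerSeries.coeff n P := by
    intro n
    rw [c, hJ, sub_eq_add_neg, HahnSeries.coeff_single_mul_add, one_mul,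
      LaurentSeries.coeff_coe_powerSeries]
  have hPH2 : P * H = PowerSeries.C (1728 : ℚ) * eisFour ^ 3 - PowerSeries.C (744 : ℚ) * G := by
    rw [hPH, map_ofNat, map_ofNat]
  have k (n) := congrArg (PowerSeries.coeff n) hPH2
  have k0 := k 0
  have k1 := k 1
  have k2 := k 2
  have k3 := k 3
  simp only [hG, pow_succ, pow_zero, one_mul, map_sub, PowerSeries.coeff_C_mul, coeff0, coeff1,
    coeff2, coeff3, H0, H1, H2, H3, eisFour, eisSix, PowerSeries.coeff_mk] at k0 k1 k2 k3
  norm_num [s31, s32, s33, s51, s52, s53] at k0 k1 k2 k3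
  have c0 := hc 0
  have c1 := hc 1
  have c2 := hc 2
  have c3 := hc 3
  norm_num at c0 c1 c2 c3
  refine ⟨?_, ?_, ?_, ?_⟩
  · linarith
  · linarith
  · linarith
  · linarith

/-! ### Exponentials of locally ad-nilpotent elements and inner automorphisms -/

section Inner

variable {L : Type*} [LieRing L] [LieAlgebra ℂ L]

/-- The group structure on the Lie algebra automorphisms, with composition as product. -/
instance lieAutGroup : Group (L ≃ₗ⁅ℂ⁆ L) where
  mul f g := g.trans f
  one := 1
  inv f := f.symm
  mul_assoc _ _ _ := rfl
  one_mul _ := rfl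
  mul_one _ := rfl
  inv_mul_cancel f := by
    apply LieEquiv.ext
    intro x
    exact f.symm_apply_apply x

/-- `x` is locally ad-nilpotent: every `y` is killed by a power of `ad x`. -/
def IsLocallyAdNilpotent (x : L) : Prop :=
  ∀ y : L, ∃ n : ℕ, (LieAlgebra.ad ℂ L x ^ n) y = 0

/-- `exp (ad x) y = ∑ₙ (ad x)ⁿ y / n!`, a finite sum if `x` is locally ad-nilpotent. -/
def expAdFun (x y : L) : L :=
  ∑ᶠ n : ℕ, (n.factorial : ℂ)⁻¹ • (LieAlgebra.ad ℂ L x ^ n) y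

theorem pow_apply_eq_zero_of_le {x y : L} {n m : ℕ} (hnm : n ≤ m)
    (h : (LieAlgebra.ad ℂ L x ^ n) y = 0) : (LieAlgebra.ad ℂ L x ^ m) y = 0 := by
  obtain ⟨k, rfl⟩ := Nat.exists_eq_add_of_le' hnm
  rw [pow_add, Module.End.mul_apply, h, map_zero]

theorem expAdFun_eq {x y : L} {N : ℕ} (h : (LieAlgebra.ad ℂ L x ^ N) y = 0) :
    expAdFun x y =
      ∑ n ∈ Finset.range N, (n.factorial : ℂ)⁻¹ • (LieAlgebra.ad ℂ L x ^ n) y := by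
  apply finsum_eq_sum_of_support_subset
  intro n hn
  by_contra hN
  apply hn
  simp only [Finset.coe_range, Set.mem_Iio, not_lt] at hN
  simp only
  rw [pow_apply_eq_zero_of_le hN h, smul_zero]

theorem sum_range_mul_range {M : Type*} [AddCommMonoid M] (N : ℕ) (f : ℕ → ℕ → M)
    (hl : ∀ i j, N ≤ i → f i j = 0) (hr : ∀ i j, N ≤ j → f i j = 0) :
    ∑ i ∈ Finset.range N, ∑ j ∈ Finset.range N, f i j =
      ∑ n ∈ Finset.range (2 * N), ∑ p ∈ Finset.HasAntidiagonal.antidiagonal n, f p.1 p.2 := by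
  rw [← Finset.sum_product', ← Finset.sum_fiberwise_of_maps_to
    (g := fun p : ℕ × ℕ => p.1 + p.2) (t := Finset.range (2 * N))]
  · refine Finset.sum_congr rfl fun n _ => Finset.sum_subset ?_ ?_
    · intro p hp
      simp only [Finset.mem_filter] at hp
      simp [hp.2]
    · intro p hp hp'
      simp only [Finset.HasAntidiagonal.mem_antidiagonal] at hp
      simp only [Finset.mem_filter, Finset.mem_product, Finset.mem_range, hp, and_true] at hp'
      rcases lt_or_ge p.1 N with h1 | h1
      · rcases lt_or_ge p.2 N with h2 | h2
        · exact absurd ⟨h1, h2⟩ hp'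
        · exact hr _ _ h2
      · exact hl _ _ h1
  · intro p hp
    simp only [Finset.mem_product, Finset.mem_range] at hp ⊢
    omega

theorem ad_pow_lie (x a b : L) (n : ℕ) :
    (LieAlgebra.ad ℂ L x ^ n) ⁅a, b⁆ = ∑ p ∈ Finset.HasAntidiagonal.antidiagonal n,
      n.choose p.1 • ⁅(LieAlgebra.ad ℂ L x ^ p.1) a, (LieAlgebra.ad ℂ L x ^ p.2) b⁆ := by
  have := LieDerivation.iterate_apply_lie (LieDerivation.ad ℂ L x) n a b
  have e : ⇑(LieDerivation.ad ℂ L x) = ⇑(LieAlgebra.ad ℂ L x) := by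
    funext y
    simp
  rw [e] at this
  simpa only [Module.End.pow_apply] using this

theorem expAdFun_lie {x : L} (hx : IsLocallyAdNilpotent x) (a b : L) :
    expAdFun x ⁅a, b⁆ = ⁅expAdFun x a, expAdFun x b⁆ := by
  obtain ⟨n, hn⟩ := hx a
  obtain ⟨m, hm⟩ := hx b
  set N := max n m
  have ha := pow_apply_eq_zero_of_le (le_max_left n m) hn
  have hb := pow_apply_eq_zero_of_le (le_max_right n m) hm
  have hab : (LieAlgebra.ad ℂ L x ^ (2 * N)) ⁅a, b⁆ = 0 := by
    rw [ad_pow_lie]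
    refine Finset.sum_eq_zero fun p hp => ?_
    rw [Finset.HasAntidiagonal.mem_antidiagonal] at hp
    rcases le_or_gt N p.1 with h | h
    · rw [pow_apply_eq_zero_of_le h ha, zero_lie, smul_zero]
    · rw [pow_apply_eq_zero_of_le (by omega : N ≤ p.2) hb, lie_zero, smul_zero]
  rw [expAdFun_eq ha, expAdFun_eq hb, expAdFun_eq hab]
  simp_rw [sum_lie, lie_sum]
  rw [sum_range_mul_range]
  · refine Finset.sum_congr rfl fun k _ => ?_
    rw [ad_pow_lie, Finset.smul_sum]
    refine Finset.sum_congr rfl fun p hp => ?_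
    rw [Finset.HasAntidiagonal.mem_antidiagonal] at hp
    rw [smul_lie, lie_smul, smul_smul, ← Nat.cast_smul_eq_nsmul ℂ, smul_smul]
    congr 1
    subst hp
    have h := Nat.add_choose_mul_factorial_mul_factorial p.1 p.2
    rw [← Nat.choose_symm_add] at h
    have h' : (((p.1 + p.2).choose p.1 : ℕ) : ℂ) * p.1.factorial * p.2.factorial =
        (p.1 + p.2).factorial := by exact_mod_cast h
    rw [← h']
    have := Nat.factorial_ne_zero p.1
    have := Nat.factorial_ne_zero p.2
    have := (Nat.choose_pos (Nat.le_add_right p.1 p.2)).ne'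
    field_simp
  · intro i j h
    rw [pow_apply_eq_zero_of_le h ha, smul_zero, zero_lie]
  · intro i j h
    rw [pow_apply_eq_zero_of_le h hb, smul_zero, lie_zero]

theorem expAdFun_add {x : L} (hx : IsLocallyAdNilpotent x) (a b : L) :
    expAdFun x (a + b) = expAdFun x a + expAdFun x b := by
  obtain ⟨n, hn⟩ := hx a
  obtain ⟨m, hm⟩ := hx b
  have ha := pow_apply_eq_zero_of_le (le_max_left n m) hn
  have hb := pow_apply_eq_zero_of_le (le_max_right n m) hm
  have hab : (LieAlgebra.ad ℂ L x ^ max n m) (a + b) = 0 := by rw [map_add, ha, hb, add_zero]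
  rw [expAdFun_eq ha, expAdFun_eq hb, expAdFun_eq hab]
  simp [Finset.sum_add_distrib]

theorem expAdFun_smul {x : L} (hx : IsLocallyAdNilpotent x) (t : ℂ) (a : L) :
    expAdFun x (t • a) = t • expAdFun x a := by
  obtain ⟨n, ha⟩ := hx a
  have hab : (LieAlgebra.ad ℂ L x ^ n) (t • a) = 0 := by rw [map_smul, ha, smul_zero]
  rw [expAdFun_eq ha, expAdFun_eq hab, Finset.smul_sum]
  simp only [map_smul]
  exact Finset.sum_congr rfl fun k _ => smul_comm _ _ _

theorem ad_smul_pow (t : ℂ) (x y : L) (n : ℕ) :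
    (LieAlgebra.ad ℂ L (t • x) ^ n) y = t ^ n • (LieAlgebra.ad ℂ L x ^ n) y := by
  rw [map_smul, smul_pow, LinearMap.smul_apply]

theorem IsLocallyAdNilpotent.smul {x : L} (hx : IsLocallyAdNilpotent x) (t : ℂ) :
    IsLocallyAdNilpotent (t • x) := by
  intro y
  obtain ⟨n, hn⟩ := hx y
  exact ⟨n, by rw [ad_smul_pow, hn, smul_zero]⟩

theorem IsLocallyAdNilpotent.neg {x : L} (hx : IsLocallyAdNilpotent x) :
    IsLocallyAdNilpotent (-x) := by
  simpa using hx.smul (-1)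

theorem expAdFun_neg_expAdFun {x : L} (hx : IsLocallyAdNilpotent x) (y : L) :
    expAdFun (-x) (expAdFun x y) = y := by
  obtain ⟨N, hN⟩ := hx y
  have hneg (n : ℕ) (z : L) : (LieAlgebra.ad ℂ L (-x) ^ n) z =
      (-1 : ℂ) ^ n • (LieAlgebra.ad ℂ L x ^ n) z := by
    rw [← ad_smul_pow, neg_one_smul]
  have hy : (LieAlgebra.ad ℂ L (-x) ^ N) (expAdFun x y) = 0 := by
    rw [hneg, expAdFun_eq hN, map_sum]
    refine smul_eq_zero_of_right _ (Finset.sum_eq_zero fun k _ => ?_)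
    rw [map_smul, ← Module.End.mul_apply, ← pow_add,
      pow_apply_eq_zero_of_le (Nat.le_add_right _ _) hN, smul_zero]
  rw [expAdFun_eq hy]
  simp only [hneg, expAdFun_eq hN, map_sum, map_smul, Finset.smul_sum]
  rw [sum_range_mul_range]
  · have key : ∀ k ∈ Finset.range (2 * N), k ≠ 0 →
        ∑ p ∈ Finset.HasAntidiagonal.antidiagonal k, ((p.1.factorial : ℂ)⁻¹ • (-1 : ℂ) ^ p.1 •
          (p.2.factorial : ℂ)⁻¹ • (LieAlgebra.ad ℂ L x ^ p.1) ((LieAlgebra.ad ℂ L x ^ p.2) y)) =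
        0 := by
      intro k _ hk
      have h0 : ((-1 : ℂ) + 1) ^ k = 0 := by simp [hk]
      rw [(Commute.all (-1 : ℂ) 1).add_pow'] at h0
      have : ∀ p ∈ Finset.HasAntidiagonal.antidiagonal k, ((p.1.factorial : ℂ)⁻¹ • (-1 : ℂ) ^ p.1 •
          (p.2.factorial : ℂ)⁻¹ • (LieAlgebra.ad ℂ L x ^ p.1) ((LieAlgebra.ad ℂ L x ^ p.2) y)) =
          ((k.factorial : ℂ)⁻¹ * (k.choose p.1 • ((-1 : ℂ) ^ p.1 * 1 ^ p.2))) •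
            (LieAlgebra.ad ℂ L x ^ k) y := by
        intro p hp
        rw [Finset.HasAntidiagonal.mem_antidiagonal] at hp
        subst hp
        rw [← Module.End.mul_apply, ← pow_add, smul_smul, smul_smul]
        congr 1
        have h := Nat.add_choose_mul_factorial_mul_factorial p.1 p.2
        rw [← Nat.choose_symm_add] at h
        have h' : (((p.1 + p.2).choose p.1 : ℕ) : ℂ) * p.1.factorial * p.2.factorial =
            (p.1 + p.2).factorial := by exact_mod_cast h
        rw [← h']
        have := Nat.factorial_ne_zero p.1
        have := Nat.factorial_ne_zero p.2
        have := (Nat.choose_pos (Nat.le_add_right p.1 p.2)).ne'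
        simp only [nsmul_eq_mul, one_pow, mul_one]
        field_simp
      rw [Finset.sum_congr rfl this, ← Finset.sum_smul, ← Finset.mul_sum, h0, mul_zero, zero_smul]
    rcases Nat.eq_zero_or_pos N with h | h
    · subst h
      simpa using hN.symm
    · rw [Finset.sum_eq_single 0 key (fun h' => absurd (Finset.mem_range.2 (by omega)) h')]
      simp
  · intro i j h
    rw [← Module.End.mul_apply, ← pow_add,
      pow_apply_eq_zero_of_le (le_trans h (Nat.le_add_right _ _)) hN]
    simp
  · intro i j h
    rw [pow_apply_eq_zero_of_le h hN]
    simp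

/-- The automorphism `exp (ad x)` of `L`, for `x` locally ad-nilpotent. -/
def expAd (x : L) (hx : IsLocallyAdNilpotent x) : L ≃ₗ⁅ℂ⁆ L where
  toFun := expAdFun x
  map_add' := expAdFun_add hx
  map_smul' := expAdFun_smul hx
  map_lie' {a b} := expAdFun_lie hx a b
  invFun := expAdFun (-x)
  left_inv := expAdFun_neg_expAdFun hx
  right_inv y := by simpa using expAdFun_neg_expAdFun hx.neg y

variable (L) in
/-- The group `Inn L` generated by all `exp (ad x)` with `x` locally ad-nilpotent. -/
def Inn : Subgroup (L ≃ₗ⁅ℂ⁆ L) :=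
  Subgroup.closure {φ | ∃ (x : L) (hx : IsLocallyAdNilpotent x), φ = expAd x hx}

end Inner

/-! ### The Monster Lie algebra -/

/-- The index set `I = {(j, k) | j ∈ {-1, 1, 2, 3, …}, 1 ≤ k ≤ c(j)}`. -/
@[ext]
structure Index where
  j : ℤ
  k : ℤ
  j_mem : j = -1 ∨ 1 ≤ j
  one_le_k : 1 ≤ k
  k_le : (k : ℚ) ≤ c j

/-- The index `(-1, 1)`. -/
def idxNeg : Index where
  j := -1
  k := 1
  j_mem := Or.inl rfl
  one_le_k := le_refl 1
  k_le := by simp [c_values.1]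

/-- The index `(1, 1)`. -/
def idxOne : Index where
  j := 1
  k := 1
  j_mem := Or.inr (le_refl 1)
  one_le_k := le_refl 1
  k_le := by norm_num [c_values.2.2.1]

/-- The Borcherds–Cartan matrix `a_{jk,pq} = -(j + p)`. -/
def cartan (a b : Index) : ℤ := -(a.j + b.j)

/-- The Serre–Chevalley generators. -/
inductive Gen
  | e (a : Index)
  | f (a : Index)
  | h (a : Index)

/-- The free Lie algebra on the Serre–Chevalley generators. -/
abbrev Free : Type := FreeLieAlgebra ℂ Gen

def genE (a : Index) : Free := FreeLieAlgebra.of ℂ (Gen.e a)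
def genF (a : Index) : Free := FreeLieAlgebra.of ℂ (Gen.f a)
def genH (a : Index) : Free := FreeLieAlgebra.of ℂ (Gen.h a)

/-- The defining relators of `𝔤(A)`. -/
inductive Relator : Free → Prop
  | hh (a b : Index) : Relator ⁅genH a, genH b⁆
  | he (a b : Index) : Relator (⁅genH a, genE b⁆ - (cartan a b : ℂ) • genE b)
  | hf (a b : Index) : Relator (⁅genH a, genF b⁆ + (cartan a b : ℂ) • genF b)
  | ef_self (a : Index) : Relator (⁅genE a, genF a⁆ - genH a)
  | ef_ne (a b : Index) (hab : a ≠ b) : Relator ⁅genE a, genF b⁆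
  | serre_e (a : Index) (ha : 1 ≤ a.j) :
      Relator ((LieAlgebra.ad ℂ Free (genE idxNeg) ^ a.j.toNat) (genE a))
  | serre_f (a : Index) (ha : 1 ≤ a.j) :
      Relator ((LieAlgebra.ad ℂ Free (genF idxNeg) ^ a.j.toNat) (genF a))

/-- The ideal of the free Lie algebra generated by the relators. -/
def relatorIdeal : LieIdeal ℂ Free := LieSubmodule.lieSpan ℂ Free {x | Relator x}

/-- The Borcherds algebra `𝔤(A)`. -/
abbrev BorcherdsAlgebra : Type := Free ⧸ relatorIdeal

/-- The Monster Lie algebra `𝔪 = 𝔤(A) / 𝔷`, where `𝔷` is the center of `𝔤(A)`. -/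
abbrev Monster : Type := BorcherdsAlgebra ⧸ LieAlgebra.center ℂ BorcherdsAlgebra

/-- The canonical map from the free Lie algebra to `𝔪`. -/
def proj : Free →ₗ⁅ℂ⁆ Monster where
  toFun x := LieSubmodule.Quotient.mk (LieSubmodule.Quotient.mk x : BorcherdsAlgebra)
  map_add' _ _ := rfl
  map_smul' _ _ := rfl
  map_lie' := rfl

/-- The images in `𝔪` of the generators `e_{jk}`, `f_{jk}`, `h_{jk}`. -/
def e (a : Index) : Monster := proj (genE a)

def f (a : Index) : Monster := proj (genF a)

def h (a : Index) : Monster := proj (genH a)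

/-- `h₁ = (h_{-1,1} - h_{1,1}) / 2`. -/
def h₁ : Monster := (1 / 2 : ℂ) • (h idxNeg - h idxOne)

/-- `h₂ = -(h_{-1,1} + h_{1,1}) / 2`. -/
def h₂ : Monster := -((1 / 2 : ℂ) • (h idxNeg + h idxOne))

/-- `e_{-1}`. -/
def eNeg : Monster := e idxNeg

/-- `f_{-1}`. -/
def fNeg : Monster := f idxNeg

/-- `e_{ℓ,jk} = (ad e_{-1})^ℓ e_{jk} / ℓ!`. -/
def eExt (l : ℕ) (a : Index) : Monster :=
  (l.factorial : ℂ)⁻¹ • (LieAlgebra.ad ℂ Monster eNeg ^ l) (e a)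

/-- `f_{ℓ,jk} = (ad f_{-1})^ℓ f_{jk} / ℓ!`. -/
def fExt (l : ℕ) (a : Index) : Monster :=
  (l.factorial : ℂ)⁻¹ • (LieAlgebra.ad ℂ Monster fNeg ^ l) (f a)

/-- The subalgebra `𝔤𝔩₂(-1)` of `𝔪`. -/
def gl2Neg : LieSubalgebra ℂ Monster :=
  LieSubalgebra.lieSpan ℂ Monster {eNeg, fNeg, h₁, h₂}

/-- The subalgebra `𝔤𝔩₂(ℓ,j,k)` of `𝔪`, for `a = (j, k)`. -/
def gl2Im (l : ℕ) (a : Index) : LieSubalgebra ℂ Monster :=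
  LieSubalgebra.lieSpan ℂ Monster {eExt l a, fExt l a, h₁, h₂}

/-! ### The automorphisms `X_{-1}(u)` and `Y_{-1}(u)` -/

theorem proj_relator {x : Free} (hx : Relator x) : proj x = 0 := by
  have h0 : (LieSubmodule.Quotient.mk x : BorcherdsAlgebra) = 0 :=
    (LieSubmodule.Quotient.mk_eq_zero' (N := relatorIdeal)).2
      (LieSubmodule.subset_lieSpan (R := ℂ) (L := Free) hx)
  change (LieSubmodule.Quotient.mk (LieSubmodule.Quotient.mk x : BorcherdsAlgebra) : Monster) = 0
  rw [h0]
  rfl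

theorem proj_surjective : Function.Surjective proj := by
  intro y
  obtain ⟨z, rfl⟩ := LieSubmodule.Quotient.surjective_mk' _ y
  obtain ⟨w, rfl⟩ := LieSubmodule.Quotient.surjective_mk' _ z
  exact ⟨w, rfl⟩

theorem eq_top_of_generators (S : LieSubalgebra ℂ Monster) (he : ∀ a, e a ∈ S)
    (hf : ∀ a, f a ∈ S) (hh : ∀ a, h a ∈ S) : S = ⊤ := by
  have hg : ∀ g : Gen, proj (FreeLieAlgebra.of ℂ g) ∈ S := by
    rintro (a | a | a)
    exacts [he a, hf a, hh a]
  have key : S.incl.comp (FreeLieAlgebra.lift ℂ fun g => (⟨_, hg g⟩ : S)) = proj := by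
    apply FreeLieAlgebra.hom_ext
    intro g
    simp [FreeLieAlgebra.lift_of_apply]
  rw [eq_top_iff]
  intro y _
  obtain ⟨x, rfl⟩ := proj_surjective y
  rw [← key]
  exact ((FreeLieAlgebra.lift ℂ fun g => (⟨_, hg g⟩ : S)) x).2

theorem lie_h_e (a b : Index) : ⁅h a, e b⁆ = (cartan a b : ℂ) • e b := by
  have := proj_relator (Relator.he a b)
  rwa [map_sub, map_smul, LieHom.map_lie, sub_eq_zero] at this

theorem lie_h_f (a b : Index) : ⁅h a, f b⁆ = -((cartan a b : ℂ) • f b) := by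
  have := proj_relator (Relator.hf a b)
  rwa [map_add, map_smul, LieHom.map_lie, add_eq_zero_iff_eq_neg] at this

theorem lie_e_f_self (a : Index) : ⁅e a, f a⁆ = h a := by
  have := proj_relator (Relator.ef_self a)
  rwa [map_sub, LieHom.map_lie, sub_eq_zero] at this

theorem lie_e_f_ne {a b : Index} (hab : a ≠ b) : ⁅e a, f b⁆ = 0 := by
  have := proj_relator (Relator.ef_ne a b hab)
  rwa [LieHom.map_lie] at this

theorem proj_ad_pow (x y : Free) (n : ℕ) : proj ((LieAlgebra.ad ℂ Free x ^ n) y) =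
    (LieAlgebra.ad ℂ Monster (proj x) ^ n) (proj y) := by
  induction n with
  | zero => simp
  | succ n ih =>
    rw [pow_succ', pow_succ', Module.End.mul_apply, Module.End.mul_apply, ← ih,
      LieAlgebra.ad_apply, LieAlgebra.ad_apply, LieHom.map_lie]

theorem eq_idxNeg_or (a : Index) : a = idxNeg ∨ 1 ≤ a.j := by
  rcases a.j_mem with hj | hj
  · left
    have h1 := a.k_le
    rw [hj, c_values.1] at h1
    have h2 : a.k ≤ 1 := by exact_mod_cast h1
    exact Index.ext hj (le_antisymm h2 a.one_le_k)
  · exact Or.inr hj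

theorem eNeg_isLocallyAdNilpotent : IsLocallyAdNilpotent eNeg := by
  have htop : LieSubalgebra.engel ℂ eNeg = ⊤ := by
    apply eq_top_of_generators
    · intro a
      rcases eq_idxNeg_or a with rfl | ha
      · exact LieSubalgebra.self_mem_engel ℂ eNeg
      · rw [LieSubalgebra.mem_engel_iff]
        refine ⟨a.j.toNat, ?_⟩
        have := proj_relator (Relator.serre_e a ha)
        rwa [proj_ad_pow] at this
    · intro a
      rw [LieSubalgebra.mem_engel_iff]
      by_cases ha : idxNeg = a
      · subst ha
        refine ⟨3, ?_⟩
        simp only [pow_succ, pow_zero, one_mul, Module.End.mul_apply, LieAlgebra.ad_apply]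
        rw [eNeg, lie_e_f_self, ← lie_skew (e idxNeg) (h idxNeg), lie_h_e]
        simp
      · refine ⟨1, ?_⟩
        rw [pow_one, LieAlgebra.ad_apply, eNeg, lie_e_f_ne ha]
    · intro a
      rw [LieSubalgebra.mem_engel_iff]
      refine ⟨2, ?_⟩
      simp only [pow_succ, pow_zero, one_mul, Module.End.mul_apply, LieAlgebra.ad_apply]
      rw [eNeg, ← lie_skew (e idxNeg) (h a), lie_h_e]
      simp
  intro y
  rw [← LieSubalgebra.mem_engel_iff, htop]
  trivial

theorem fNeg_isLocallyAdNilpotent : IsLocallyAdNilpotent fNeg := by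
  have htop : LieSubalgebra.engel ℂ fNeg = ⊤ := by
    apply eq_top_of_generators
    · intro a
      rw [LieSubalgebra.mem_engel_iff]
      by_cases ha : a = idxNeg
      · subst ha
        refine ⟨3, ?_⟩
        simp only [pow_succ, pow_zero, one_mul, Module.End.mul_apply, LieAlgebra.ad_apply]
        rw [fNeg, ← lie_skew (f idxNeg) (e idxNeg), lie_e_f_self, lie_neg, ← lie_skew (f idxNeg) (h idxNeg), lie_h_f]
        simp
      · refine ⟨1, ?_⟩
        rw [pow_one, LieAlgebra.ad_apply, fNeg, ← lie_skew, lie_e_f_ne ha, neg_zero]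
    · intro a
      rcases eq_idxNeg_or a with rfl | ha
      · exact LieSubalgebra.self_mem_engel ℂ fNeg
      · rw [LieSubalgebra.mem_engel_iff]
        refine ⟨a.j.toNat, ?_⟩
        have := proj_relator (Relator.serre_f a ha)
        rwa [proj_ad_pow] at this
    · intro a
      rw [LieSubalgebra.mem_engel_iff]
      refine ⟨2, ?_⟩
      simp only [pow_succ, pow_zero, one_mul, Module.End.mul_apply, LieAlgebra.ad_apply]
      rw [fNeg, ← lie_skew (f idxNeg) (h a), lie_h_f]
      simp
  intro y
  rw [← LieSubalgebra.mem_engel_iff, htop]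
  trivial

/-- `X_{-1}(u) = exp (u ad e_{-1})`. -/
def X (u : ℂ) : Monster ≃ₗ⁅ℂ⁆ Monster := expAd (u • eNeg) (eNeg_isLocallyAdNilpotent.smul u)

/-- `Y_{-1}(u) = exp (u ad f_{-1})`. -/
def Y (u : ℂ) : Monster ≃ₗ⁅ℂ⁆ Monster := expAd (u • fNeg) (fNeg_isLocallyAdNilpotent.smul u)

end

end MonsterLie

/-! The bracket on matrices is the commutator. -/
attribute [local instance] LieRing.ofAssociativeRing

namespace MonsterLie

noncomputable section

/-! ### Lie algebras satisfying the defining relations -/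

/-! The element `h₁ + h₂` grades `𝔪` by integers: `e_{-1}`, `f_{-1}` and the Cartan generators have
degree 0, while `e_{jk}` and `f_{jk}` with `j ≥ 1` have degrees `±(j + 1)`. Modulo the center the
Cartan part is spanned by `h₁, h₂`, so degree 0 is a copy of `𝔤𝔩₂`. The part of positive degree is
generated by the `e_{ℓ,jk}`, the negative part by the `f_{ℓ,jk}` (`mem_triangular`). The Chevalley
involution exchanges the two sides.

The main point is that a locally ad-nilpotent element has degree 0. The positive part should be a
free Lie algebra on the `e_{ℓ,jk}`, in which ad-nilpotency on two different free generators forces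
an element to vanish. Freeness enters through a representation `wordRep` of `𝔤(A)` on the free
associative algebra on letters `e_{ℓ,jk}`, `0 ≤ ℓ < j`, resembling a module induced from the trivial
module of the nonpositive part: the `e_{ℓ,jk}` act by left multiplication, and the other generators
kill 1 and have the commutators with letters that the relations dictate (`killsRelators_wordRep`).
It vanishes on the kernel of `proj` (`wordRep_eq_zero_of_proj`). If `x` is locally ad-nilpotent,
then so is its top positive component on homogeneous vectors (`ad_pow_leading`), hence so is the
corresponding noncommutative polynomial on letters. Comparison of longest words shows that this
polynomial is 0 (`freeAlgebra_eq_zero_of_ad_nilpotent`). An affine action of the free algebra on `𝔪`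
carries this back to the vanishing of the component (`exists_word`).

For an element of the degree 0 part, its actions on `e_{11}` and on the string of `e_{21}` detect
trace and determinant, which gives nilpotency (`trace_det_of_isLocallyAdNilpotent`). Conversely a
nilpotent matrix is a multiple of `E₁₂`, or is conjugate by some `1 + u E₁₂` to a multiple of `E₂₁`.
So the `X_{-1}(u)` and `Y_{-1}(u)` generate `Inn(𝔪)`. This group acts on strings of length `j` as
`SL₂` acts on binary forms of degree `j - 1`. The string with `j = 2` is the standard
representation, so `-1` acts nontrivially and the group is `SL₂` rather than a quotient.

Each `𝔤𝔩₂(ℓ,j,k)` is isomorphic to `𝔤𝔩₂` after rescaling, because `[e_{ℓ,jk}, f_{ℓ,jk}]` is a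
nonzero multiple of an explicit Cartan element (`lie_eExt_fExt`). For `𝔤𝔩₂` itself, locally
ad-nilpotent matrices are scalar plus square-zero, their exponentials are conjugations, and
conjugations form `GL₂` modulo its center. -/

theorem free_eq_top_of_generators (S : LieSubalgebra ℂ Free) (he : ∀ a, genE a ∈ S)
    (hf : ∀ a, genF a ∈ S) (hh : ∀ a, genH a ∈ S) (x : Free) : x ∈ S := by
  have hg : ∀ g : Gen, FreeLieAlgebra.of ℂ g ∈ S := by
    rintro (a | a | a)
    exacts [he a, hf a, hh a]
  have key : S.incl.comp (FreeLieAlgebra.lift ℂ fun g => (⟨_, hg g⟩ : S)) = LieHom.id := by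
    apply FreeLieAlgebra.hom_ext
    intro g
    simp [FreeLieAlgebra.lift_of_apply]
  have := congrArg (fun F : Free →ₗ⁅ℂ⁆ Free => F x) key
  simp only [LieHom.coe_id, id_eq] at this
  rw [← this]
  exact ((FreeLieAlgebra.lift ℂ fun g => (⟨_, hg g⟩ : S)) x).2

/-- The Chevalley involution of the free Lie algebra. -/
def chevalley : Free →ₗ⁅ℂ⁆ Free :=
  FreeLieAlgebra.lift ℂ fun
    | .e a => genF a
    | .f a => genE a
    | .h a => -genH a

@[simp] theorem chevalley_genE (a : Index) : chevalley (genE a) = genF a :=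
  FreeLieAlgebra.lift_of_apply _ _
@[simp] theorem chevalley_genF (a : Index) : chevalley (genF a) = genE a :=
  FreeLieAlgebra.lift_of_apply _ _
@[simp] theorem chevalley_genH (a : Index) : chevalley (genH a) = -genH a :=
  FreeLieAlgebra.lift_of_apply _ _

theorem chevalley_comp_chevalley : chevalley.comp chevalley = LieHom.id := by
  apply FreeLieAlgebra.hom_ext
  rintro (a | a | a)
  · change chevalley (chevalley (genE a)) = genE a
    simp
  · change chevalley (chevalley (genF a)) = genF a
    simp
  · change chevalley (chevalley (genH a)) = genH a
    simp

@[simp] theorem chevalley_chevalley (x : Free) : chevalley (chevalley x) = x :=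
  congrArg (fun F : Free →ₗ⁅ℂ⁆ Free => F x) chevalley_comp_chevalley

section Generic

variable {L : Type*} [LieRing L] [LieAlgebra ℂ L]

theorem map_ad_pow {L' : Type*} [LieRing L'] [LieAlgebra ℂ L'] (p : L →ₗ⁅ℂ⁆ L') (x y : L) (n : ℕ) :
    p ((LieAlgebra.ad ℂ L x ^ n) y) = (LieAlgebra.ad ℂ L' (p x) ^ n) (p y) := by
  induction n with
  | zero => simp
  | succ n ih =>
    rw [pow_succ', pow_succ', Module.End.mul_apply, Module.End.mul_apply, ← ih,
      LieAlgebra.ad_apply, LieAlgebra.ad_apply, LieHom.map_lie]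

theorem ad_pow_succ_apply (x y : L) (n : ℕ) :
    (LieAlgebra.ad ℂ L x ^ (n + 1)) y = ⁅x, (LieAlgebra.ad ℂ L x ^ n) y⁆ := by
  rw [pow_succ', Module.End.mul_apply, LieAlgebra.ad_apply]

/-- A Lie homomorphism from the free Lie algebra that kills the relators. -/
def KillsRelators (p : Free →ₗ⁅ℂ⁆ L) : Prop := ∀ x, Relator x → p x = 0

theorem killsRelators_proj : KillsRelators proj := fun _ => proj_relator

variable {p : Free →ₗ⁅ℂ⁆ L} (hp : KillsRelators p)
include hp

namespace KillsRelators

theorem lie_h_h (a b : Index) : ⁅p (genH a), p (genH b)⁆ = 0 := by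
  rw [← LieHom.map_lie]
  exact hp _ (.hh a b)

theorem lie_h_e (a b : Index) : ⁅p (genH a), p (genE b)⁆ = (cartan a b : ℂ) • p (genE b) := by
  have := hp _ (.he a b)
  rwa [map_sub, map_smul, LieHom.map_lie, sub_eq_zero] at this

theorem lie_h_f (a b : Index) : ⁅p (genH a), p (genF b)⁆ = -((cartan a b : ℂ) • p (genF b)) := by
  have := hp _ (.hf a b)
  rwa [map_add, map_smul, LieHom.map_lie, add_eq_zero_iff_eq_neg] at this

theorem lie_e_f_self (a : Index) : ⁅p (genE a), p (genF a)⁆ = p (genH a) := by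
  have := hp _ (.ef_self a)
  rwa [map_sub, LieHom.map_lie, sub_eq_zero] at this

theorem lie_e_f_ne {a b : Index} (hab : a ≠ b) : ⁅p (genE a), p (genF b)⁆ = 0 := by
  rw [← LieHom.map_lie]
  exact hp _ (.ef_ne a b hab)

/-- The involution permutes the relators up to sign. Facts about the positive generators, proved for
arbitrary `p`, therefore transfer to the negative ones by applying them to `p.comp chevalley`. -/
theorem comp_chevalley : KillsRelators (p.comp chevalley) := by
  intro x hx
  rw [LieHom.comp_apply]
  induction hx with
  | hh a b => simp [hp.lie_h_h]
  | he a b =>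
    rw [map_sub, map_smul, LieHom.map_lie, chevalley_genH, chevalley_genE, map_sub, map_smul,
      LieHom.map_lie, map_neg, neg_lie, hp.lie_h_f, neg_neg, sub_self]
  | hf a b =>
    rw [map_add, map_smul, LieHom.map_lie, chevalley_genH, chevalley_genF, map_add, map_smul,
      LieHom.map_lie, map_neg, neg_lie, hp.lie_h_e, neg_add_cancel]
  | ef_self a =>
    rw [map_sub, LieHom.map_lie, chevalley_genE, chevalley_genF, chevalley_genH, map_sub,
      LieHom.map_lie, ← lie_skew, hp.lie_e_f_self]
    simp
  | ef_ne a b hab =>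
    rw [LieHom.map_lie, chevalley_genE, chevalley_genF, LieHom.map_lie, ← lie_skew,
      hp.lie_e_f_ne hab.symm, neg_zero]
  | serre_e a ha =>
    rw [map_ad_pow, chevalley_genE, chevalley_genE]
    exact hp _ (.serre_f a ha)
  | serre_f a ha =>
    rw [map_ad_pow, chevalley_genF, chevalley_genF]
    exact hp _ (.serre_e a ha)

end KillsRelators

omit hp

variable (p) in
/-- The element `(ad e_{-1})^ℓ e_a / ℓ!`. -/
def posVec (l : ℕ) (a : Index) : L :=
  (l.factorial : ℂ)⁻¹ • (LieAlgebra.ad ℂ L (p (genE idxNeg)) ^ l) (p (genE a))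

theorem posVec_zero (a : Index) : posVec p 0 a = p (genE a) := by simp [posVec]

theorem lie_e_posVec (l : ℕ) (a : Index) :
    ⁅p (genE idxNeg), posVec p l a⁆ = ((l : ℂ) + 1) • posVec p (l + 1) a := by
  rw [posVec, posVec, lie_smul, ← ad_pow_succ_apply, smul_smul, Nat.factorial_succ]
  congr 1
  have := Nat.factorial_ne_zero l
  have : (l : ℂ) + 1 ≠ 0 := by exact_mod_cast Nat.succ_ne_zero l
  push_cast
  field_simp

theorem posVec_succ (l : ℕ) (a : Index) :
    posVec p (l + 1) a = ((l : ℂ) + 1)⁻¹ • ⁅p (genE idxNeg), posVec p l a⁆ := by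
  have : (l : ℂ) + 1 ≠ 0 := by exact_mod_cast Nat.succ_ne_zero l
  rw [lie_e_posVec, smul_smul, inv_mul_cancel₀ this, one_smul]

/-- Lift of `h₁`. -/
def genH₁ : Free := (1 / 2 : ℂ) • (genH idxNeg - genH idxOne)

/-- Lift of `h₂`. -/
def genH₂ : Free := -((1 / 2 : ℂ) • (genH idxNeg + genH idxOne))

theorem chevalley_genH₁ : chevalley genH₁ = -genH₁ := by
  simp [genH₁, smul_sub]; abel

theorem chevalley_genH₂ : chevalley genH₂ = -genH₂ := by
  simp [genH₂, smul_add, add_comm]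

theorem genH_idxNeg : genH idxNeg = genH₁ - genH₂ := by
  rw [genH₁, genH₂]; module

/-! ### Weights and `𝔰𝔩₂`-strings of the vectors `e_{ℓ,jk}`. -/

namespace KillsRelators
include hp

theorem lie_h_posVec (b : Index) (l : ℕ) (a : Index) : ⁅p (genH b), posVec p l a⁆ =
    ((cartan b a : ℂ) + l * (cartan b idxNeg : ℂ)) • posVec p l a := by
  induction l with
  | zero => simp [posVec_zero, hp.lie_h_e]
  | succ l ih =>
    rw [posVec_succ, lie_smul, leibniz_lie, ih, hp.lie_h_e, smul_lie, lie_smul]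
    push_cast
    module

theorem lie_h₁_posVec (l : ℕ) (a : Index) :
    ⁅p genH₁, posVec p l a⁆ = ((l : ℂ) + 1) • posVec p l a := by
  rw [genH₁, map_smul, map_sub, smul_lie, sub_lie, hp.lie_h_posVec, hp.lie_h_posVec, ← sub_smul,
    smul_smul]
  congr 1
  simp only [cartan, idxNeg, idxOne]
  push_cast
  ring

theorem lie_h₂_posVec (l : ℕ) (a : Index) :
    ⁅p genH₂, posVec p l a⁆ = ((a.j : ℂ) - l) • posVec p l a := by
  rw [genH₂, map_neg, map_smul, map_add, neg_lie, smul_lie, add_lie, hp.lie_h_posVec,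
    hp.lie_h_posVec, ← add_smul, smul_smul, ← neg_smul]
  congr 1
  simp only [cartan, idxNeg, idxOne]
  push_cast
  ring

theorem lie_h₁_e (a : Index) : ⁅p genH₁, p (genE a)⁆ = p (genE a) := by
  simpa [posVec_zero] using hp.lie_h₁_posVec 0 a

theorem lie_h₂_e (a : Index) : ⁅p genH₂, p (genE a)⁆ = (a.j : ℂ) • p (genE a) := by
  simpa [posVec_zero] using hp.lie_h₂_posVec 0 a

theorem lie_h₁_f (a : Index) : ⁅p genH₁, p (genF a)⁆ = -p (genF a) := by
  have := hp.comp_chevalley.lie_h₁_e a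
  simp only [LieHom.comp_apply, chevalley_genH₁, chevalley_genE, map_neg, neg_lie] at this
  rw [← neg_eq_iff_eq_neg, this]

theorem lie_h₂_f (a : Index) : ⁅p genH₂, p (genF a)⁆ = -((a.j : ℂ) • p (genF a)) := by
  have := hp.comp_chevalley.lie_h₂_e a
  simp only [LieHom.comp_apply, chevalley_genH₂, chevalley_genE, map_neg, neg_lie] at this
  rw [← neg_eq_iff_eq_neg, this]

theorem lie_h₁_h (a : Index) : ⁅p genH₁, p (genH a)⁆ = 0 := by
  simp [genH₁, hp.lie_h_h]

theorem lie_h₂_h (a : Index) : ⁅p genH₂, p (genH a)⁆ = 0 := by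
  simp [genH₂, hp.lie_h_h]

theorem posVec_eq_zero {a : Index} (ha : 1 ≤ a.j) {l : ℕ} (hl : a.j ≤ l) : posVec p l a = 0 := by
  have h := hp _ (.serre_e a ha)
  rw [map_ad_pow] at h
  rw [posVec, pow_apply_eq_zero_of_le (by omega) h, smul_zero]

theorem lie_f_posVec_zero {a : Index} (ha : 1 ≤ a.j) :
    ⁅p (genF idxNeg), posVec p 0 a⁆ = 0 := by
  have hne : a ≠ idxNeg := by
    rintro rfl
    simp [idxNeg] at ha
  rw [posVec_zero, ← lie_skew, hp.lie_e_f_ne hne, neg_zero]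

/-- This is the usual `𝔰𝔩₂`-string computation: `e_{jk}` commutes with `f_{-1}` and has weight `1 -
j` under `h_{-1,1}`. The coefficient vanishes at `ℓ = j - 1`, in agreement with the Serre relation
that ends the string. -/
theorem lie_f_posVec_succ {a : Index} (ha : 1 ≤ a.j) (l : ℕ) :
    ⁅p (genF idxNeg), posVec p (l + 1) a⁆ = ((a.j : ℂ) - l - 1) • posVec p l a := by
  have h0 : (l : ℂ) + 1 ≠ 0 := by exact_mod_cast Nat.succ_ne_zero l
  have hfe : ⁅p (genF idxNeg), p (genE idxNeg)⁆ = -p (genH idxNeg) := by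
    rw [← lie_skew, hp.lie_e_f_self]
  induction l with
  | zero =>
    rw [posVec_succ, lie_smul, leibniz_lie, hfe, hp.lie_f_posVec_zero ha, neg_lie,
      hp.lie_h_posVec, lie_zero, add_zero, ← neg_smul, smul_smul]
    congr 1
    simp only [cartan, idxNeg]
    push_cast
    ring
  | succ l ih =>
    have h1 : (l : ℂ) + 1 ≠ 0 := by exact_mod_cast Nat.succ_ne_zero l
    rw [posVec_succ, lie_smul, leibniz_lie, hfe, ih h1, neg_lie, hp.lie_h_posVec, lie_smul,
      lie_e_posVec, ← neg_smul, smul_smul, ← add_smul, smul_smul]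
    congr 1
    rw [inv_mul_eq_iff_eq_mul₀ h0]
    simp only [cartan, idxNeg]
    push_cast
    ring

end KillsRelators

/-! ### The triangular decomposition -/

variable (p) in
/-- The subalgebra generated by the `e_{ℓ,jk}`. -/
def posSubalgebra : LieSubalgebra ℂ L :=
  LieSubalgebra.lieSpan ℂ L {x | ∃ (a : Index) (l : ℕ), 1 ≤ a.j ∧ x = posVec p l a}

variable (p) in
/-- The span of `e_{-1}`, `f_{-1}` and the Cartan generators. -/
def levi : Submodule ℂ L :=
  Submodule.span ℂ ({p (genE idxNeg), p (genF idxNeg)} ∪ Set.range fun a => p (genH a))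

variable (p) in
/-- The sum of the negative part, the Levi part and the positive part. -/
def triangular : Submodule ℂ L :=
  (posSubalgebra (p.comp chevalley)).toSubmodule ⊔ levi p ⊔ (posSubalgebra p).toSubmodule

theorem comp_chevalley_comp_chevalley : (p.comp chevalley).comp chevalley = p := by
  ext x; simp

theorem e_mem_levi : p (genE idxNeg) ∈ levi p := Submodule.subset_span (by simp)
theorem f_mem_levi : p (genF idxNeg) ∈ levi p := Submodule.subset_span (by simp)
theorem h_mem_levi (a : Index) : p (genH a) ∈ levi p := Submodule.subset_span (by simp)

theorem levi_comp_chevalley : levi (p.comp chevalley) = levi p := by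
  have key : ∀ q : Free →ₗ⁅ℂ⁆ L, levi (q.comp chevalley) ≤ levi q := by
    intro q
    rw [levi, Submodule.span_le]
    rintro x ((rfl | rfl) | ⟨a, rfl⟩)
    · simpa using f_mem_levi
    · simpa using e_mem_levi
    · simpa using h_mem_levi a
  refine le_antisymm (key p) ?_
  have := key (p.comp chevalley)
  rwa [comp_chevalley_comp_chevalley] at this

theorem triangular_comp_chevalley : triangular (p.comp chevalley) = triangular p := by
  rw [triangular, triangular, comp_chevalley_comp_chevalley, levi_comp_chevalley]
  rw [sup_comm, sup_comm (posSubalgebra p).toSubmodule, sup_assoc]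

theorem posVec_mem {a : Index} (ha : 1 ≤ a.j) (l : ℕ) : posVec p l a ∈ posSubalgebra p :=
  LieSubalgebra.subset_lieSpan ⟨a, l, ha, rfl⟩

theorem lie_mem_lieSpan_of_generators {s : Set L} {x y : L}
    (h : ∀ z ∈ s, ⁅x, z⁆ ∈ LieSubalgebra.lieSpan ℂ L s) (hy : y ∈ LieSubalgebra.lieSpan ℂ L s) :
    ⁅x, y⁆ ∈ LieSubalgebra.lieSpan ℂ L s := by
  induction hy using LieSubalgebra.lieSpan_induction with
  | mem z hz => exact h z hz
  | zero => simp
  | add y z _ _ hy hz => rw [lie_add]; exact add_mem hy hz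
  | smul t y _ hy => rw [lie_smul]; exact Submodule.smul_mem _ t hy
  | lie y z hy' hz' hy hz =>
    rw [leibniz_lie]
    exact add_mem (LieSubalgebra.lie_mem _ hy hz') (LieSubalgebra.lie_mem _ hy' hz)

namespace KillsRelators
include hp

theorem lie_levi_pos {x y : L} (hx : x ∈ levi p) (hy : y ∈ posSubalgebra p) :
    ⁅x, y⁆ ∈ posSubalgebra p := by
  induction hx using Submodule.span_induction with
  | mem x hx =>
    refine lie_mem_lieSpan_of_generators ?_ hy
    rintro z ⟨a, l, ha, rfl⟩
    change _ ∈ posSubalgebra p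
    rcases hx with (rfl | rfl) | ⟨b, rfl⟩
    · rw [lie_e_posVec]
      exact Submodule.smul_mem _ _ (posVec_mem ha _)
    · cases l with
      | zero => rw [hp.lie_f_posVec_zero ha]; exact zero_mem _
      | succ l =>
        rw [hp.lie_f_posVec_succ ha]
        exact Submodule.smul_mem _ _ (posVec_mem ha _)
    · dsimp only
      rw [hp.lie_h_posVec]
      exact Submodule.smul_mem _ _ (posVec_mem ha _)
  | zero => rw [zero_lie]; exact zero_mem _
  | add x z _ _ hx hz => rw [add_lie]; exact add_mem hx hz
  | smul t x _ hx => rw [smul_lie]; exact Submodule.smul_mem _ t hx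

theorem lie_e_levi {x : L} (hx : x ∈ levi p) : ⁅p (genE idxNeg), x⁆ ∈ levi p := by
  induction hx using Submodule.span_induction with
  | mem x hx =>
    rcases hx with (rfl | rfl) | ⟨b, rfl⟩
    · rw [lie_self]; exact zero_mem _
    · rw [hp.lie_e_f_self]; exact h_mem_levi _
    · dsimp only
      rw [← lie_skew, hp.lie_h_e]
      exact neg_mem (Submodule.smul_mem _ _ e_mem_levi)
  | zero => rw [lie_zero]; exact zero_mem _
  | add x z _ _ hx hz => rw [lie_add]; exact add_mem hx hz
  | smul t x _ hx => rw [lie_smul]; exact Submodule.smul_mem _ t hx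

theorem lie_f_levi {x : L} (hx : x ∈ levi p) : ⁅p (genF idxNeg), x⁆ ∈ levi p := by
  have := hp.comp_chevalley.lie_e_levi (x := x) (by rwa [levi_comp_chevalley])
  simpa [levi_comp_chevalley] using this

theorem lie_h_levi (a : Index) {x : L} (hx : x ∈ levi p) : ⁅p (genH a), x⁆ ∈ levi p := by
  induction hx using Submodule.span_induction with
  | mem x hx =>
    rcases hx with (rfl | rfl) | ⟨b, rfl⟩
    · rw [hp.lie_h_e]; exact Submodule.smul_mem _ _ e_mem_levi
    · rw [hp.lie_h_f]; exact neg_mem (Submodule.smul_mem _ _ f_mem_levi)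
    · dsimp only
      rw [hp.lie_h_h]; exact zero_mem _
  | zero => rw [lie_zero]; exact zero_mem _
  | add x z _ _ hx hz => rw [lie_add]; exact add_mem hx hz
  | smul t x _ hx => rw [lie_smul]; exact Submodule.smul_mem _ t hx

theorem lie_levi_levi {x y : L} (hx : x ∈ levi p) (hy : y ∈ levi p) : ⁅x, y⁆ ∈ levi p := by
  induction hx using Submodule.span_induction with
  | mem x hx =>
    rcases hx with (rfl | rfl) | ⟨b, rfl⟩
    exacts [hp.lie_e_levi hy, hp.lie_f_levi hy, hp.lie_h_levi b hy]
  | zero => rw [zero_lie]; exact zero_mem _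
  | add x z _ _ hx hz => rw [add_lie]; exact add_mem hx hz
  | smul t x _ hx => rw [smul_lie]; exact Submodule.smul_mem _ t hx

/-- Since `e_a` commutes with `f_{-1}`, induction on `ℓ` reduces the bracket to `[e_a, f_b]`, which
is 0 or `h_a`. -/
theorem lie_e_posVec_chevalley_mem_levi {a b : Index} (ha : 1 ≤ a.j) (l : ℕ) :
    ⁅p (genE a), posVec (p.comp chevalley) l b⁆ ∈ levi p := by
  have hne : a ≠ idxNeg := by
    rintro rfl
    simp [idxNeg] at ha
  induction l with
  | zero =>
    rw [posVec_zero, LieHom.comp_apply, chevalley_genE]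
    by_cases hab : a = b
    · subst hab
      rw [hp.lie_e_f_self]
      exact h_mem_levi _
    · rw [hp.lie_e_f_ne hab]
      exact zero_mem _
  | succ l ih =>
    rw [posVec_succ, lie_smul, leibniz_lie, LieHom.comp_apply, chevalley_genE, hp.lie_e_f_ne hne,
      zero_lie, zero_add]
    exact Submodule.smul_mem _ _ (hp.lie_f_levi ih)

/-- By the previous lemma `e_a` sends negative generators to the Levi part. On a bracket of negative
elements the Leibniz rule leaves brackets of the negative or Levi part with the negative part, and
these remain negative. -/
theorem lie_e_neg_mem {a : Index} (ha : 1 ≤ a.j) {y : L}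
    (hy : y ∈ posSubalgebra (p.comp chevalley)) :
    ⁅p (genE a), y⁆ ∈ (posSubalgebra (p.comp chevalley)).toSubmodule ⊔ levi p := by
  have hlevi : ∀ {x y : L}, x ∈ (posSubalgebra (p.comp chevalley)).toSubmodule ⊔ levi p →
      y ∈ posSubalgebra (p.comp chevalley) → ⁅x, y⁆ ∈ posSubalgebra (p.comp chevalley) := by
    intro x y hx hy
    obtain ⟨u, hu, v, hv, rfl⟩ := Submodule.mem_sup.1 hx
    rw [add_lie]
    exact add_mem (LieSubalgebra.lie_mem _ hu hy)
      (hp.comp_chevalley.lie_levi_pos (by rwa [levi_comp_chevalley]) hy)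
  induction hy using LieSubalgebra.lieSpan_induction with
  | mem z hz =>
    obtain ⟨b, l, hb, rfl⟩ := hz
    exact Submodule.mem_sup_right (hp.lie_e_posVec_chevalley_mem_levi ha l)
  | zero => rw [lie_zero]; exact zero_mem _
  | add y z _ _ hy hz => rw [lie_add]; exact add_mem hy hz
  | smul t y _ hy => rw [lie_smul]; exact Submodule.smul_mem _ t hy
  | lie y z hy' hz' hy hz =>
    rw [leibniz_lie, ← lie_skew y]
    exact Submodule.mem_sup_left (add_mem (hlevi hy hz') (neg_mem (hlevi hz hy')))

theorem lie_e_triangular {a : Index} (ha : 1 ≤ a.j) {y : L} (hy : y ∈ triangular p) :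
    ⁅p (genE a), y⁆ ∈ triangular p := by
  obtain ⟨u', hu', v, hv, rfl⟩ := Submodule.mem_sup.1 hy
  obtain ⟨u, hu, w, hw, rfl⟩ := Submodule.mem_sup.1 hu'
  have he : p (genE a) ∈ posSubalgebra p := by
    rw [← posVec_zero]
    exact posVec_mem ha 0
  rw [lie_add, lie_add]
  refine add_mem (add_mem ?_ ?_) ?_
  · exact Submodule.mem_sup_left (hp.lie_e_neg_mem ha hu)
  · rw [← lie_skew]
    exact neg_mem (Submodule.mem_sup_right (hp.lie_levi_pos hw he))
  · exact Submodule.mem_sup_right (LieSubalgebra.lie_mem _ he hv)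

theorem lie_levi_triangular {x y : L} (hx : x ∈ levi p) (hy : y ∈ triangular p) :
    ⁅x, y⁆ ∈ triangular p := by
  obtain ⟨u', hu', v, hv, rfl⟩ := Submodule.mem_sup.1 hy
  obtain ⟨u, hu, w, hw, rfl⟩ := Submodule.mem_sup.1 hu'
  rw [lie_add, lie_add]
  refine add_mem (add_mem ?_ ?_) ?_
  · exact Submodule.mem_sup_left (Submodule.mem_sup_left
      (hp.comp_chevalley.lie_levi_pos (by rwa [levi_comp_chevalley]) hu))
  · exact Submodule.mem_sup_left (Submodule.mem_sup_right (hp.lie_levi_levi hx hw))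
  · exact Submodule.mem_sup_right (hp.lie_levi_pos hx hv)

theorem lie_triangular (x : Free) : ∀ y ∈ triangular p, ⁅p x, y⁆ ∈ triangular p := by
  let S : LieSubalgebra ℂ Free :=
    { carrier := {x | ∀ y ∈ triangular p, ⁅p x, y⁆ ∈ triangular p}
      zero_mem' := fun y _ => by simp
      add_mem' := fun {u v} hu hv y hy => by
        rw [map_add, add_lie]; exact add_mem (hu y hy) (hv y hy)
      smul_mem' := fun t u hu y hy => by
        rw [map_smul, smul_lie]; exact Submodule.smul_mem _ t (hu y hy)
      lie_mem' := fun {u v} hu hv y hy => by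
        rw [LieHom.map_lie, lie_lie]
        exact sub_mem (hu _ (hv y hy)) (hv _ (hu y hy)) }
  refine free_eq_top_of_generators S ?_ ?_ ?_ x
  · intro a y hy
    rcases eq_idxNeg_or a with rfl | ha
    · exact hp.lie_levi_triangular e_mem_levi hy
    · exact hp.lie_e_triangular ha hy
  · intro a y hy
    rcases eq_idxNeg_or a with rfl | ha
    · exact hp.lie_levi_triangular f_mem_levi hy
    · have := hp.comp_chevalley.lie_e_triangular ha (y := y) (by rwa [triangular_comp_chevalley])
      simpa [triangular_comp_chevalley] using this
  · intro a y hy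
    exact hp.lie_levi_triangular (h_mem_levi a) hy

/-- The sum is stable under bracketing with every `p x`, so its preimage is a subalgebra, and it
contains the generators. Directness is not asserted here; degree arguments separate the summands
later. -/
theorem mem_triangular (x : Free) : p x ∈ triangular p := by
  let S : LieSubalgebra ℂ Free :=
    { (triangular p).comap (p : Free →ₗ[ℂ] L) with
      lie_mem' := fun {u v} _ hv => by
        change p ⁅u, v⁆ ∈ triangular p
        rw [LieHom.map_lie]
        exact hp.lie_triangular u _ hv }
  refine free_eq_top_of_generators S ?_ ?_ ?_ x
  · intro a
    change p (genE a) ∈ triangular p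
    rcases eq_idxNeg_or a with rfl | ha
    · exact Submodule.mem_sup_left (Submodule.mem_sup_right e_mem_levi)
    · rw [← posVec_zero]
      exact Submodule.mem_sup_right (posVec_mem ha 0)
  · intro a
    change p (genF a) ∈ triangular p
    rcases eq_idxNeg_or a with rfl | ha
    · exact Submodule.mem_sup_left (Submodule.mem_sup_right f_mem_levi)
    · have : p (genF a) = posVec (p.comp chevalley) 0 a := by simp [posVec_zero]
      rw [this]
      exact Submodule.mem_sup_left (Submodule.mem_sup_left (posVec_mem ha 0))
  · intro a
    exact Submodule.mem_sup_left (Submodule.mem_sup_right (h_mem_levi a))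

end KillsRelators

end Generic

/-! ### Operators on free algebras determined by their commutators with the letters -/

section FreeOperators

variable {X : Type*}

/-- Left multiplication on a free algebra. -/
def leftMul : FreeAlgebra ℂ X →ₐ[ℂ] Module.End ℂ (FreeAlgebra ℂ X) :=
  Algebra.lmul ℂ (FreeAlgebra ℂ X)

@[simp] theorem leftMul_apply (s t : FreeAlgebra ℂ X) : leftMul s t = s * t := rfl

theorem leftMul_injective : Function.Injective (leftMul (X := X)) := by
  intro s t h
  simpa using congrArg (fun Q : Module.End ℂ (FreeAlgebra ℂ X) => Q 1) h

theorem leftMul_lie (s t : FreeAlgebra ℂ X) : leftMul ⁅s, t⁆ = ⁅leftMul s, leftMul t⁆ := by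
  simp [Ring.lie_def]

/-- The affine action of the free algebra used to construct an operator with prescribed
commutators. -/
def commutatorAction (c : X → Module.End ℂ (FreeAlgebra ℂ X)) :
    FreeAlgebra ℂ X →ₐ[ℂ] Module.End ℂ (FreeAlgebra ℂ X × FreeAlgebra ℂ X) :=
  FreeAlgebra.lift ℂ fun x =>
    LinearMap.prod
      (leftMul (FreeAlgebra.ι ℂ x) ∘ₗ LinearMap.fst ℂ _ _ + c x ∘ₗ LinearMap.snd ℂ _ _)
      (leftMul (FreeAlgebra.ι ℂ x) ∘ₗ LinearMap.snd ℂ _ _)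

theorem commutatorAction_snd (c : X → Module.End ℂ (FreeAlgebra ℂ X)) (t : FreeAlgebra ℂ X)
    (v : FreeAlgebra ℂ X × FreeAlgebra ℂ X) : (commutatorAction c t v).2 = t * v.2 := by
  induction t using FreeAlgebra.induction generalizing v with
  | grade0 r => simp [Algebra.algebraMap_eq_smul_one]
  | grade1 x => simp [commutatorAction]
  | mul s t hs ht => rw [map_mul, Module.End.mul_apply, hs, ht, mul_assoc]
  | add s t hs ht => rw [map_add, LinearMap.add_apply, Prod.snd_add, hs, ht, add_mul]

/-- The operator that kills `1` and whose commutator with the letter `x` is `c x`. -/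
def operatorOf (c : X → Module.End ℂ (FreeAlgebra ℂ X)) : Module.End ℂ (FreeAlgebra ℂ X) where
  toFun t := (commutatorAction c t (0, 1)).1
  map_add' s t := by simp
  map_smul' r t := by simp

@[simp] theorem operatorOf_one (c : X → Module.End ℂ (FreeAlgebra ℂ X)) : operatorOf c 1 = 0 := by
  simp [operatorOf]

/-- A letter `x` acts on pairs by a block triangular matrix with `x` on the diagonal and `c x` in
the corner. Starting from `(0, 1)`, the second coordinate records the word `t` itself, so the first
satisfies `T(x t) = x T(t) + c_x(t)`. -/
theorem lie_operatorOf (c : X → Module.End ℂ (FreeAlgebra ℂ X)) (x : X) :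
    ⁅operatorOf c, leftMul (FreeAlgebra.ι ℂ x)⁆ = c x := by
  ext t
  have h : operatorOf c (FreeAlgebra.ι ℂ x * t) =
      FreeAlgebra.ι ℂ x * operatorOf c t + c x t := by
    simp only [operatorOf, LinearMap.coe_mk, AddHom.coe_mk]
    rw [map_mul, Module.End.mul_apply]
    have h1 := commutatorAction_snd c t (0, 1)
    rw [mul_one] at h1
    nth_rewrite 1 [commutatorAction]
    rw [FreeAlgebra.lift_ι_apply]
    simp [h1]
  simp [Ring.lie_def, h]

/-- An operator commuting with the letters is an endomorphism of the free left module of rank one,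
hence a right multiplication. -/
theorem operator_apply_eq_mul (Q : Module.End ℂ (FreeAlgebra ℂ X))
    (hQ : ∀ x : X, ⁅Q, leftMul (FreeAlgebra.ι ℂ x)⁆ = 0) (t : FreeAlgebra ℂ X) : Q t = t * Q 1 := by
  have key : ∀ t s : FreeAlgebra ℂ X, Q (t * s) = t * Q s := by
    intro t
    induction t using FreeAlgebra.induction with
    | grade0 r => intro s; simp [Algebra.algebraMap_eq_smul_one]
    | grade1 x =>
      intro s
      have := congrArg (fun P : Module.End ℂ (FreeAlgebra ℂ X) => P s) (hQ x)
      simpa [Ring.lie_def, sub_eq_zero] using this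
    | mul a b ha hb => intro s; rw [mul_assoc, ha, hb, mul_assoc]
    | add a b ha hb => intro s; rw [add_mul, map_add, ha, hb, add_mul]
  simpa using key t 1

theorem operator_eq_zero (Q : Module.End ℂ (FreeAlgebra ℂ X)) (h1 : Q 1 = 0)
    (hQ : ∀ x : X, ⁅Q, leftMul (FreeAlgebra.ι ℂ x)⁆ = 0) : Q = 0 := by
  ext t
  rw [operator_apply_eq_mul Q hQ, h1, mul_zero, LinearMap.zero_apply]

end FreeOperators

/-! ### A representation of `𝔤(A)` on a free associative algebra -/

/-- The letters, indexing the elements `e_{ℓ,jk}`. -/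
abbrev Letter : Type := {b : Index × ℕ // 1 ≤ b.1.j ∧ (b.2 : ℤ) < b.1.j}

/-- The free associative algebra on the letters. -/
abbrev Words : Type := FreeAlgebra ℂ Letter

open Classical in
/-- The letter `(a, ℓ)`, or `0` when out of range. -/
def vec (a : Index) (l : ℕ) : Words :=
  if hb : 1 ≤ a.j ∧ (l : ℤ) < a.j then FreeAlgebra.ι ℂ (⟨(a, l), hb⟩ : Letter) else 0

theorem vec_of_lt {a : Index} {l : ℕ} (hb : 1 ≤ a.j ∧ (l : ℤ) < a.j) :
    vec a l = FreeAlgebra.ι ℂ (⟨(a, l), hb⟩ : Letter) := dif_pos hb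

theorem vec_of_le {a : Index} {l : ℕ} (hb : a.j ≤ l) : vec a l = 0 :=
  dif_neg fun h => absurd h.2 (not_lt.2 hb)

/-- Left multiplication by a letter. -/
def vecOp (a : Index) (l : ℕ) : Module.End ℂ Words := leftMul (vec a l)

theorem vecOp_of_le {a : Index} {l : ℕ} (hb : a.j ≤ l) : vecOp a l = 0 := by
  rw [vecOp, vec_of_le hb, map_zero]

/-- This is the uniqueness principle behind the operator identities below: it suffices to compare
values at 1 and commutators with letters. -/
theorem words_operator_eq_zero (Q : Module.End ℂ Words) (h1 : Q 1 = 0)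
    (hQ : ∀ (a : Index) (l : ℕ), 1 ≤ a.j → ⁅Q, vecOp a l⁆ = 0) : Q = 0 := by
  refine operator_eq_zero Q h1 fun b => ?_
  obtain ⟨⟨a, l⟩, hb⟩ := b
  have := hQ a l hb.1
  rwa [vecOp, vec_of_lt hb] at this

theorem words_operator_ext {P Q : Module.End ℂ Words} (h1 : P 1 = Q 1)
    (hQ : ∀ (a : Index) (l : ℕ), 1 ≤ a.j → ⁅P, vecOp a l⁆ = ⁅Q, vecOp a l⁆) : P = Q := by
  rw [← sub_eq_zero]
  refine words_operator_eq_zero _ (by simp [h1]) fun a l ha => ?_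
  rw [sub_lie, hQ a l ha, sub_self]

/-- Commutators are prescribed only for `ℓ < j`. Beyond that range the letter is 0, so a uniform
formula in `ℓ` requires the prescribed value to vanish there as well. -/
theorem lie_operatorOf_vecOp (c : Index → ℕ → Module.End ℂ Words)
    (hc : ∀ (a : Index) (l : ℕ), 1 ≤ a.j → a.j ≤ l → c a l = 0) {a : Index} (ha : 1 ≤ a.j) (l : ℕ) :
    ⁅operatorOf fun b : Letter => c b.1.1 b.1.2, vecOp a l⁆ = c a l := by
  rcases lt_or_ge (l : ℤ) a.j with hl | hl
  · rw [vecOp, vec_of_lt ⟨ha, hl⟩, lie_operatorOf]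
  · rw [vecOp_of_le hl, lie_zero, hc a l ha hl]

/-- The operator of `e_{-1}`. -/
def opE : Module.End ℂ Words :=
  operatorOf fun b : Letter => ((b.1.2 : ℂ) + 1) • vecOp b.1.1 (b.1.2 + 1)

/-- The commutators of the operator of `f_{-1}` with the letters. -/
def opFCommutator (a : Index) : ℕ → Module.End ℂ Words
  | 0 => 0
  | l + 1 => ((a.j : ℂ) - l - 1) • vecOp a l

/-- The operator of `f_{-1}`. -/
def opF : Module.End ℂ Words := operatorOf fun b : Letter => opFCommutator b.1.1 b.1.2

/-- The operator of `h₁`. -/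
def opH₁ : Module.End ℂ Words :=
  operatorOf fun b : Letter => ((b.1.2 : ℂ) + 1) • vecOp b.1.1 b.1.2

/-- The operator of `h₂`. -/
def opH₂ : Module.End ℂ Words :=
  operatorOf fun b : Letter => ((b.1.1.j : ℂ) - b.1.2) • vecOp b.1.1 b.1.2

/-- The operator of `h_a`. -/
def opH (a : Index) : Module.End ℂ Words := -(opH₂ + (a.j : ℂ) • opH₁)

open Classical in
/-- The commutators of the operator of `f_a`, for `a` imaginary, with the letters. -/
def opLowerCommutator (a b : Index) (l : ℕ) : Module.End ℂ Words :=
  if b = a then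
    match l with
    -- These values are forced. The first is `-h_a = h₂ + j h₁`. Bracketing it with `e_{-1}`, which
    -- commutes with `f_a`, gives `e_{-1} - j e_{-1}` for `ℓ = 1`, and a further bracket with
    -- `e_{-1}` gives 0.
    | 0 => opH₂ + (a.j : ℂ) • opH₁
    | 1 => -(((a.j : ℂ) - 1) • opE)
    | _ + 2 => 0
  else 0

/-- The operator of `f_a`, for `a` imaginary. -/
def opLower (a : Index) : Module.End ℂ Words :=
  operatorOf fun b : Letter => opLowerCommutator a b.1.1 b.1.2

@[simp] theorem opE_one : opE 1 = 0 := operatorOf_one _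
@[simp] theorem opF_one : opF 1 = 0 := operatorOf_one _
@[simp] theorem opH₁_one : opH₁ 1 = 0 := operatorOf_one _
@[simp] theorem opH₂_one : opH₂ 1 = 0 := operatorOf_one _
@[simp] theorem opLower_one (a : Index) : opLower a 1 = 0 := operatorOf_one _
@[simp] theorem opH_one (a : Index) : opH a 1 = 0 := by simp [opH]

section Commutators

variable {a : Index} (ha : 1 ≤ a.j)
include ha

theorem lie_opE_vecOp (l : ℕ) : ⁅opE, vecOp a l⁆ = ((l : ℂ) + 1) • vecOp a (l + 1) :=
  lie_operatorOf_vecOp (fun a l => ((l : ℂ) + 1) • vecOp a (l + 1))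
    (fun a l _ hl => by rw [vecOp_of_le (by push_cast; omega), smul_zero]) ha l

theorem lie_opF_vecOp (l : ℕ) : ⁅opF, vecOp a l⁆ = opFCommutator a l := by
  refine lie_operatorOf_vecOp opFCommutator (fun a l h1 hl => ?_) ha l
  cases l with
  | zero => rfl
  | succ l =>
    rw [opFCommutator]
    rcases hl.eq_or_lt with h | h
    -- At the boundary `j = ℓ + 1` the letter on the right is still nonzero; it is the coefficient
    -- `j - ℓ - 1` that vanishes.
    · rw [h]
      push_cast
      rw [show (l : ℂ) + 1 - l - 1 = 0 by ring, zero_smul]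
    · rw [vecOp_of_le (by push_cast at h; omega), smul_zero]

theorem lie_opF_vecOp_zero : ⁅opF, vecOp a 0⁆ = 0 := lie_opF_vecOp ha 0

theorem lie_opF_vecOp_succ (l : ℕ) :
    ⁅opF, vecOp a (l + 1)⁆ = ((a.j : ℂ) - l - 1) • vecOp a l := lie_opF_vecOp ha (l + 1)

theorem lie_opH₁_vecOp (l : ℕ) : ⁅opH₁, vecOp a l⁆ = ((l : ℂ) + 1) • vecOp a l :=
  lie_operatorOf_vecOp (fun a l => ((l : ℂ) + 1) • vecOp a l)
    (fun a l _ hl => by rw [vecOp_of_le hl, smul_zero]) ha l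

theorem lie_opH₂_vecOp (l : ℕ) : ⁅opH₂, vecOp a l⁆ = ((a.j : ℂ) - l) • vecOp a l :=
  lie_operatorOf_vecOp (fun a l => ((a.j : ℂ) - l) • vecOp a l)
    (fun a l _ hl => by rw [vecOp_of_le hl, smul_zero]) ha l

theorem lie_opH_vecOp (b : Index) (l : ℕ) :
    ⁅opH b, vecOp a l⁆ = -(((a.j : ℂ) - l) + b.j * ((l : ℂ) + 1)) • vecOp a l := by
  rw [opH, neg_lie, add_lie, smul_lie, lie_opH₁_vecOp ha, lie_opH₂_vecOp ha, smul_smul, ← add_smul,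
    neg_smul]

theorem lie_opLower_vecOp (b : Index) (l : ℕ) :
    ⁅opLower b, vecOp a l⁆ = opLowerCommutator b a l := by
  refine lie_operatorOf_vecOp (opLowerCommutator b) (fun a l h1 hl => ?_) ha l
  unfold opLowerCommutator
  split_ifs with hab
  · match l, hl with
    | 0, hl => push_cast at hl; omega
    -- The index `ℓ = 1` is out of range only for `j = 1`, where the factor `j - 1` is 0.
    | 1, hl =>
      have : b.j = 1 := by subst hab; push_cast at hl; omega
      simp [this]
    | _ + 2, _ => rfl
  · rfl

theorem lie_opLower_vecOp_ne {b : Index} (hab : a ≠ b) (l : ℕ) : ⁅opLower b, vecOp a l⁆ = 0 := by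
  rw [lie_opLower_vecOp ha]
  exact if_neg hab

theorem lie_opLower_vecOp_zero : ⁅opLower a, vecOp a 0⁆ = opH₂ + (a.j : ℂ) • opH₁ := by
  rw [lie_opLower_vecOp ha]
  exact if_pos rfl

theorem lie_opLower_vecOp_one : ⁅opLower a, vecOp a 1⁆ = -(((a.j : ℂ) - 1) • opE) := by
  rw [lie_opLower_vecOp ha]
  exact if_pos rfl

theorem lie_opLower_vecOp_add_two (l : ℕ) : ⁅opLower a, vecOp a (l + 2)⁆ = 0 := by
  rw [lie_opLower_vecOp ha]
  exact if_pos rfl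

end Commutators

theorem lie_one_eq_zero {P Q : Module.End ℂ Words} (hP : P 1 = 0) (hQ : Q 1 = 0) :
    ⁅P, Q⁆ 1 = 0 := by
  simp [Ring.lie_def, hP, hQ]

/-! ### The defining relations for the operators. -/

theorem lie_opH₁_opH₂ : ⁅opH₁, opH₂⁆ = 0 := by
  refine words_operator_eq_zero _ (lie_one_eq_zero (by simp) (by simp)) fun a l ha => ?_
  rw [lie_lie, lie_opH₁_vecOp ha, lie_opH₂_vecOp ha, lie_smul, lie_smul, lie_opH₁_vecOp ha,
    lie_opH₂_vecOp ha]
  module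

theorem lie_opH₁_opE : ⁅opH₁, opE⁆ = opE := by
  refine words_operator_ext (by rw [lie_one_eq_zero] <;> simp) fun a l ha => ?_
  rw [lie_lie, lie_opH₁_vecOp ha, lie_opE_vecOp ha, lie_smul, lie_smul, lie_opH₁_vecOp ha,
    lie_opE_vecOp ha]
  push_cast
  module

theorem lie_opH₂_opE : ⁅opH₂, opE⁆ = -opE := by
  refine words_operator_ext (by rw [lie_one_eq_zero] <;> simp) fun a l ha => ?_
  rw [lie_lie, neg_lie, lie_opH₂_vecOp ha, lie_opE_vecOp ha, lie_smul, lie_smul, lie_opH₂_vecOp ha,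
    lie_opE_vecOp ha]
  push_cast
  module

theorem lie_opH₁_opF : ⁅opH₁, opF⁆ = -opF := by
  refine words_operator_ext (by rw [lie_one_eq_zero] <;> simp) fun a l ha => ?_
  rw [lie_lie, neg_lie, lie_opH₁_vecOp ha, lie_smul]
  cases l with
  | zero => rw [lie_opF_vecOp_zero ha]; simp
  | succ l =>
    rw [lie_opF_vecOp_succ ha, lie_smul, lie_opH₁_vecOp ha]
    push_cast
    module

theorem lie_opH₂_opF : ⁅opH₂, opF⁆ = opF := by
  refine words_operator_ext (by rw [lie_one_eq_zero] <;> simp) fun a l ha => ?_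
  rw [lie_lie, lie_opH₂_vecOp ha, lie_smul]
  cases l with
  | zero => rw [lie_opF_vecOp_zero ha]; simp
  | succ l =>
    rw [lie_opF_vecOp_succ ha, lie_smul, lie_opH₂_vecOp ha]
    push_cast
    module

theorem lie_opE_opF : ⁅opE, opF⁆ = opH₁ - opH₂ := by
  refine words_operator_ext (by rw [lie_one_eq_zero] <;> simp) fun a l ha => ?_
  rw [lie_lie, sub_lie, lie_opH₁_vecOp ha, lie_opH₂_vecOp ha, lie_opE_vecOp ha, lie_smul,
    lie_opF_vecOp_succ ha]
  cases l with
  | zero =>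
    rw [lie_opF_vecOp_zero ha, lie_zero]
    push_cast
    module
  | succ l =>
    rw [lie_opF_vecOp_succ ha, lie_smul, lie_opE_vecOp ha]
    push_cast
    module

theorem lie_opH_opE (b : Index) : ⁅opH b, opE⁆ = -((b.j : ℂ) - 1) • opE := by
  rw [opH, neg_lie, add_lie, smul_lie, lie_opH₁_opE, lie_opH₂_opE]
  module

theorem lie_opH_opF (b : Index) : ⁅opH b, opF⁆ = ((b.j : ℂ) - 1) • opF := by
  rw [opH, neg_lie, add_lie, smul_lie, lie_opH₁_opF, lie_opH₂_opF]
  module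

theorem lie_opH_opH (a b : Index) : ⁅opH a, opH b⁆ = 0 := by
  have : ⁅opH₂, opH₁⁆ = 0 := by rw [← lie_skew, lie_opH₁_opH₂, neg_zero]
  simp only [opH, neg_lie, lie_neg, add_lie, lie_add, smul_lie, lie_smul, lie_self, lie_opH₁_opH₂,
    this]
  simp

theorem lie_opH₂_opH₁ : ⁅opH₂, opH₁⁆ = 0 := by rw [← lie_skew, lie_opH₁_opH₂, neg_zero]

theorem lie_opE_opH₁ : ⁅opE, opH₁⁆ = -opE := by rw [← lie_skew, lie_opH₁_opE]
theorem lie_opE_opH₂ : ⁅opE, opH₂⁆ = opE := by rw [← lie_skew, lie_opH₂_opE, neg_neg]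

theorem lie_opE_opLower {b : Index} (_ : 1 ≤ b.j) : ⁅opE, opLower b⁆ = 0 := by
  refine words_operator_eq_zero _ (by rw [lie_one_eq_zero] <;> simp) fun a l ha => ?_
  rw [lie_lie, lie_opE_vecOp ha, lie_smul]
  by_cases hab : a = b
  · subst hab
    match l with
    | 0 =>
      rw [lie_opLower_vecOp_zero ha, lie_opLower_vecOp_one ha, lie_add, lie_smul, lie_opE_opH₁,
        lie_opE_opH₂]
      push_cast
      module
    | 1 =>
      rw [lie_opLower_vecOp_one ha, lie_opLower_vecOp_add_two ha 0]
      simp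
    | l + 2 =>
      rw [lie_opLower_vecOp_add_two ha l, lie_opLower_vecOp_add_two ha (l + 1)]
      simp
  · simp [lie_opLower_vecOp_ne ha hab]

theorem lie_opH₁_opLower (b : Index) : ⁅opH₁, opLower b⁆ = -opLower b := by
  refine words_operator_ext (by rw [lie_one_eq_zero] <;> simp) fun a l ha => ?_
  rw [lie_lie, lie_opH₁_vecOp ha, lie_smul, neg_lie]
  by_cases hab : a = b
  · subst hab
    match l with
    | 0 =>
      rw [lie_opLower_vecOp_zero ha, lie_add, lie_smul, lie_self, lie_opH₁_opH₂]
      push_cast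
      module
    | 1 =>
      rw [lie_opLower_vecOp_one ha, lie_neg, lie_smul, lie_opH₁_opE]
      push_cast
      module
    | l + 2 =>
      rw [lie_opLower_vecOp_add_two ha l]
      simp
  · simp [lie_opLower_vecOp_ne ha hab]

theorem lie_opH₂_opLower (b : Index) : ⁅opH₂, opLower b⁆ = -((b.j : ℂ) • opLower b) := by
  refine words_operator_ext (by rw [lie_one_eq_zero] <;> simp) fun a l ha => ?_
  rw [lie_lie, lie_opH₂_vecOp ha, lie_smul, neg_lie, smul_lie]
  by_cases hab : a = b
  · subst hab
    match l with
    | 0 =>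
      rw [lie_opLower_vecOp_zero ha, lie_add, lie_smul, lie_self, lie_opH₂_opH₁]
      push_cast
      module
    | 1 =>
      rw [lie_opLower_vecOp_one ha, lie_neg, lie_smul, lie_opH₂_opE]
      push_cast
      module
    | l + 2 =>
      rw [lie_opLower_vecOp_add_two ha l]
      simp
  · simp [lie_opLower_vecOp_ne ha hab]

theorem lie_opH_opLower (a b : Index) :
    ⁅opH a, opLower b⁆ = ((b.j : ℂ) + a.j) • opLower b := by
  rw [opH, neg_lie, add_lie, smul_lie, lie_opH₁_opLower, lie_opH₂_opLower]
  module

theorem lie_weight_opLower (a : Index) (n : ℕ) :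
    ⁅opH₁ - opH₂, (LieAlgebra.ad ℂ _ opF ^ n) (opLower a)⁆ =
      ((a.j : ℂ) - 1 - 2 * n) • (LieAlgebra.ad ℂ _ opF ^ n) (opLower a) := by
  induction n with
  | zero =>
    simp only [pow_zero, Module.End.one_apply]
    rw [sub_lie, lie_opH₁_opLower, lie_opH₂_opLower]
    push_cast
    module
  | succ n ih =>
    rw [ad_pow_succ_apply, leibniz_lie, ih, sub_lie, lie_opH₁_opF, lie_opH₂_opF, lie_smul, sub_lie,
      neg_lie]
    push_cast
    module

/-- The operator `opLower a` commutes with `opE` and has weight `j - 1` under `opH₁ - opH₂`, so it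
is a highest weight vector and the standard formula for `e fⁿ⁺¹ v` applies. -/
theorem lie_opE_ad_opF_opLower {a : Index} (ha : 1 ≤ a.j) (n : ℕ) :
    ⁅opE, (LieAlgebra.ad ℂ _ opF ^ (n + 1)) (opLower a)⁆ =
      (((n : ℂ) + 1) * ((a.j : ℂ) - 1 - n)) • (LieAlgebra.ad ℂ _ opF ^ n) (opLower a) := by
  induction n with
  | zero =>
    rw [ad_pow_succ_apply, leibniz_lie, lie_opE_opF, lie_weight_opLower, pow_zero,
      Module.End.one_apply, lie_opE_opLower ha, lie_zero]
    push_cast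
    module
  | succ n ih =>
    rw [ad_pow_succ_apply, leibniz_lie, lie_opE_opF, lie_weight_opLower, ih, lie_smul,
      ad_pow_succ_apply]
    push_cast
    module

theorem lie_ad_opF_opLower_vecOp_zero (a : Index) {b : Index} (hb : 1 ≤ b.j) (n : ℕ) :
    ⁅(LieAlgebra.ad ℂ _ opF ^ n) (opLower a), vecOp b 0⁆ =
      (LieAlgebra.ad ℂ _ opF ^ n) ⁅opLower a, vecOp b 0⁆ := by
  induction n with
  | zero => simp
  | succ n ih =>
    rw [ad_pow_succ_apply, ad_pow_succ_apply, lie_lie, ih, lie_opF_vecOp_zero hb, lie_zero, sub_zero]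

theorem lie_opF_opH₁ : ⁅opF, opH₁⁆ = opF := by rw [← lie_skew, lie_opH₁_opF, neg_neg]
theorem lie_opF_opH₂ : ⁅opF, opH₂⁆ = -opF := by rw [← lie_skew, lie_opH₂_opF]

/-- For `j = n + 1` the previous formula shows that `(ad opF)ⁿ⁺¹ (opLower a)` commutes with `opE`.
As `opE` produces every letter of a string from the one with `ℓ = 0`, only commutators with these
initial letters need to vanish. There the result is 0 or `(ad opF)ⁿ (n opF)`, which is 0 because
either `n = 0` or `opF` commutes with itself. -/
theorem ad_opF_pow_opLower {a : Index} (ha : 1 ≤ a.j) :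
    (LieAlgebra.ad ℂ _ opF ^ a.j.toNat) (opLower a) = 0 := by
  obtain ⟨n, hn⟩ : ∃ n : ℕ, a.j = n + 1 := ⟨(a.j - 1).toNat, by omega⟩
  have hn' : a.j.toNat = n + 1 := by omega
  have hone : ∀ m, ((LieAlgebra.ad ℂ _ opF ^ m) (opLower a)) 1 = 0 := by
    intro m
    induction m with
    | zero => simp
    | succ m ih => rw [ad_pow_succ_apply]; exact lie_one_eq_zero opF_one ih
  rw [hn']
  have hE := lie_opE_ad_opF_opLower ha n
  rw [hn, show ((n + 1 : ℤ) : ℂ) - 1 - n = 0 by push_cast; ring, mul_zero, zero_smul] at hE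
  refine words_operator_eq_zero _ (hone _) fun b l hb => ?_
  induction l with
  | zero =>
    rw [lie_ad_opF_opLower_vecOp_zero a hb]
    by_cases hab : b = a
    · subst hab
      rw [lie_opLower_vecOp_zero hb]
      have h1 : ⁅opF, opH₂ + (b.j : ℂ) • opH₁⁆ = (n : ℂ) • opF := by
        rw [lie_add, lie_smul, lie_opF_opH₁, lie_opF_opH₂, hn]
        push_cast
        module
      rw [pow_succ, Module.End.mul_apply, LieAlgebra.ad_apply, h1, map_smul]
      cases n with
      | zero => simp
      | succ n => rw [pow_succ, Module.End.mul_apply, LieAlgebra.ad_apply, lie_self]; simp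
    · rw [lie_opLower_vecOp_ne hb hab, map_zero]
  | succ l ih =>
    have h0 : (l : ℂ) + 1 ≠ 0 := by exact_mod_cast Nat.succ_ne_zero l
    have h2 : vecOp b (l + 1) = ((l : ℂ) + 1)⁻¹ • ⁅opE, vecOp b l⁆ := by
      rw [lie_opE_vecOp hb, smul_smul, inv_mul_cancel₀ h0, one_smul]
    rw [h2, lie_smul, leibniz_lie, ← lie_skew _ opE, hE, ih]
    simp

open Classical in
/-- The representation of the free Lie algebra on `Words`. -/
def wordRep : Free →ₗ⁅ℂ⁆ Module.End ℂ Words :=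
  FreeLieAlgebra.lift ℂ fun
    | .e a => if a = idxNeg then opE else vecOp a 0
    | .f a => if a = idxNeg then opF else opLower a
    | .h a => opH a

theorem ne_idxNeg {a : Index} (ha : 1 ≤ a.j) : a ≠ idxNeg := by
  rintro rfl
  simp [idxNeg] at ha

theorem wordRep_e_neg : wordRep (genE idxNeg) = opE :=
  (FreeLieAlgebra.lift_of_apply _ _).trans (if_pos rfl)
theorem wordRep_f_neg : wordRep (genF idxNeg) = opF :=
  (FreeLieAlgebra.lift_of_apply _ _).trans (if_pos rfl)
theorem wordRep_e {a : Index} (ha : 1 ≤ a.j) : wordRep (genE a) = vecOp a 0 :=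
  (FreeLieAlgebra.lift_of_apply _ _).trans (if_neg (ne_idxNeg ha))
theorem wordRep_f {a : Index} (ha : 1 ≤ a.j) : wordRep (genF a) = opLower a :=
  (FreeLieAlgebra.lift_of_apply _ _).trans (if_neg (ne_idxNeg ha))
theorem wordRep_h (a : Index) : wordRep (genH a) = opH a :=
  FreeLieAlgebra.lift_of_apply _ _

theorem ad_opE_pow_vecOp {a : Index} (ha : 1 ≤ a.j) (l : ℕ) :
    (LieAlgebra.ad ℂ _ opE ^ l) (vecOp a 0) = (l.factorial : ℂ) • vecOp a l := by
  induction l with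
  | zero => simp
  | succ l ih =>
    rw [ad_pow_succ_apply, ih, lie_smul, lie_opE_vecOp ha, smul_smul, Nat.factorial_succ]
    push_cast
    rw [mul_comm]

theorem killsRelators_wordRep : KillsRelators wordRep := by
  intro x hx
  induction hx with
  | hh a b => rw [LieHom.map_lie, wordRep_h, wordRep_h, lie_opH_opH]
  | he a b =>
    rw [map_sub, map_smul, LieHom.map_lie, wordRep_h]
    rcases eq_idxNeg_or b with rfl | hb
    · rw [wordRep_e_neg, lie_opH_opE]
      simp only [cartan, idxNeg]
      push_cast
      module
    · rw [wordRep_e hb, lie_opH_vecOp hb]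
      simp only [cartan]
      push_cast
      module
  | hf a b =>
    rw [map_add, map_smul, LieHom.map_lie, wordRep_h]
    rcases eq_idxNeg_or b with rfl | hb
    · rw [wordRep_f_neg, lie_opH_opF]
      simp only [cartan, idxNeg]
      push_cast
      module
    · rw [wordRep_f hb, lie_opH_opLower]
      simp only [cartan]
      push_cast
      module
  | ef_self a =>
    rw [map_sub, LieHom.map_lie, wordRep_h, opH]
    rcases eq_idxNeg_or a with rfl | ha
    · rw [wordRep_e_neg, wordRep_f_neg, lie_opE_opF]
      simp only [idxNeg]
      push_cast
      module
    · rw [wordRep_e ha, wordRep_f ha, ← lie_skew, lie_opLower_vecOp_zero ha]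
      module
  | ef_ne a b hab =>
    rw [LieHom.map_lie]
    rcases eq_idxNeg_or a with rfl | ha
    · rcases eq_idxNeg_or b with rfl | hb
      · exact absurd rfl hab
      · rw [wordRep_e_neg, wordRep_f hb, lie_opE_opLower hb]
    · rcases eq_idxNeg_or b with rfl | hb
      · rw [wordRep_e ha, wordRep_f_neg, ← lie_skew, lie_opF_vecOp_zero ha, neg_zero]
      · rw [wordRep_e ha, wordRep_f hb, ← lie_skew, lie_opLower_vecOp_ne ha hab, neg_zero]
  | serre_e a ha =>
    rw [map_ad_pow, wordRep_e_neg, wordRep_e ha, ad_opE_pow_vecOp ha, vecOp_of_le (by omega),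
      smul_zero]
  | serre_f a ha =>
    rw [map_ad_pow, wordRep_f_neg, wordRep_f ha, ad_opF_pow_opLower ha]

/-! ### Locally ad-nilpotent elements of free algebras -/

section FreeAlgebraNilpotent

variable {X : Type*}

/-- Words in `s` and `t` are no longer than `u` and `v`. Two of them with product `u v` must then
have exactly these lengths, and a word splits uniquely at a given position. -/
theorem coeff_mul_of_length_le (s t : MonoidAlgebra ℂ (FreeMonoid X)) (u v : FreeMonoid X)
    (hs : ∀ w ∈ s.coeff.support, w.length ≤ u.length)
    (ht : ∀ w ∈ t.coeff.support, w.length ≤ v.length) :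
    (s * t).coeff (u * v) = s.coeff u * t.coeff v := by
  classical
  have key : ∀ a ∈ s.coeff.support, ∀ b ∈ t.coeff.support, a * b = u * v → a = u ∧ b = v := by
    intro a ha b hb hab
    have h1 := hs a ha
    have h2 := ht b hb
    have h3 := congrArg FreeMonoid.length hab
    rw [FreeMonoid.length_mul, FreeMonoid.length_mul] at h3
    exact List.append_inj hab (show a.length = u.length by omega)
  rw [MonoidAlgebra.coeff_mul, Finsupp.sum, Finset.sum_eq_single u]
  · rw [Finsupp.sum, Finset.sum_eq_single v]
    · simp
    · intro b hb hbv
      rw [if_neg]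
      intro h
      exact hbv (mul_left_cancel h)
    · intro hv
      simp [Finsupp.notMem_support_iff.1 hv]
  · intro a ha hau
    refine Finset.sum_eq_zero fun b hb => if_neg fun h => hau (key a ha b hb h).1
  · intro hu
    refine Finset.sum_eq_zero fun b hb => ?_
    simp [Finsupp.notMem_support_iff.1 hu]

theorem length_le_of_mem_support_mul {s t : MonoidAlgebra ℂ (FreeMonoid X)} {m n : ℕ}
    (hs : ∀ w ∈ s.coeff.support, w.length ≤ m) (ht : ∀ w ∈ t.coeff.support, w.length ≤ n) :
    ∀ w ∈ (s * t).coeff.support, w.length ≤ m + n := by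
  classical
  intro w hw
  rw [Finsupp.mem_support_iff, MonoidAlgebra.coeff_mul] at hw
  obtain ⟨a, ha, hw⟩ := Finset.exists_ne_zero_of_sum_ne_zero hw
  obtain ⟨b, hb, hw⟩ := Finset.exists_ne_zero_of_sum_ne_zero hw
  have hab : a * b = w := by
    by_contra h
    exact hw (if_neg h)
  rw [← hab, FreeMonoid.length_mul]
  exact add_le_add (hs a ha) (ht b hb)

-- Let `u = x₀ w` be at least as long as every word of `t`, and let `y ≠ x₀`. The coefficient of `uⁿ
-- y` in `(ad t)ⁿ y` comes only from multiplying by `t` on the left each time, so it is the `n`-th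
-- power of the coefficient of `u`. The statement covers every last letter `x`, because the
-- induction needs the vanishing at `x = x₀`.
open Classical in
theorem coeff_ad_pow_letter {t : MonoidAlgebra ℂ (FreeMonoid X)} {x₀ y : X} (hy : y ≠ x₀)
    {w : FreeMonoid X}
    (ht : ∀ v ∈ t.coeff.support, v.length ≤ (FreeMonoid.of x₀ * w).length) (n : ℕ) :
    (∀ v ∈ ((LieAlgebra.ad ℂ _ t ^ n)
        (MonoidAlgebra.of ℂ (FreeMonoid X) (FreeMonoid.of y))).coeff.support,
      v.length ≤ n * (FreeMonoid.of x₀ * w).length + 1) ∧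
    ∀ x, ((LieAlgebra.ad ℂ _ t ^ n) (MonoidAlgebra.of ℂ (FreeMonoid X) (FreeMonoid.of y))).coeff
      ((FreeMonoid.of x₀ * w) ^ n * FreeMonoid.of x) =
        if x = y then t.coeff (FreeMonoid.of x₀ * w) ^ n else 0 := by
  have hlen : ∀ (u : FreeMonoid X) (n : ℕ), (u ^ n).length = n * u.length := by
    intro u n
    induction n with
    | zero => simp
    | succ n ih => rw [pow_succ, FreeMonoid.length_mul, ih]; ring
  induction n with
  | zero =>
    constructor
    · intro v hv
      simp only [pow_zero, Module.End.one_apply, MonoidAlgebra.of_apply,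
        MonoidAlgebra.coeff_single] at hv
      have := Finsupp.support_single_subset hv
      rw [Finset.mem_singleton] at this
      rw [this]
      simp
    · intro x
      simp only [pow_zero, Module.End.one_apply, MonoidAlgebra.of_apply,
        MonoidAlgebra.coeff_single, one_mul]
      rw [Finsupp.single_apply]
      by_cases h : x = y
      · simp [h]
      · rw [if_neg h, if_neg]
        intro h'
        exact h (FreeMonoid.of_injective h').symm
  | succ n ih =>
    obtain ⟨ih1, ih2⟩ := ih
    set S := (LieAlgebra.ad ℂ _ t ^ n) (MonoidAlgebra.of ℂ (FreeMonoid X) (FreeMonoid.of y))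
    have hS : (LieAlgebra.ad ℂ _ t ^ (n + 1))
        (MonoidAlgebra.of ℂ (FreeMonoid X) (FreeMonoid.of y)) = t * S - S * t := by
      rw [ad_pow_succ_apply, Ring.lie_def]
    rw [hS]
    have hlenS : ∀ x : X, n * (FreeMonoid.of x₀ * w).length + 1 =
        ((FreeMonoid.of x₀ * w) ^ n * FreeMonoid.of x).length := by
      intro x
      rw [FreeMonoid.length_mul _ (FreeMonoid.of x), hlen, FreeMonoid.length_of]
    constructor
    · intro v hv
      have hv' : v ∈ (t * S).coeff.support ∨ v ∈ (S * t).coeff.support := by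
        by_contra! h
        rw [Finsupp.notMem_support_iff, Finsupp.notMem_support_iff] at h
        rw [Finsupp.mem_support_iff] at hv
        apply hv
        simp [h.1, h.2]
      rcases hv' with h | h
      · have := length_le_of_mem_support_mul ht ih1 v h
        linarith
      · have := length_le_of_mem_support_mul ih1 ht v h
        linarith
    · intro x
      have h1 : (t * S).coeff ((FreeMonoid.of x₀ * w) ^ (n + 1) * FreeMonoid.of x) =
          t.coeff (FreeMonoid.of x₀ * w) *
            S.coeff ((FreeMonoid.of x₀ * w) ^ n * FreeMonoid.of x) := by
        rw [pow_succ', mul_assoc]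
        exact coeff_mul_of_length_le _ _ _ _ ht fun v hv => (hlenS x) ▸ ih1 v hv
      -- In `S * t` the target word must be cut after `uⁿ x₀`, whose coefficient in `S` is 0 by
      -- induction since `x₀ ≠ y`.
      have h2 : (S * t).coeff ((FreeMonoid.of x₀ * w) ^ (n + 1) * FreeMonoid.of x) =
          S.coeff ((FreeMonoid.of x₀ * w) ^ n * FreeMonoid.of x₀) *
            t.coeff (w * FreeMonoid.of x) := by
        rw [pow_succ, show (FreeMonoid.of x₀ * w) ^ n * (FreeMonoid.of x₀ * w) * FreeMonoid.of x =
          ((FreeMonoid.of x₀ * w) ^ n * FreeMonoid.of x₀) * (w * FreeMonoid.of x) by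
            simp only [mul_assoc]]
        refine coeff_mul_of_length_le _ _ _ _ (fun v hv => (hlenS x₀) ▸ ih1 v hv) fun v hv => ?_
        have := ht v hv
        rw [FreeMonoid.length_mul, FreeMonoid.length_of] at this ⊢
        omega
      rw [MonoidAlgebra.coeff_sub, Finsupp.sub_apply, h1, h2, ih2, ih2, if_neg (Ne.symm hy)]
      by_cases h : x = y
      · simp [h, pow_succ']
      · simp [h]

open Classical in
/-- An element of the augmentation ideal of a free algebra that acts ad-nilpotently on two
different letters vanishes. -/
theorem freeAlgebra_eq_zero_of_ad_nilpotent {t : FreeAlgebra ℂ X}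
    (ht : FreeAlgebra.algebraMapInv t = 0) {y z : X} (hyz : y ≠ z)
    (hy : ∃ n, (LieAlgebra.ad ℂ (FreeAlgebra ℂ X) t ^ n) (FreeAlgebra.ι ℂ y) = 0)
    (hz : ∃ n, (LieAlgebra.ad ℂ (FreeAlgebra ℂ X) t ^ n) (FreeAlgebra.ι ℂ z) = 0) : t = 0 := by
  by_contra hne
  set Φ := FreeAlgebra.equivMonoidAlgebraFreeMonoid (R := ℂ) (X := X)
  have hne' : (Φ t).coeff.support.Nonempty := by
    rw [Finsupp.support_nonempty_iff]
    intro h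
    rw [MonoidAlgebra.coeff_eq_zero] at h
    exact hne (by simpa using h)
  obtain ⟨u, hu, hmax⟩ := Finset.exists_max_image _ FreeMonoid.length hne'
  have htrans : ∀ x, (∃ n, (LieAlgebra.ad ℂ (FreeAlgebra ℂ X) t ^ n) (FreeAlgebra.ι ℂ x) = 0) →
      ∃ n, (LieAlgebra.ad ℂ _ (Φ t) ^ n)
        (MonoidAlgebra.of ℂ (FreeMonoid X) (FreeMonoid.of x)) = 0 := by
    rintro x ⟨n, hn⟩
    refine ⟨n, ?_⟩
    have h := map_ad_pow Φ.toAlgHom.toLieHom t (FreeAlgebra.ι ℂ x) n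
    rw [hn, map_zero] at h
    have h2 : Φ.toAlgHom.toLieHom (FreeAlgebra.ι ℂ x) =
        MonoidAlgebra.of ℂ (FreeMonoid X) (FreeMonoid.of x) := by
      change FreeAlgebra.lift ℂ _ (FreeAlgebra.ι ℂ x) = _
      rw [FreeAlgebra.lift_ι_apply]
    rw [h2] at h
    exact h.symm
  induction u using FreeMonoid.casesOn with
  | one =>
    -- If a longest word is empty, then `t` is a scalar, and the augmentation hypothesis makes it 0.
    have h1 : Φ t = MonoidAlgebra.single 1 ((Φ t).coeff 1) := by
      ext v
      rw [MonoidAlgebra.coeff_single, Finsupp.single_apply]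
      split_ifs with h
      · rw [h]
      · by_contra hv
        have := hmax v (Finsupp.mem_support_iff.2 hv)
        rw [FreeMonoid.length_one, Nat.le_zero, FreeMonoid.length_eq_zero] at this
        exact h this.symm
    have h2 : t = algebraMap ℂ _ ((Φ t).coeff 1) := by
      apply Φ.injective
      rw [AlgEquiv.commutes]
      exact h1
    rw [h2, FreeAlgebra.algebraMap_leftInverse] at ht
    rw [ht, map_zero] at h2
    exact hne h2
  | of_mul x₀ w =>
    have main : ∀ y, y ≠ x₀ →
        (∃ n, (LieAlgebra.ad ℂ (FreeAlgebra ℂ X) t ^ n) (FreeAlgebra.ι ℂ y) = 0) → False := by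
      intro y hyx hy
      obtain ⟨n, hn⟩ := htrans y hy
      have := (coeff_ad_pow_letter hyx hmax n).2 y
      rw [hn, if_pos rfl] at this
      exact pow_ne_zero n (Finsupp.mem_support_iff.1 hu) this.symm
    -- At least one of two different letters differs from the initial letter of the longest word.
    by_cases h : y = x₀
    · exact main z (fun h' => hyz (h.trans h'.symm)) hz
    · exact main y h hy

end FreeAlgebraNilpotent

/-! ### Integral eigenvalue decompositions -/

section Graded

variable {V : Type*} [AddCommGroup V] [Module ℂ V]

/-- The sum of the eigenspaces of `D` for the eigenvalues in `S`. -/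
def gradedPart (D : Module.End ℂ V) (S : Set ℤ) : Submodule ℂ V :=
  ⨆ d ∈ S, Module.End.eigenspace D (d : ℂ)

theorem mem_gradedPart {D : Module.End ℂ V} {S : Set ℤ} {d : ℤ} (hd : d ∈ S) {x : V}
    (hx : D x = (d : ℂ) • x) : x ∈ gradedPart D S :=
  Submodule.mem_iSup_of_mem d (Submodule.mem_iSup_of_mem hd (Module.End.mem_eigenspace_iff.2 hx))

theorem gradedPart_mono {D : Module.End ℂ V} {S T : Set ℤ} (h : S ⊆ T) :
    gradedPart D S ≤ gradedPart D T :=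
  biSup_mono h

theorem gradedPart_le {D : Module.End ℂ V} {S : Set ℤ} {N : Submodule ℂ V}
    (h : ∀ d ∈ S, ∀ x, D x = (d : ℂ) • x → x ∈ N) : gradedPart D S ≤ N :=
  iSup₂_le fun d hd x hx => h d hd x (Module.End.mem_eigenspace_iff.1 hx)

theorem disjoint_gradedPart (D : Module.End ℂ V) {S T : Set ℤ} (h : Disjoint S T) :
    Disjoint (gradedPart D S) (gradedPart D T) := by
  have := (Module.End.eigenspaces_iSupIndep D).comp (Int.cast_injective (α := ℂ))
  exact this.disjoint_biSup_biSup h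

theorem eq_zero_of_mem_gradedPart {D : Module.End ℂ V} {S T : Set ℤ} (h : Disjoint S T) {x : V}
    (hS : x ∈ gradedPart D S) (hT : x ∈ gradedPart D T) : x = 0 :=
  Submodule.disjoint_def.1 (disjoint_gradedPart D h) x hS hT

theorem gradedPart_neg_le (D : Module.End ℂ V) (S : Set ℤ) :
    gradedPart (-D) S ≤ gradedPart D {d | -d ∈ S} := by
  refine gradedPart_le fun d hd x hx => mem_gradedPart (d := -d) (by simpa using hd) ?_
  rw [LinearMap.neg_apply, neg_eq_iff_eq_neg] at hx
  rw [hx]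
  push_cast
  module

variable {L : Type*} [LieRing L] [LieAlgebra ℂ L]

theorem lie_mem_gradedPart {H : L} {S T U : Set ℤ} (h : ∀ s ∈ S, ∀ t ∈ T, s + t ∈ U) {x y : L}
    (hx : x ∈ gradedPart (LieAlgebra.ad ℂ L H) S) (hy : y ∈ gradedPart (LieAlgebra.ad ℂ L H) T) :
    ⁅x, y⁆ ∈ gradedPart (LieAlgebra.ad ℂ L H) U := by
  have h1 : gradedPart (LieAlgebra.ad ℂ L H) S ≤ (gradedPart (LieAlgebra.ad ℂ L H) U).comap
      (LieAlgebra.ad ℂ L (-y)) := by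
    refine gradedPart_le fun s hs x hx => ?_
    have h2 : gradedPart (LieAlgebra.ad ℂ L H) T ≤ (gradedPart (LieAlgebra.ad ℂ L H) U).comap
        (LieAlgebra.ad ℂ L x) := by
      refine gradedPart_le fun t ht y hy => mem_gradedPart (h s hs t ht) ?_
      rw [LieAlgebra.ad_apply] at hx hy
      rw [LieAlgebra.ad_apply, LieAlgebra.ad_apply, leibniz_lie, hx, hy, smul_lie, lie_smul]
      push_cast
      module
    have := h2 hy
    rw [Submodule.mem_comap, LieAlgebra.ad_apply] at this ⊢
    rwa [neg_lie, lie_skew]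
  have := h1 hx
  rwa [Submodule.mem_comap, LieAlgebra.ad_apply, neg_lie, lie_skew] at this

end Graded

/-! ### The kernel of the representation -/

/-- Lift of `e_{ℓ,jk}`. -/
def freeVec (l : ℕ) (a : Index) : Free := posVec LieHom.id l a

theorem map_freeVec {L : Type*} [LieRing L] [LieAlgebra ℂ L] (p : Free →ₗ⁅ℂ⁆ L) (l : ℕ)
    (a : Index) : p (freeVec l a) = posVec p l a := by
  rw [freeVec, posVec, posVec, map_smul, map_ad_pow]
  rfl

theorem posVec_wordRep {a : Index} (ha : 1 ≤ a.j) (l : ℕ) : posVec wordRep l a = vecOp a l := by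
  have : (l.factorial : ℂ) ≠ 0 := by exact_mod_cast l.factorial_ne_zero
  rw [posVec, wordRep_e_neg, wordRep_e ha, ad_opE_pow_vecOp ha, smul_smul, inv_mul_cancel₀ this,
    one_smul]

theorem algebraMapInv_vec (a : Index) (l : ℕ) :
    FreeAlgebra.algebraMapInv (vec a l) = (0 : ℂ) := by
  rw [vec]
  split_ifs
  · simp [FreeAlgebra.algebraMapInv]
  · simp

theorem wordRep_genH₁ : wordRep genH₁ = opH₁ := by
  simp only [genH₁, map_smul, map_sub, wordRep_h, opH, idxNeg, idxOne]
  push_cast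
  module

theorem wordRep_genH₂ : wordRep genH₂ = opH₂ := by
  simp only [genH₂, map_smul, map_add, map_neg, wordRep_h, opH, idxNeg, idxOne]
  push_cast
  module

/-- Left multiplication by a letter raises the `opH₁ + opH₂` degree by `(ℓ + 1) + (j - ℓ) = j + 1`,
so nonempty words have positive degree and only constants have degree 0. -/
theorem eq_algebraMap_of_degree_zero {s : Words} (hs : (opH₁ + opH₂) s = 0) :
    s = algebraMap ℂ Words (FreeAlgebra.algebraMapInv s) := by
  set N := gradedPart (opH₁ + opH₂) (Set.Ici 1)
  have hb : ∀ (b : Letter) (t : Words), (opH₁ + opH₂) (FreeAlgebra.ι ℂ b * t) =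
      ((b.1.1.j : ℂ) + 1) • (FreeAlgebra.ι ℂ b * t) +
        FreeAlgebra.ι ℂ b * (opH₁ + opH₂) t := by
    rintro ⟨⟨a, l⟩, hb⟩ t
    have h1 : ⁅opH₁ + opH₂, vecOp a l⁆ = ((a.j : ℂ) + 1) • vecOp a l := by
      rw [add_lie, lie_opH₁_vecOp hb.1, lie_opH₂_vecOp hb.1]
      module
    rw [vecOp, vec_of_lt hb] at h1
    have := congrArg (fun Q : Module.End ℂ Words => Q t) h1
    simp only [Ring.lie_def, LinearMap.sub_apply, Module.End.mul_apply, leftMul_apply,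
      LinearMap.smul_apply] at this
    rw [sub_eq_iff_eq_add] at this
    exact this
  -- Constants plus positive degrees form a subspace stable under left multiplication, so it
  -- contains `s * 1`.
  have key : ∀ t : Words, ∀ r ∈ Submodule.span ℂ {(1 : Words)} ⊔ N,
      t * r ∈ Submodule.span ℂ {(1 : Words)} ⊔ N := by
    intro t
    induction t using FreeAlgebra.induction with
    | grade0 c =>
      intro r hr
      rw [Algebra.algebraMap_eq_smul_one, smul_mul_assoc, one_mul]
      exact Submodule.smul_mem _ _ hr
    | grade1 b =>
      intro r hr
      refine Submodule.mem_sup_right ?_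
      have h1 : ∀ (d : ℤ) (n : Words), 0 ≤ d → (opH₁ + opH₂) n = (d : ℂ) • n →
          FreeAlgebra.ι ℂ b * n ∈ N := by
        intro d n hd hn
        have := b.2.1
        refine mem_gradedPart (d := d + b.1.1.j + 1) (by simp; omega) ?_
        rw [hb, hn, mul_smul_comm]
        push_cast
        module
      obtain ⟨u, hu, n, hn, rfl⟩ := Submodule.mem_sup.1 hr
      rw [mul_add]
      refine add_mem ?_ ?_
      · obtain ⟨c, rfl⟩ := Submodule.mem_span_singleton.1 hu
        exact h1 0 _ le_rfl (by simp)
      · have : N ≤ N.comap (leftMul (FreeAlgebra.ι ℂ b)) := by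
          refine gradedPart_le fun d hd x hx => h1 d x ?_ hx
          have : (1 : ℤ) ≤ d := hd
          omega
        exact this hn
    | mul u v hu hv => intro r hr; rw [mul_assoc]; exact hu _ (hv _ hr)
    | add u v hu hv => intro r hr; rw [add_mul]; exact add_mem (hu _ hr) (hv _ hr)
  have h1 := key s 1 (Submodule.mem_sup_left (Submodule.mem_span_singleton_self _))
  rw [mul_one] at h1
  obtain ⟨u, hu, n, hn, hun⟩ := Submodule.mem_sup.1 h1
  obtain ⟨c, rfl⟩ := Submodule.mem_span_singleton.1 hu
  have hn0 : (opH₁ + opH₂) n = 0 := by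
    rw [← hun, map_add, map_smul] at hs
    simpa using hs
  have : n = 0 := by
    refine eq_zero_of_mem_gradedPart (S := {0}) (by simp)
      (mem_gradedPart (d := 0) (Set.mem_singleton 0) ?_) hn
    rw [hn0, Int.cast_zero, zero_smul]
  rw [← hun, this]
  simp [Algebra.algebraMap_eq_smul_one]

theorem leftMul_of_mem_posSubalgebra {Q : Module.End ℂ Words} (hQ : Q ∈ posSubalgebra wordRep) :
    ∃ t : Words, Q = leftMul t ∧ FreeAlgebra.algebraMapInv t = (0 : ℂ) := by
  induction hQ using LieSubalgebra.lieSpan_induction with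
  | mem x hx =>
    obtain ⟨a, l, ha, rfl⟩ := hx
    exact ⟨vec a l, posVec_wordRep ha l, algebraMapInv_vec a l⟩
  | zero => exact ⟨0, by simp, by simp⟩
  | add x y _ _ hx hy =>
    obtain ⟨s, rfl, hs⟩ := hx
    obtain ⟨t, rfl, ht⟩ := hy
    exact ⟨s + t, by simp, by simp [hs, ht]⟩
  | smul r x _ hx =>
    obtain ⟨s, rfl, hs⟩ := hx
    exact ⟨r • s, by simp, by simp [hs]⟩
  | lie x y _ _ hx hy =>
    obtain ⟨s, rfl, hs⟩ := hx
    obtain ⟨t, rfl, ht⟩ := hy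
    exact ⟨⁅s, t⁆, (leftMul_lie s t).symm, by simp [Ring.lie_def, hs, ht]⟩

theorem ad_pow_apply_one {P Q : Module.End ℂ Words} (hP : P 1 = 0) (hQ : Q 1 = 0) (n : ℕ) :
    ((LieAlgebra.ad ℂ _ P ^ n) Q) 1 = 0 := by
  induction n with
  | zero => simpa using hQ
  | succ n ih => rw [ad_pow_succ_apply]; exact lie_one_eq_zero hP ih

theorem apply_one_of_mem_negSubalgebra {Q : Module.End ℂ Words}
    (hQ : Q ∈ posSubalgebra (wordRep.comp chevalley)) : Q 1 = 0 := by
  induction hQ using LieSubalgebra.lieSpan_induction with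
  | mem x hx =>
    obtain ⟨a, l, ha, rfl⟩ := hx
    rw [posVec, LinearMap.smul_apply, LieHom.comp_apply, LieHom.comp_apply, chevalley_genE,
      chevalley_genE, wordRep_f_neg, wordRep_f ha, ad_pow_apply_one (by simp) (by simp), smul_zero]
  | zero => simp
  | add x y _ _ hx hy => rw [LinearMap.add_apply, hx, hy, add_zero]
  | smul r x _ hx => rw [LinearMap.smul_apply, hx, smul_zero]
  | lie x y _ _ hx hy => exact lie_one_eq_zero hx hy

theorem apply_one_of_mem_levi {Q : Module.End ℂ Words} (hQ : Q ∈ levi wordRep) : Q 1 = 0 := by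
  induction hQ using Submodule.span_induction with
  | mem x hx =>
    rcases hx with (rfl | rfl) | ⟨a, rfl⟩
    · rw [wordRep_e_neg, opE_one]
    · rw [wordRep_f_neg, opF_one]
    · dsimp only
      rw [wordRep_h, opH_one]
  | zero => simp
  | add x y _ _ hx hy => rw [LinearMap.add_apply, hx, hy, add_zero]
  | smul r x _ hx => rw [LinearMap.smul_apply, hx, smul_zero]

/-- In the triangular decomposition of `wordRep x`, the negative and Levi parts kill 1, and the
positive part is left multiplication by an element of the augmentation ideal. -/
theorem algebraMapInv_wordRep_apply_one (x : Free) :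
    FreeAlgebra.algebraMapInv (wordRep x 1) = (0 : ℂ) := by
  obtain ⟨u', hu', v, hv, huv⟩ := Submodule.mem_sup.1 (killsRelators_wordRep.mem_triangular x)
  obtain ⟨u, hu, w, hw, rfl⟩ := Submodule.mem_sup.1 hu'
  obtain ⟨t, rfl, ht⟩ := leftMul_of_mem_posSubalgebra hv
  rw [← huv, LinearMap.add_apply, LinearMap.add_apply, apply_one_of_mem_negSubalgebra hu,
    apply_one_of_mem_levi hw]
  simpa using ht

/-! ### Descent of the representation to `𝔪`. -/

theorem relatorIdeal_le_ker {L : Type*} [LieRing L] [LieAlgebra ℂ L] {p : Free →ₗ⁅ℂ⁆ L}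
    (hp : KillsRelators p) {x : Free} (hx : x ∈ relatorIdeal) : p x = 0 := by
  have : relatorIdeal ≤ p.ker :=
    LieSubmodule.lieSpan_le.2 fun y hy => (LieHom.mem_ker (f := p)).2 (hp y hy)
  exact (LieHom.mem_ker (f := p)).1 (this hx)

/-- The canonical map from the free Lie algebra to `𝔤(A)`. -/
def borcherdsProj : Free →ₗ⁅ℂ⁆ BorcherdsAlgebra where
  toFun x := LieSubmodule.Quotient.mk x
  map_add' _ _ := rfl
  map_smul' _ _ := rfl
  map_lie' := rfl

theorem borcherdsProj_eq_zero_iff {x : Free} : borcherdsProj x = 0 ↔ x ∈ relatorIdeal :=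
  LieSubmodule.Quotient.mk_eq_zero' (N := relatorIdeal)

theorem killsRelators_borcherdsProj : KillsRelators borcherdsProj := fun _ hy =>
  borcherdsProj_eq_zero_iff.2 (LieSubmodule.subset_lieSpan hy)

theorem proj_eq_zero_iff {x : Free} : proj x = 0 ↔ ∀ y : Free, ⁅y, x⁆ ∈ relatorIdeal := by
  change (LieSubmodule.Quotient.mk (LieSubmodule.Quotient.mk x : BorcherdsAlgebra) : Monster) = 0 ↔ _
  rw [LieSubmodule.Quotient.mk_eq_zero', LieModule.mem_maxTrivSubmodule]
  constructor
  · intro h y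
    have := h (LieSubmodule.Quotient.mk y)
    rw [← LieSubmodule.Quotient.mk_bracket] at this
    exact (LieSubmodule.Quotient.mk_eq_zero' (N := relatorIdeal)).1 this
  · intro h z
    obtain ⟨y, rfl⟩ := LieSubmodule.Quotient.surjective_mk' _ z
    exact (LieSubmodule.Quotient.mk_eq_zero' (N := relatorIdeal)).2 (h y)

/-- Elements killed by `proj` are central in `𝔤(A)`. Their operators commute with letters, hence are
right multiplications by their value at 1. Commuting with `h₁ + h₂` puts that value in degree 0, so
it is a constant, and its constant term is 0. -/
theorem wordRep_eq_zero_of_proj {x : Free} (hx : proj x = 0) : wordRep x = 0 := by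
  rw [proj_eq_zero_iff] at hx
  have hcomm : ∀ y, ⁅wordRep x, wordRep y⁆ = 0 := by
    intro y
    rw [← lie_skew, ← LieHom.map_lie, relatorIdeal_le_ker killsRelators_wordRep (hx y), neg_zero]
  have hmul := operator_apply_eq_mul (wordRep x) <| by
    rintro ⟨⟨a, l⟩, hb⟩
    rw [← vec_of_lt hb]
    change ⁅wordRep x, vecOp a l⁆ = 0
    rw [← posVec_wordRep hb.1, ← map_freeVec, hcomm]
  have h0 : (opH₁ + opH₂) (wordRep x 1) = 0 := by
    have h : ⁅wordRep (genH₁ + genH₂), wordRep x⁆ = 0 := by rw [← lie_skew, hcomm, neg_zero]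
    have := congrArg (fun Q : Module.End ℂ Words => Q 1) h
    simpa [Ring.lie_def, wordRep_genH₁, wordRep_genH₂] using this
  have h1 := eq_algebraMap_of_degree_zero h0
  rw [algebraMapInv_wordRep_apply_one, map_zero] at h1
  ext t
  rw [hmul, h1, mul_zero, LinearMap.zero_apply]

theorem chevalley_mem_relatorIdeal {x : Free} (hx : x ∈ relatorIdeal) :
    chevalley x ∈ relatorIdeal :=
  borcherdsProj_eq_zero_iff.1 (relatorIdeal_le_ker killsRelators_borcherdsProj.comp_chevalley hx)

theorem proj_chevalley_eq_zero {x : Free} (hx : proj x = 0) : proj (chevalley x) = 0 := by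
  rw [proj_eq_zero_iff] at hx ⊢
  intro y
  have := chevalley_mem_relatorIdeal (hx (chevalley y))
  rwa [LieHom.map_lie, chevalley_chevalley] at this

/-! ### Locally ad-nilpotent elements have degree zero -/

/-- The index `(2, 1)`. -/
def idxTwo : Index where
  j := 2
  k := 1
  j_mem := Or.inr (by norm_num)
  one_le_k := le_refl 1
  k_le := by norm_num [c_values.2.2.2]

section Degree

variable {L : Type*} [LieRing L] [LieAlgebra ℂ L]

/-- The affine action of a Lie algebra on itself attached to the inner derivation of `H`. -/
def affineAction (H z : L) : Module.End ℂ (ℂ × L) :=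
  LinearMap.prod 0 ((LinearMap.toSpanSingleton ℂ L ⁅H, z⁆) ∘ₗ LinearMap.fst ℂ ℂ L +
    LieAlgebra.ad ℂ L z ∘ₗ LinearMap.snd ℂ ℂ L)

theorem affineAction_apply (H z : L) (v : ℂ × L) :
    affineAction H z v = (0, v.1 • ⁅H, z⁆ + ⁅z, v.2⁆) := by
  simp [affineAction]

/-- The Jacobi identity makes `z ↦ [H, z]` a 1-cocycle, which is what an affine extension of the
adjoint action needs. Unlike `ad z`, the affine operator determines `[H, z]`. -/
theorem affineAction_lie (H x y : L) :
    affineAction H ⁅x, y⁆ = ⁅affineAction H x, affineAction H y⁆ := by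
  refine LinearMap.ext fun v => ?_
  rw [Ring.lie_def, LinearMap.sub_apply, Module.End.mul_apply, Module.End.mul_apply]
  simp only [affineAction_apply, zero_smul, zero_add, Prod.mk_sub_mk, sub_zero]
  congr 1
  rw [lie_add, lie_add, lie_smul, lie_smul, lie_lie, leibniz_lie H x y, smul_add,
    ← lie_skew ⁅H, x⁆ y]
  module

variable (p : Free →ₗ⁅ℂ⁆ L)

/-- The affine action of the free associative algebra on `L`. -/
def wordAction : Words →ₐ[ℂ] Module.End ℂ (ℂ × L) :=
  FreeAlgebra.lift ℂ fun b => affineAction (p (genH₁ + genH₂)) (posVec p b.1.2 b.1.1)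

variable {p} (hp : KillsRelators p)
include hp

namespace KillsRelators

theorem lie_degree_posVec (a : Index) (l : ℕ) :
    ⁅p (genH₁ + genH₂), posVec p l a⁆ = ((a.j : ℂ) + 1) • posVec p l a := by
  rw [map_add, add_lie, hp.lie_h₁_posVec, hp.lie_h₂_posVec]
  module

theorem wordAction_vec {a : Index} (ha : 1 ≤ a.j) (l : ℕ) :
    wordAction p (vec a l) = affineAction (p (genH₁ + genH₂)) (posVec p l a) := by
  rcases lt_or_ge (l : ℤ) a.j with hl | hl
  · rw [vec_of_lt ⟨ha, hl⟩, wordAction, FreeAlgebra.lift_ι_apply]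
  · rw [vec_of_le hl, hp.posVec_eq_zero ha hl, map_zero]
    refine LinearMap.ext fun v => ?_
    simp only [affineAction_apply, LinearMap.zero_apply, lie_zero, smul_zero, zero_lie, add_zero]
    rfl

/-- One polynomial `t` in the letters represents `z` in both actions. Nilpotency goes from `L` to
`t` through `wordRep`, and the vanishing of `t` comes back to `L` through `wordAction`; the positive
subalgebra need not be shown to be free. -/
theorem exists_word {z : L} (hz : z ∈ posSubalgebra p) :
    ∃ (x : Free) (t : Words), p x = z ∧ wordRep x = leftMul t ∧
      FreeAlgebra.algebraMapInv t = (0 : ℂ) ∧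
      wordAction p t = affineAction (p (genH₁ + genH₂)) z := by
  induction hz using LieSubalgebra.lieSpan_induction with
  | mem z hz =>
    obtain ⟨a, l, ha, rfl⟩ := hz
    refine ⟨freeVec l a, vec a l, map_freeVec p l a, ?_, algebraMapInv_vec a l,
      hp.wordAction_vec ha l⟩
    rw [map_freeVec, posVec_wordRep ha, vecOp]
  | zero =>
    refine ⟨0, 0, map_zero _, by simp, by simp, ?_⟩
    refine LinearMap.ext fun v => ?_
    simp only [affineAction_apply, LinearMap.zero_apply, lie_zero, smul_zero, zero_lie, add_zero,
      map_zero]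
    rfl
  | add y z _ _ hy hz =>
    obtain ⟨x, t, rfl, h1, h2, h3⟩ := hy
    obtain ⟨x', t', rfl, h1', h2', h3'⟩ := hz
    refine ⟨x + x', t + t', by simp, by simp [h1, h1'], by simp [h2, h2'], ?_⟩
    rw [map_add, h3, h3']
    refine LinearMap.ext fun v => ?_
    rw [LinearMap.add_apply]
    simp only [affineAction_apply, Prod.mk_add_mk, add_zero, lie_add, add_lie, smul_add]
    congr 1
    abel
  | smul r y _ hy =>
    obtain ⟨x, t, rfl, h1, h2, h3⟩ := hy
    refine ⟨r • x, r • t, by simp, by simp [h1], by simp [h2], ?_⟩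
    rw [map_smul, h3]
    refine LinearMap.ext fun v => ?_
    rw [LinearMap.smul_apply]
    simp only [affineAction_apply, Prod.smul_mk, smul_zero, lie_smul, smul_lie, smul_add]
    congr 2
    rw [smul_comm]
  | lie y z _ _ hy hz =>
    obtain ⟨x, t, rfl, h1, h2, h3⟩ := hy
    obtain ⟨x', t', rfl, h1', h2', h3'⟩ := hz
    refine ⟨⁅x, x'⁆, ⁅t, t'⁆, by simp, by rw [LieHom.map_lie, h1, h1', leftMul_lie],
      by simp [Ring.lie_def, h2, h2'], ?_⟩
    rw [affineAction_lie, ← h3, ← h3']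
    simp [Ring.lie_def]

theorem lie_degree_eq_zero_of_nilpotent (hker : ∀ x, p x = 0 → wordRep x = 0) {z : L}
    (hz : z ∈ posSubalgebra p)
    (hnil : ∀ (a : Index) (l : ℕ), 1 ≤ a.j → ∃ n, (LieAlgebra.ad ℂ L z ^ n) (posVec p l a) = 0) :
    ⁅p (genH₁ + genH₂), z⁆ = 0 := by
  obtain ⟨x, t, rfl, h1, h2, h3⟩ := hp.exists_word hz
  have hw : ∀ (a : Index) (l : ℕ), 1 ≤ a.j →
      ∃ n, (LieAlgebra.ad ℂ Words t ^ n) (vec a l) = 0 := by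
    intro a l ha
    obtain ⟨n, hn⟩ := hnil a l ha
    refine ⟨n, leftMul_injective ?_⟩
    have h4 := map_ad_pow (leftMul (X := Letter)).toLieHom t (vec a l) n
    have h5 : wordRep ((LieAlgebra.ad ℂ Free x ^ n) (freeVec l a)) = 0 :=
      hker _ (by rw [map_ad_pow, map_freeVec, hn])
    rw [map_ad_pow, h1, map_freeVec, posVec_wordRep ha, vecOp] at h5
    rw [map_zero]
    exact h4.trans h5
  have hone : 1 ≤ idxOne.j ∧ ((0 : ℕ) : ℤ) < idxOne.j := by simp [idxOne]
  have htwo : 1 ≤ idxTwo.j ∧ ((0 : ℕ) : ℤ) < idxTwo.j := by simp [idxTwo]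
  have hn1 := hw idxOne 0 hone.1
  have hn2 := hw idxTwo 0 htwo.1
  rw [vec_of_lt hone] at hn1
  rw [vec_of_lt htwo] at hn2
  -- The strings of `(1,1)` and `(2,1)` supply the two different letters required.
  have ht : t = 0 := by
    refine freeAlgebra_eq_zero_of_ad_nilpotent h2 ?_ hn1 hn2
    intro h
    have : idxOne.j = idxTwo.j := congrArg (fun b : Letter => b.1.1.j) h
    simp [idxOne, idxTwo] at this
  rw [ht, map_zero] at h3
  -- At `(1, 0)` the affine operator returns exactly `[h₁ + h₂, z]`.
  have := congrArg (fun Q : Module.End ℂ (ℂ × L) => (Q (1, 0)).2) h3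
  simpa [affineAction_apply] using this.symm

variable (p) in
omit hp in
/-- The sum of the eigenspaces of `h₁ + h₂` for the eigenvalues in `S`. -/
def _root_.MonsterLie.degreePart (S : Set ℤ) : Submodule ℂ L :=
  gradedPart (LieAlgebra.ad ℂ L (p (genH₁ + genH₂))) S

/-! ### Decomposition by the eigenvalues of `h₁ + h₂`. -/

omit hp in
theorem _root_.MonsterLie.degreePart_comp_chevalley_le (S : Set ℤ) :
    degreePart (p.comp chevalley) S ≤ degreePart p {d | -d ∈ S} := by
  have : LieAlgebra.ad ℂ L ((p.comp chevalley) (genH₁ + genH₂)) =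
      -LieAlgebra.ad ℂ L (p (genH₁ + genH₂)) := by
    rw [← map_neg, LieHom.comp_apply, map_add, chevalley_genH₁, chevalley_genH₂]
    congr 1
    simp
    abel
  rw [degreePart, this]
  exact gradedPart_neg_le _ _

theorem posSubalgebra_le_degreePart {z : L} (hz : z ∈ posSubalgebra p) :
    z ∈ degreePart p (Set.Ici 1) := by
  induction hz using LieSubalgebra.lieSpan_induction with
  | mem z hz =>
    obtain ⟨a, l, ha, rfl⟩ := hz
    refine mem_gradedPart (d := a.j + 1) (by simp; omega) ?_
    rw [LieAlgebra.ad_apply, hp.lie_degree_posVec]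
    push_cast
    rfl
  | zero => exact zero_mem _
  | add y z _ _ hy hz => exact add_mem hy hz
  | smul r y _ hy => exact Submodule.smul_mem _ r hy
  | lie y z _ _ hy hz =>
    refine lie_mem_gradedPart (fun s hs t ht => ?_) hy hz
    simp only [Set.mem_Ici] at hs ht ⊢
    omega

theorem negSubalgebra_le_degreePart {z : L} (hz : z ∈ posSubalgebra (p.comp chevalley)) :
    z ∈ degreePart p (Set.Iic (-1)) := by
  have h := degreePart_comp_chevalley_le _ (hp.comp_chevalley.posSubalgebra_le_degreePart hz)
  refine gradedPart_mono (fun d hd => ?_) h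
  simp only [Set.mem_Ici, Set.mem_ofPred_eq, Set.mem_Iic] at hd ⊢
  omega

theorem levi_le_degreePart : levi p ≤ degreePart p {0} := by
  rw [levi, Submodule.span_le]
  have hmem : ∀ x : L, ⁅p (genH₁ + genH₂), x⁆ = 0 → x ∈ degreePart p {0} := fun x hx =>
    mem_gradedPart (d := 0) (Set.mem_singleton 0)
      (by rw [LieAlgebra.ad_apply, hx, Int.cast_zero, zero_smul])
  rintro x ((rfl | rfl) | ⟨a, rfl⟩)
  · apply hmem
    rw [map_add, add_lie, hp.lie_h₁_e, hp.lie_h₂_e]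
    simp [idxNeg]
  · apply hmem
    rw [map_add, add_lie, hp.lie_h₁_f, hp.lie_h₂_f]
    simp [idxNeg]
  · apply hmem
    rw [map_add, add_lie, hp.lie_h₁_h, hp.lie_h₂_h, add_zero]

theorem exists_decomposition (hsurj : Function.Surjective p) (x : L) :
    ∃ u ∈ degreePart p (Set.Iic (-1)), ∃ w ∈ levi p, ∃ v ∈ posSubalgebra p, x = u + w + v := by
  obtain ⟨y, rfl⟩ := hsurj x
  obtain ⟨u', hu', v, hv, huv⟩ := Submodule.mem_sup.1 (hp.mem_triangular y)
  obtain ⟨u, hu, w, hw, rfl⟩ := Submodule.mem_sup.1 hu'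
  exact ⟨u, hp.negSubalgebra_le_degreePart hu, w, hw, v, hv, huv.symm⟩

theorem mem_posSubalgebra_of_degree (hsurj : Function.Surjective p) {d : ℤ} (hd : 1 ≤ d) {z : L}
    (hz : ⁅p (genH₁ + genH₂), z⁆ = (d : ℂ) • z) : z ∈ posSubalgebra p := by
  obtain ⟨u, hu, w, hw, v, hv, rfl⟩ := hp.exists_decomposition hsurj z
  have h0 : u + w = 0 := by
    refine eq_zero_of_mem_gradedPart (S := Set.Iic 0) (T := Set.Ici 1)
      (D := LieAlgebra.ad ℂ L (p (genH₁ + genH₂))) ?_ ?_ ?_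
    · rw [Set.disjoint_left]
      intro s hs ht
      simp only [Set.mem_Iic, Set.mem_Ici] at hs ht
      omega
    · refine add_mem (gradedPart_mono (Set.Iic_subset_Iic.2 (by norm_num)) hu) ?_
      exact gradedPart_mono (by simp) (hp.levi_le_degreePart hw)
    · rw [show u + w = (u + w + v) - v by abel]
      exact sub_mem (mem_gradedPart (d := d) hd hz) (hp.posSubalgebra_le_degreePart hv)
  rwa [h0, zero_add]

theorem mem_levi_of_degree_zero (hsurj : Function.Surjective p) {z : L}
    (hz : ⁅p (genH₁ + genH₂), z⁆ = 0) : z ∈ levi p := by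
  obtain ⟨u, hu, w, hw, v, hv, rfl⟩ := hp.exists_decomposition hsurj z
  have h0 : u + v = 0 := by
    refine eq_zero_of_mem_gradedPart (S := {0}ᶜ) (T := {0})
      (D := LieAlgebra.ad ℂ L (p (genH₁ + genH₂))) disjoint_compl_left ?_ ?_
    · refine add_mem (gradedPart_mono ?_ hu)
        (gradedPart_mono ?_ (hp.posSubalgebra_le_degreePart hv))
      · intro s hs
        simp only [Set.mem_Iic, Set.mem_compl_iff, Set.mem_singleton_iff] at hs ⊢
        omega
      · intro s hs
        simp only [Set.mem_Ici, Set.mem_compl_iff, Set.mem_singleton_iff] at hs ⊢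
        omega
    · rw [show u + v = (u + w + v) - w by abel]
      refine sub_mem (mem_gradedPart (d := 0) (Set.mem_singleton 0) ?_) (hp.levi_le_degreePart hw)
      rw [LieAlgebra.ad_apply, hz, Int.cast_zero, zero_smul]
  rw [show u + w + v = w + (u + v) by abel, h0, add_zero]
  exact hw

theorem degreePart_univ (hsurj : Function.Surjective p) (x : L) :
    x ∈ degreePart p Set.univ := by
  obtain ⟨u, hu, w, hw, v, hv, rfl⟩ := hp.exists_decomposition hsurj x
  exact add_mem (add_mem (gradedPart_mono (Set.subset_univ _) hu)
    (gradedPart_mono (Set.subset_univ _) (hp.levi_le_degreePart hw)))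
    (gradedPart_mono (Set.subset_univ _) (hp.posSubalgebra_le_degreePart hv))

theorem exists_homogeneous (hsurj : Function.Surjective p) (x : L) :
    ∃ f : ℤ →₀ L, (∀ d, ⁅p (genH₁ + genH₂), f d⁆ = (d : ℂ) • f d) ∧ f.sum (fun _ y => y) = x := by
  have h := hp.degreePart_univ hsurj x
  rw [degreePart, gradedPart, iSup_univ, Submodule.mem_iSup_iff_exists_finsupp] at h
  obtain ⟨f, hf, hx⟩ := h
  exact ⟨f, fun d => Module.End.mem_eigenspace_iff.1 (hf d), hx⟩

end KillsRelators

omit hp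

/-- The leading term of `(ad x)ⁿ y` is `(ad z)ⁿ y`, for `z` the leading term of `x` and `y`
homogeneous. -/
theorem ad_pow_leading {H x y z : L} {d e : ℤ} (hz : ⁅H, z⁆ = (d : ℂ) • z)
    (hx : x - z ∈ gradedPart (LieAlgebra.ad ℂ L H) (Set.Iio d)) (hy : ⁅H, y⁆ = (e : ℂ) • y)
    (n : ℕ) :
    (LieAlgebra.ad ℂ L z ^ n) y ∈ gradedPart (LieAlgebra.ad ℂ L H) {e + n * d} ∧
      (LieAlgebra.ad ℂ L x ^ n) y - (LieAlgebra.ad ℂ L z ^ n) y ∈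
        gradedPart (LieAlgebra.ad ℂ L H) (Set.Iio (e + n * d)) := by
  have hz' : z ∈ gradedPart (LieAlgebra.ad ℂ L H) {d} := mem_gradedPart (Set.mem_singleton d) hz
  have hx' : x ∈ gradedPart (LieAlgebra.ad ℂ L H) (Set.Iic d) := by
    rw [← sub_add_cancel x z]
    exact add_mem (gradedPart_mono Set.Iio_subset_Iic_self hx) (gradedPart_mono (by simp) hz')
  induction n with
  | zero =>
    constructor
    · exact mem_gradedPart (d := e) (by simp) hy
    · simp
  | succ n ih =>
    obtain ⟨ih1, ih2⟩ := ih
    rw [ad_pow_succ_apply, ad_pow_succ_apply]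
    constructor
    · refine lie_mem_gradedPart (fun s hs t ht => ?_) hz' ih1
      simp only [Set.mem_singleton_iff] at hs ht ⊢
      rw [hs, ht]
      push_cast
      ring
    · have hsplit : ⁅x, (LieAlgebra.ad ℂ L x ^ n) y⁆ - ⁅z, (LieAlgebra.ad ℂ L z ^ n) y⁆ =
          ⁅x, (LieAlgebra.ad ℂ L x ^ n) y - (LieAlgebra.ad ℂ L z ^ n) y⁆ +
            ⁅x - z, (LieAlgebra.ad ℂ L z ^ n) y⁆ := by
        rw [lie_sub, sub_lie]
        abel
      rw [hsplit]
      refine add_mem (lie_mem_gradedPart (fun s hs t ht => ?_) hx' ih2)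
        (lie_mem_gradedPart (fun s hs t ht => ?_) hx ih1)
      · simp only [Set.mem_Iic, Set.mem_Iio] at hs ht ⊢
        push_cast
        linarith
      · simp only [Set.mem_Iio, Set.mem_singleton_iff] at hs ht ⊢
        push_cast
        linarith

include hp

/-! ### Vanishing of the components of nonzero degree. -/

namespace KillsRelators

/-- Take the highest nonzero component `z`, of degree `m ≥ 1`. For homogeneous `y`, the element `(ad
z)ⁿ y` is the top part of `(ad x)ⁿ y`, so nilpotency passes to `z` and yields `[h₁ + h₂, z] = 0`.
This bracket is also `m z`, so `z = 0`, a contradiction. -/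
theorem component_eq_zero_of_pos (hsurj : Function.Surjective p)
    (hker : ∀ x, p x = 0 → wordRep x = 0) {x : L} (hx : IsLocallyAdNilpotent x) {f : ℤ →₀ L}
    (hf : ∀ d, ⁅p (genH₁ + genH₂), f d⁆ = (d : ℂ) • f d) (hsum : f.sum (fun _ y => y) = x)
    {d : ℤ} (hd : 1 ≤ d) : f d = 0 := by
  classical
  by_contra hne
  set s := f.support.filter fun d => 1 ≤ d with hs
  have hsne : s.Nonempty := ⟨d, by simp [hs, hne, hd]⟩
  set m := s.max' hsne with hm
  have hms : m ∈ s := s.max'_mem hsne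
  rw [hs, Finset.mem_filter, Finsupp.mem_support_iff] at hms
  obtain ⟨hm0, hm1⟩ := hms
  have hlow : x - f m ∈ gradedPart (LieAlgebra.ad ℂ L (p (genH₁ + genH₂))) (Set.Iio m) := by
    rw [← hsum, Finsupp.sum, ← Finset.add_sum_erase _ _ (Finsupp.mem_support_iff.2 hm0),
      add_sub_cancel_left]
    refine sum_mem fun i hi => mem_gradedPart (d := i) ?_ (hf i)
    rw [Finset.mem_erase] at hi
    rcases lt_or_ge i 1 with h | h
    · exact lt_of_lt_of_le h hm1
    · exact lt_of_le_of_ne (s.le_max' i (by simp only [hs, Finset.mem_filter]; exact ⟨hi.2, h⟩))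
        hi.1
  have h0 := hp.lie_degree_eq_zero_of_nilpotent hker
    (hp.mem_posSubalgebra_of_degree hsurj hm1 (hf m)) <| by
      intro a l _
      obtain ⟨n, hn⟩ := hx (posVec p l a)
      refine ⟨n, ?_⟩
      obtain ⟨h1, h2⟩ := ad_pow_leading (y := posVec p l a) (e := a.j + 1) (hf m) hlow
        (by rw [hp.lie_degree_posVec]; push_cast; rfl) n
      rw [hn, zero_sub] at h2
      refine eq_zero_of_mem_gradedPart ?_ h1 (neg_mem_iff.1 h2)
      simp
  rw [hf m] at h0
  rcases smul_eq_zero.1 h0 with h | h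
  · have : m = 0 := by exact_mod_cast h
    omega
  · exact hm0 h

theorem mem_levi_of_isLocallyAdNilpotent (hsurj : Function.Surjective p)
    (hker : ∀ x, p x = 0 → wordRep x = 0) (hker' : ∀ x, p (chevalley x) = 0 → wordRep x = 0)
    {x : L} (hx : IsLocallyAdNilpotent x) : x ∈ levi p := by
  obtain ⟨f, hf, hsum⟩ := hp.exists_homogeneous hsurj x
  have hpos : ∀ d : ℤ, 1 ≤ d → f d = 0 := fun d hd =>
    hp.component_eq_zero_of_pos hsurj hker hx hf hsum hd
  have hneg : ∀ d : ℤ, d ≤ -1 → f d = 0 := by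
    intro d hd
    have hsurj' : Function.Surjective (p.comp chevalley) := by
      intro y
      obtain ⟨z, rfl⟩ := hsurj y
      exact ⟨chevalley z, by simp⟩
    -- The involution reverses the grading, so the components are reindexed by `d ↦ -d`.
    have := hp.comp_chevalley.component_eq_zero_of_pos hsurj' hker' hx
      (f := f.equivMapDomain (Equiv.neg ℤ)) ?_ ?_ (d := -d) (by omega)
    · simpa [Finsupp.equivMapDomain_apply] using this
    · intro i
      have h := hf (-i)
      rw [Finsupp.equivMapDomain_apply, LieHom.comp_apply, map_add, chevalley_genH₁,
        chevalley_genH₂, ← neg_add, map_neg, neg_lie]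
      change -⁅p (genH₁ + genH₂), f (-i)⁆ = (i : ℂ) • f (-i)
      rw [h]
      push_cast
      module
    · rw [← hsum]
      simp [Finsupp.sum_equivMapDomain]
  have hx0 : x = f 0 := by
    rw [← hsum, Finsupp.sum, Finset.sum_eq_single 0]
    · intro d _ hd
      rcases lt_or_gt_of_ne hd with h | h
      · exact hneg d (by omega)
      · exact hpos d (by omega)
    · intro h
      exact Finsupp.notMem_support_iff.1 h
  rw [hx0]
  refine hp.mem_levi_of_degree_zero hsurj ?_
  rw [hf 0, Int.cast_zero, zero_smul]

end KillsRelators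

end Degree

/-! ### Copies of `𝔤𝔩₂` -/

section Gl2

variable {L : Type*} [LieRing L] [LieAlgebra ℂ L]

/-- The elements `a, b, e, f` satisfy the relations of the matrix units
`E₁₁, E₂₂, E₁₂, E₂₁`. -/
structure IsGl2Tuple (a b e f : L) : Prop where
  lie_a_b : ⁅a, b⁆ = 0
  lie_a_e : ⁅a, e⁆ = e
  lie_a_f : ⁅a, f⁆ = -f
  lie_b_e : ⁅b, e⁆ = -e
  lie_b_f : ⁅b, f⁆ = f
  lie_e_f : ⁅e, f⁆ = a - b

variable {a b e f : L} (H : IsGl2Tuple a b e f)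

/-- The Lie algebra homomorphism from `𝔤𝔩₂` determined by the images of the matrix units. -/
def gl2Hom : Matrix (Fin 2) (Fin 2) ℂ →ₗ⁅ℂ⁆ L where
  toFun M := M 0 0 • a + M 0 1 • e + M 1 0 • f + M 1 1 • b
  map_add' M N := by simp only [Matrix.add_apply]; module
  map_smul' t M := by simp only [Matrix.smul_apply, smul_eq_mul, RingHom.id_apply]; module
  map_lie' {M N} := by
    have ba : ⁅b, a⁆ = 0 := by rw [← lie_skew, H.lie_a_b, neg_zero]
    have ea : ⁅e, a⁆ = -e := by rw [← lie_skew, H.lie_a_e]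
    have fa : ⁅f, a⁆ = f := by rw [← lie_skew, H.lie_a_f, neg_neg]
    have eb : ⁅e, b⁆ = e := by rw [← lie_skew, H.lie_b_e, neg_neg]
    have fb : ⁅f, b⁆ = -f := by rw [← lie_skew, H.lie_b_f]
    have fe : ⁅f, e⁆ = b - a := by rw [← lie_skew, H.lie_e_f, neg_sub]
    simp only [Ring.lie_def, Matrix.sub_apply, Matrix.mul_apply, Fin.sum_univ_two, lie_add,
      add_lie, lie_smul, smul_lie, lie_self, H.lie_a_b, H.lie_a_e, H.lie_a_f, H.lie_b_e, H.lie_b_f,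
      H.lie_e_f, ba, ea, fa, eb, fb, fe]
    module

theorem gl2Hom_apply (M : Matrix (Fin 2) (Fin 2) ℂ) :
    gl2Hom H M = M 0 0 • a + M 0 1 • e + M 1 0 • f + M 1 1 • b := rfl

/-- Independence of `a` and `b` suffices: `[e, f] = a - b ≠ 0` makes `e` and `f` nonzero, while `(ad
e)²` and `(ad f)²` isolate the coefficients of `f` and `e`. -/
theorem gl2Hom_injective (hab : ∀ s t : ℂ, s • a + t • b = 0 → s = 0 ∧ t = 0) :
    Function.Injective (gl2Hom H) := by
  have h2 : (-2 : ℂ) ≠ 0 := by norm_num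
  have he : e ≠ 0 := by
    intro h
    have := H.lie_e_f
    rw [h, zero_lie] at this
    have := (hab 1 (-1) (by rw [one_smul, neg_one_smul, ← sub_eq_add_neg, ← this])).1
    exact one_ne_zero this
  have hf : f ≠ 0 := by
    intro h
    have := H.lie_e_f
    rw [h, lie_zero] at this
    have := (hab 1 (-1) (by rw [one_smul, neg_one_smul, ← sub_eq_add_neg, ← this])).1
    exact one_ne_zero this
  rw [injective_iff_map_eq_zero]
  intro M hM
  have ea : ⁅e, a⁆ = -e := by rw [← lie_skew, H.lie_a_e]
  have fa : ⁅f, a⁆ = f := by rw [← lie_skew, H.lie_a_f, neg_neg]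
  have eb : ⁅e, b⁆ = e := by rw [← lie_skew, H.lie_b_e, neg_neg]
  have fb : ⁅f, b⁆ = -f := by rw [← lie_skew, H.lie_b_f]
  have fe : ⁅f, e⁆ = b - a := by rw [← lie_skew, H.lie_e_f, neg_sub]
  rw [gl2Hom_apply] at hM
  have h10 : M 1 0 = 0 := by
    have h := congrArg (fun x => ⁅e, ⁅e, x⁆⁆) hM
    simp only [lie_add, lie_smul, lie_self, lie_neg, lie_sub, ea, eb, H.lie_e_f, lie_zero,
      smul_zero, neg_zero, zero_add, add_zero] at h
    have h' : (-2 * M 1 0) • e = 0 := by rw [← h]; module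
    simpa [he] using h'
  have h01 : M 0 1 = 0 := by
    have h := congrArg (fun x => ⁅f, ⁅f, x⁆⁆) hM
    simp only [lie_add, lie_smul, lie_self, lie_neg, lie_sub, fa, fb, fe, lie_zero,
      smul_zero, neg_zero, zero_add, add_zero] at h
    have h' : (-2 * M 0 1) • f = 0 := by rw [← h]; module
    simpa [hf] using h'
  rw [h10, h01, zero_smul, zero_smul, add_zero, add_zero] at hM
  obtain ⟨h00, h11⟩ := hab _ _ hM
  ext i j
  fin_cases i <;> fin_cases j <;> assumption

theorem gl2Hom_single (i j : Fin 2) : gl2Hom H (Matrix.single i j 1) = ![![a, e], ![f, b]] i j := by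
  fin_cases i <;> fin_cases j <;> simp [gl2Hom_apply]

theorem gl2Hom_range : (gl2Hom H).range = LieSubalgebra.lieSpan ℂ L {e, f, a, b} := by
  apply le_antisymm
  · rintro x ⟨M, rfl⟩
    have hm : ∀ y ∈ ({e, f, a, b} : Set L), ∀ t : ℂ,
        t • y ∈ LieSubalgebra.lieSpan ℂ L {e, f, a, b} := fun y hy t =>
      Submodule.smul_mem _ t (LieSubalgebra.subset_lieSpan hy)
    change gl2Hom H M ∈ _
    rw [gl2Hom_apply]
    exact add_mem (add_mem (add_mem (hm a (by simp) _) (hm e (by simp) _)) (hm f (by simp) _))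
      (hm b (by simp) _)
  · rw [LieSubalgebra.lieSpan_le]
    rintro x (rfl | rfl | rfl | rfl)
    · exact ⟨Matrix.single 0 1 1, gl2Hom_single H 0 1⟩
    · exact ⟨Matrix.single 1 0 1, gl2Hom_single H 1 0⟩
    · exact ⟨Matrix.single 0 0 1, gl2Hom_single H 0 0⟩
    · exact ⟨Matrix.single 1 1 1, gl2Hom_single H 1 1⟩

theorem exists_gl2Equiv (hab : ∀ s t : ℂ, s • a + t • b = 0 → s = 0 ∧ t = 0)
    {K : LieSubalgebra ℂ L} (hK : LieSubalgebra.lieSpan ℂ L {e, f, a, b} = K) :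
    ∃ φ : Matrix (Fin 2) (Fin 2) ℂ ≃ₗ⁅ℂ⁆ K, ∀ M, (φ M : L) = gl2Hom H M := by
  rw [← gl2Hom_range H] at hK
  subst hK
  exact ⟨LieEquiv.ofInjective _ (gl2Hom_injective H hab), fun M => rfl⟩

end Gl2

/-! ### The degree zero part of the Monster Lie algebra -/

theorem proj_genH₁ : proj genH₁ = h₁ := by simp [genH₁, h₁, h]
theorem proj_genH₂ : proj genH₂ = h₂ := by simp [genH₂, h₂, h]

/-- On `e_{pq}` the elements `h₁`, `h₂`, `h_{jk}` have weights `1`, `p`, `-(j + p)`, and the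
opposite weights on `f_{pq}`. Hence `h_{jk} + h₂ + j h₁` is central in `𝔤(A)`. -/
theorem proj_genH (a : Index) : proj (genH a) = -(h₂ + (a.j : ℂ) • h₁) := by
  have hq := killsRelators_borcherdsProj
  have key : proj (genH a + (genH₂ + (a.j : ℂ) • genH₁)) = 0 := by
    obtain ⟨z, hz⟩ : ∃ z : Free, z = genH a + (genH₂ + (a.j : ℂ) • genH₁) := ⟨_, rfl⟩
    rw [← hz, proj_eq_zero_iff]
    -- The elements commuting with `z` modulo the relators form a subalgebra, so checking the
    -- generators is enough.
    let S : LieSubalgebra ℂ Free :=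
      { carrier := {y | ⁅y, z⁆ ∈ relatorIdeal}
        zero_mem' := by
          change ⁅(0 : Free), z⁆ ∈ relatorIdeal
          rw [zero_lie]
          exact zero_mem _
        add_mem' := fun {u v} hu hv => by
          change ⁅u + v, z⁆ ∈ relatorIdeal
          rw [add_lie]
          exact add_mem hu hv
        smul_mem' := fun t u hu => by
          change ⁅t • u, z⁆ ∈ relatorIdeal
          rw [smul_lie]
          exact Submodule.smul_mem _ t hu
        lie_mem' := fun {u v} hu hv => by
          change ⁅⁅u, v⁆, z⁆ ∈ relatorIdeal
          rw [lie_lie]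
          exact sub_mem (LieSubmodule.lie_mem _ hv) (LieSubmodule.lie_mem _ hu) }
    refine fun y => free_eq_top_of_generators S (fun b => ?_) (fun b => ?_) (fun b => ?_) y
    · change ⁅genE b, z⁆ ∈ relatorIdeal
      rw [← borcherdsProj_eq_zero_iff, LieHom.map_lie, hz, map_add, map_add, map_smul, ← lie_skew,
        add_lie, add_lie, smul_lie, hq.lie_h_e, hq.lie_h₁_e, hq.lie_h₂_e, cartan]
      push_cast
      module
    · change ⁅genF b, z⁆ ∈ relatorIdeal
      rw [← borcherdsProj_eq_zero_iff, LieHom.map_lie, hz, map_add, map_add, map_smul, ← lie_skew,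
        add_lie, add_lie, smul_lie, hq.lie_h_f, hq.lie_h₁_f, hq.lie_h₂_f, cartan]
      push_cast
      module
    · change ⁅genH b, z⁆ ∈ relatorIdeal
      rw [← borcherdsProj_eq_zero_iff, LieHom.map_lie, hz, map_add, map_add, map_smul, ← lie_skew,
        add_lie, add_lie, smul_lie, hq.lie_h_h, hq.lie_h₁_h, hq.lie_h₂_h]
      simp
  rw [map_add, map_add, map_smul, proj_genH₁, proj_genH₂] at key
  exact eq_neg_of_add_eq_zero_left key

theorem isGl2Tuple_neg : IsGl2Tuple h₁ h₂ eNeg fNeg where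
  lie_a_b := by
    rw [← proj_genH₁, ← proj_genH₂, genH₂]
    simp [killsRelators_proj.lie_h₁_h]
  lie_a_e := by rw [← proj_genH₁]; exact killsRelators_proj.lie_h₁_e idxNeg
  lie_a_f := by rw [← proj_genH₁]; exact killsRelators_proj.lie_h₁_f idxNeg
  lie_b_e := by
    rw [← proj_genH₂]
    exact (killsRelators_proj.lie_h₂_e idxNeg).trans (by simp [idxNeg, eNeg, e])
  lie_b_f := by
    rw [← proj_genH₂]
    exact (killsRelators_proj.lie_h₂_f idxNeg).trans (by simp [idxNeg, fNeg, f])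
  lie_e_f := by
    rw [← proj_genH₁, ← proj_genH₂, ← map_sub, ← genH_idxNeg]
    exact lie_e_f_self idxNeg

theorem vecOp_ne_zero {a : Index} {l : ℕ} (hb : 1 ≤ a.j ∧ (l : ℤ) < a.j) : vecOp a l ≠ 0 := by
  rw [vecOp, vec_of_lt hb]
  intro h
  exact FreeAlgebra.ι_ne_zero _ (leftMul_injective (h.trans (map_zero _).symm))

theorem posVec_proj_ne_zero {a : Index} {l : ℕ} (hb : 1 ≤ a.j ∧ (l : ℤ) < a.j) :
    posVec proj l a ≠ 0 := by
  intro h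
  rw [← map_freeVec] at h
  have := wordRep_eq_zero_of_proj h
  rw [map_freeVec, posVec_wordRep hb.1] at this
  exact vecOp_ne_zero hb this

/-- The combination acts on `e_{jk}`, nonzero by `wordRep`, as the scalar `s + t j`; the values `j =
1, 2` determine `s` and `t`. -/
theorem h₁_h₂_independent (s t : ℂ) (hst : s • h₁ + t • h₂ = 0) : s = 0 ∧ t = 0 := by
  have key : ∀ {a : Index}, 1 ≤ a.j → s + t * a.j = 0 := by
    intro a ha
    have h := congrArg (fun x => ⁅x, posVec proj 0 a⁆) hst
    simp only [add_lie, smul_lie, zero_lie] at h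
    rw [← proj_genH₁, ← proj_genH₂, killsRelators_proj.lie_h₁_posVec,
      killsRelators_proj.lie_h₂_posVec, smul_smul, smul_smul, ← add_smul, smul_eq_zero] at h
    rcases h with h | h
    · simpa using h
    · exact absurd h (posVec_proj_ne_zero ⟨ha, by simpa using lt_of_lt_of_le one_pos ha⟩)
  have k1 := key (a := idxOne) (by simp [idxOne])
  have k2 := key (a := idxTwo) (by simp [idxTwo])
  simp only [idxOne, idxTwo] at k1 k2
  push_cast at k1 k2
  have ht : t = 0 := by linear_combination k2 - k1
  exact ⟨by rw [ht] at k1; simpa using k1, ht⟩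

/-- The homomorphism from `𝔤𝔩₂` to `𝔪`. -/
def gl2NegHom : Matrix (Fin 2) (Fin 2) ℂ →ₗ⁅ℂ⁆ Monster := gl2Hom isGl2Tuple_neg

theorem gl2NegHom_apply (M : Matrix (Fin 2) (Fin 2) ℂ) :
    gl2NegHom M = M 0 0 • h₁ + M 0 1 • eNeg + M 1 0 • fNeg + M 1 1 • h₂ := rfl

theorem exists_gl2NegHom_of_mem_levi {x : Monster} (hx : x ∈ levi proj) : ∃ M, gl2NegHom M = x := by
  have : levi proj ≤ gl2NegHom.range.toSubmodule := by
    rw [levi, Submodule.span_le]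
    rintro x ((rfl | rfl) | ⟨a, rfl⟩)
    · exact ⟨Matrix.single 0 1 1, gl2Hom_single _ 0 1⟩
    · exact ⟨Matrix.single 1 0 1, gl2Hom_single _ 1 0⟩
    · refine ⟨!![-(a.j : ℂ), 0; 0, -1], ?_⟩
      change gl2NegHom _ = proj (genH a)
      rw [proj_genH, gl2NegHom_apply]
      simp [add_comm]
  exact this hx

/-! ### Locally ad-nilpotent elements of the Monster Lie algebra -/

theorem lie_gl2NegHom_posVec {a : Index} (ha : 1 ≤ a.j) (M : Matrix (Fin 2) (Fin 2) ℂ) :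
    ⁅gl2NegHom M, posVec proj 0 a⁆ =
      (M 0 0 + M 1 1 * a.j) • posVec proj 0 a + M 0 1 • posVec proj 1 a := by
  have h1 := killsRelators_proj.lie_h₁_posVec 0 a
  have h2 := killsRelators_proj.lie_h₂_posVec 0 a
  have h3 := lie_e_posVec (p := proj) 0 a
  have h4 := killsRelators_proj.lie_f_posVec_zero ha
  rw [proj_genH₁] at h1
  rw [proj_genH₂] at h2
  change ⁅eNeg, _⁆ = _ at h3
  change ⁅fNeg, _⁆ = _ at h4
  rw [gl2NegHom_apply]
  simp only [add_lie, smul_lie, h1, h2, h3, h4]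
  push_cast
  module

theorem lie_gl2NegHom_posVec_one (M : Matrix (Fin 2) (Fin 2) ℂ) :
    ⁅gl2NegHom M, posVec proj 1 idxTwo⁆ =
      M 1 0 • posVec proj 0 idxTwo + (2 * M 0 0 + M 1 1) • posVec proj 1 idxTwo := by
  have ha : 1 ≤ idxTwo.j := by simp [idxTwo]
  have h1 := killsRelators_proj.lie_h₁_posVec 1 idxTwo
  have h2 := killsRelators_proj.lie_h₂_posVec 1 idxTwo
  have h3 := lie_e_posVec (p := proj) 1 idxTwo
  have h4 := killsRelators_proj.lie_f_posVec_succ ha 0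
  rw [proj_genH₁] at h1
  rw [proj_genH₂] at h2
  have hj : (idxTwo.j : ℂ) = 2 := by simp [idxTwo]
  rw [killsRelators_proj.posVec_eq_zero ha (l := 1 + 1) (by simp [idxTwo])] at h3
  change ⁅eNeg, _⁆ = _ at h3
  change ⁅fNeg, _⁆ = _ at h4
  rw [gl2NegHom_apply]
  simp only [add_lie, smul_lie, h1, h2, h3, h4, hj]
  push_cast
  module

/-- The string for `j = 1` is a line on which `M` acts by its trace. Once the trace is 0, the square
of `M` acts on `e_{21}` by `-det M`. Nilpotency forces both scalars to be 0. -/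
theorem trace_det_of_isLocallyAdNilpotent {M : Matrix (Fin 2) (Fin 2) ℂ}
    (hM : IsLocallyAdNilpotent (gl2NegHom M)) :
    M 0 0 + M 1 1 = 0 ∧ M 0 0 * M 1 1 - M 0 1 * M 1 0 = 0 := by
  have h1 : 1 ≤ idxOne.j := by simp [idxOne]
  have h2 : 1 ≤ idxTwo.j := by simp [idxTwo]
  have htr : M 0 0 + M 1 1 = 0 := by
    have key : ∀ n, (LieAlgebra.ad ℂ Monster (gl2NegHom M) ^ n) (posVec proj 0 idxOne) =
        (M 0 0 + M 1 1) ^ n • posVec proj 0 idxOne := by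
      intro n
      induction n with
      | zero => simp
      | succ n ih =>
        rw [ad_pow_succ_apply, ih, lie_smul, lie_gl2NegHom_posVec h1,
          killsRelators_proj.posVec_eq_zero h1 (l := 1) (by simp [idxOne])]
        simp only [idxOne]
        push_cast
        module
    obtain ⟨n, hn⟩ := hM (posVec proj 0 idxOne)
    rw [key] at hn
    rcases smul_eq_zero.1 hn with h | h
    · exact eq_zero_of_pow_eq_zero h
    · exact absurd h (posVec_proj_ne_zero ⟨h1, by simp [idxOne]⟩)
  refine ⟨htr, ?_⟩
  have h11 : M 1 1 = -M 0 0 := by linear_combination htr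
  have key : ∀ n, (LieAlgebra.ad ℂ Monster (gl2NegHom M) ^ (2 * n)) (posVec proj 0 idxTwo) =
      (M 0 0 ^ 2 + M 0 1 * M 1 0) ^ n • posVec proj 0 idxTwo := by
    intro n
    induction n with
    | zero => simp
    | succ n ih =>
      rw [show 2 * (n + 1) = 2 * n + 1 + 1 by ring, ad_pow_succ_apply, ad_pow_succ_apply, ih,
        lie_smul, lie_smul, lie_gl2NegHom_posVec h2, lie_add, lie_smul, lie_smul,
        lie_gl2NegHom_posVec h2, lie_gl2NegHom_posVec_one, h11]
      simp only [idxTwo]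
      push_cast
      module
  obtain ⟨n, hn⟩ := hM (posVec proj 0 idxTwo)
  have hn' := pow_apply_eq_zero_of_le (show n ≤ 2 * n by omega) hn
  rw [key] at hn'
  rcases smul_eq_zero.1 hn' with h | h
  · have := eq_zero_of_pow_eq_zero h
    rw [h11]
    linear_combination -this
  · exact absurd h (posVec_proj_ne_zero ⟨h2, by simp [idxTwo]⟩)

theorem exists_of_isLocallyAdNilpotent {x : Monster} (hx : IsLocallyAdNilpotent x) :
    ∃ M, gl2NegHom M = x ∧ M 0 0 + M 1 1 = 0 ∧ M 0 0 * M 1 1 - M 0 1 * M 1 0 = 0 := by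
  have hlevi := killsRelators_proj.mem_levi_of_isLocallyAdNilpotent proj_surjective
    (fun _ => wordRep_eq_zero_of_proj)
    (fun x hx => wordRep_eq_zero_of_proj (by simpa using proj_chevalley_eq_zero hx)) hx
  obtain ⟨M, rfl⟩ := exists_gl2NegHom_of_mem_levi hlevi
  exact ⟨M, rfl, trace_det_of_isLocallyAdNilpotent hx⟩

/-! ### Transport of exponentials -/

section Transport

variable {L L' : Type*} [LieRing L] [LieAlgebra ℂ L] [LieRing L'] [LieAlgebra ℂ L']

theorem IsLocallyAdNilpotent.map {x : L} (hx : IsLocallyAdNilpotent x) (ψ : L ≃ₗ⁅ℂ⁆ L') :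
    IsLocallyAdNilpotent (ψ x) := by
  intro y
  obtain ⟨n, hn⟩ := hx (ψ.symm y)
  refine ⟨n, ?_⟩
  have h := map_ad_pow ψ.toLieHom x (ψ.symm y) n
  rw [hn, map_zero] at h
  simpa using h.symm

theorem expAdFun_map {x : L} (hx : IsLocallyAdNilpotent x) (ψ : L ≃ₗ⁅ℂ⁆ L') (y : L) :
    expAdFun (ψ x) (ψ y) = ψ (expAdFun x y) := by
  obtain ⟨n, hn⟩ := hx y
  have h (k : ℕ) : ψ ((LieAlgebra.ad ℂ L x ^ k) y) = (LieAlgebra.ad ℂ L' (ψ x) ^ k) (ψ y) :=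
    map_ad_pow ψ.toLieHom x y k
  rw [expAdFun_eq hn, expAdFun_eq (N := n) (by rw [← h, hn, map_zero]), map_sum]
  refine Finset.sum_congr rfl fun k _ => ?_
  rw [map_smul, h]

theorem expAd_map {x : L} (hx : IsLocallyAdNilpotent x) (ψ : L ≃ₗ⁅ℂ⁆ L) :
    expAd (ψ x) (hx.map ψ) = ψ * expAd x hx * ψ⁻¹ := by
  apply LieEquiv.ext
  intro y
  change expAdFun (ψ x) y = ψ (expAdFun x (ψ.symm y))
  rw [← expAdFun_map hx, LieEquiv.apply_symm_apply]

/-- The exponential of `u ad x` acts on a string of divided powers by a linear substitution. -/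
theorem expAdFun_string {x : L} {w : ℕ → L} {n : ℕ} (hw : ∀ l, ⁅x, w l⁆ = ((l : ℂ) + 1) • w (l + 1))
    (hn : ∀ l, n < l → w l = 0) (hx : IsLocallyAdNilpotent x) (u s t : ℂ) :
    expAdFun (u • x) (∑ l ∈ Finset.range (n + 1), (s ^ (n - l) * t ^ l) • w l) =
      ∑ l ∈ Finset.range (n + 1), (s ^ (n - l) * (t + u * s) ^ l) • w l := by
  have hpow : ∀ l i : ℕ, (LieAlgebra.ad ℂ L x ^ i) (w l) =
      ((i.factorial : ℂ) * ((l + i).choose l : ℂ)) • w (l + i) := by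
    intro l i
    induction i with
    | zero => simp
    | succ i ih =>
      rw [ad_pow_succ_apply, ih, lie_smul, hw, smul_smul, Nat.factorial_succ, ← add_assoc]
      congr 1
      have h := Nat.choose_mul_succ_eq (l + i) l
      rw [show l + i + 1 - l = i + 1 by omega] at h
      have h' : ((l + i).choose l : ℂ) * ((l : ℂ) + i + 1) =
          ((l + i + 1).choose l : ℂ) * ((i : ℂ) + 1) := by exact_mod_cast h
      push_cast
      linear_combination (i.factorial : ℂ) * h'
  -- The sum may run over all `m ≤ n` independently of `l`: binomials vanish for `m < l`, and `w m`
  -- vanishes for `m > n`.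
  have hone : ∀ l, expAdFun (u • x) (w l) =
      ∑ m ∈ Finset.range (n + 1), ((m.choose l : ℂ) * u ^ (m - l)) • w m := by
    intro l
    have h0 : (LieAlgebra.ad ℂ L (u • x) ^ (n + 1)) (w l) = 0 := by
      rw [ad_smul_pow, hpow, hn _ (by omega), smul_zero, smul_zero]
    have hterm : ∀ i : ℕ, (i.factorial : ℂ)⁻¹ • (LieAlgebra.ad ℂ L (u • x) ^ i) (w l) =
        (((l + i).choose l : ℂ) * u ^ (l + i - l)) • w (l + i) := by
      intro i
      have := Nat.factorial_ne_zero i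
      rw [ad_smul_pow, hpow, smul_smul, smul_smul, Nat.add_sub_cancel_left]
      congr 1
      field_simp
    rw [expAdFun_eq h0, Finset.sum_congr rfl fun i _ => hterm i]
    have h1 := Finset.sum_Ico_eq_sum_range
      (fun m => ((m.choose l : ℂ) * u ^ (m - l)) • w m) l (l + (n + 1))
    rw [Nat.add_sub_cancel_left] at h1
    rw [← h1, Finset.range_eq_Ico]
    have h2 : ∑ m ∈ Finset.Ico 0 l, ((m.choose l : ℂ) * u ^ (m - l)) • w m = 0 := by
      refine Finset.sum_eq_zero fun m hm => ?_
      rw [Finset.mem_Ico] at hm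
      rw [Nat.choose_eq_zero_of_lt hm.2, Nat.cast_zero, zero_mul, zero_smul]
    have h3 : ∑ m ∈ Finset.Ico (n + 1) (l + (n + 1)), ((m.choose l : ℂ) * u ^ (m - l)) • w m = 0 := by
      refine Finset.sum_eq_zero fun m hm => ?_
      rw [Finset.mem_Ico] at hm
      rw [hn m (by omega), smul_zero]
    have h4 := Finset.sum_Ico_consecutive (fun m => ((m.choose l : ℂ) * u ^ (m - l)) • w m)
      (Nat.zero_le l) (show l ≤ l + (n + 1) by omega)
    have h5 := Finset.sum_Ico_consecutive (fun m => ((m.choose l : ℂ) * u ^ (m - l)) • w m)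
      (Nat.zero_le (n + 1)) (show n + 1 ≤ l + (n + 1) by omega)
    rw [h2, zero_add] at h4
    rw [h3, add_zero] at h5
    rw [h4, h5]
  have hlin : expAdFun (u • x) (∑ l ∈ Finset.range (n + 1), (s ^ (n - l) * t ^ l) • w l) =
      ∑ l ∈ Finset.range (n + 1), (s ^ (n - l) * t ^ l) • expAdFun (u • x) (w l) := by
    change (expAd (u • x) (hx.smul u)) _ = ∑ l ∈ _, _ • (expAd (u • x) (hx.smul u)) _
    rw [map_sum]
    simp only [map_smul]
  rw [hlin]
  simp only [hone, Finset.smul_sum, smul_smul]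
  rw [Finset.sum_comm]
  refine Finset.sum_congr rfl fun m hm => ?_
  rw [← Finset.sum_smul]
  congr 1
  rw [Finset.mem_range] at hm
  -- The coefficients of `w m` agree by the binomial theorem, with `s ^ (n - l)` split as `s ^ (n -
  -- m) * s ^ (m - l)`.
  rw [add_pow, Finset.mul_sum]
  symm
  refine Finset.sum_subset_zero_on_sdiff (Finset.range_mono (by omega)) ?_ ?_
  · intro l hl
    rw [Finset.mem_sdiff, Finset.mem_range, Finset.mem_range] at hl
    rw [Nat.choose_eq_zero_of_lt (by omega), Nat.cast_zero, zero_mul, mul_zero]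
  · intro l hl
    rw [Finset.mem_range] at hl
    rw [mul_pow, show n - l = (n - m) + (m - l) by omega, pow_add]
    ring

end Transport

/-! ### The inner automorphisms of the Monster Lie algebra -/

theorem X_eNeg (u : ℂ) : X u eNeg = eNeg := by
  change expAdFun _ _ = _
  rw [expAdFun_eq (N := 1) (by simp)]
  simp

theorem Y_fNeg (u : ℂ) : Y u fNeg = fNeg := by
  change expAdFun _ _ = _
  rw [expAdFun_eq (N := 1) (by simp)]
  simp

theorem lie_eNeg_h₁ : ⁅eNeg, h₁⁆ = -eNeg := by rw [← lie_skew, isGl2Tuple_neg.lie_a_e]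
theorem lie_eNeg_h₂ : ⁅eNeg, h₂⁆ = eNeg := by rw [← lie_skew, isGl2Tuple_neg.lie_b_e, neg_neg]
theorem lie_fNeg_h₁ : ⁅fNeg, h₁⁆ = fNeg := by rw [← lie_skew, isGl2Tuple_neg.lie_a_f, neg_neg]
theorem lie_fNeg_h₂ : ⁅fNeg, h₂⁆ = -fNeg := by rw [← lie_skew, isGl2Tuple_neg.lie_b_f]
theorem lie_fNeg_eNeg : ⁅fNeg, eNeg⁆ = h₂ - h₁ := by
  rw [← lie_skew, isGl2Tuple_neg.lie_e_f, neg_sub]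

theorem X_h₁ (u : ℂ) : X u h₁ = h₁ - u • eNeg := by
  change expAdFun _ _ = _
  rw [expAdFun_eq (N := 2) (by simp [pow_succ, lie_eNeg_h₁])]
  simp [Finset.sum_range_succ, lie_eNeg_h₁]
  module

theorem X_h₂ (u : ℂ) : X u h₂ = h₂ + u • eNeg := by
  change expAdFun _ _ = _
  rw [expAdFun_eq (N := 2) (by simp [pow_succ, lie_eNeg_h₂])]
  simp [Finset.sum_range_succ, lie_eNeg_h₂]

theorem X_fNeg (u : ℂ) : X u fNeg = fNeg + u • (h₁ - h₂) - u ^ 2 • eNeg := by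
  change expAdFun _ _ = _
  rw [expAdFun_eq (N := 3)
    (by simp [pow_succ, isGl2Tuple_neg.lie_e_f, lie_eNeg_h₁, lie_eNeg_h₂])]
  simp [Finset.sum_range_succ, pow_succ, isGl2Tuple_neg.lie_e_f, lie_eNeg_h₁, lie_eNeg_h₂]
  module

theorem Y_h₁ (u : ℂ) : Y u h₁ = h₁ + u • fNeg := by
  change expAdFun _ _ = _
  rw [expAdFun_eq (N := 2) (by simp [pow_succ, lie_fNeg_h₁])]
  simp [Finset.sum_range_succ, lie_fNeg_h₁]

theorem Y_h₂ (u : ℂ) : Y u h₂ = h₂ - u • fNeg := by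
  change expAdFun _ _ = _
  rw [expAdFun_eq (N := 2) (by simp [pow_succ, lie_fNeg_h₂])]
  simp [Finset.sum_range_succ, lie_fNeg_h₂]
  module

theorem Y_eNeg (u : ℂ) : Y u eNeg = eNeg + u • (h₂ - h₁) - u ^ 2 • fNeg := by
  change expAdFun _ _ = _
  rw [expAdFun_eq (N := 3) (by simp [pow_succ, lie_fNeg_eNeg, lie_fNeg_h₁, lie_fNeg_h₂])]
  simp [Finset.sum_range_succ, pow_succ, lie_fNeg_eNeg, lie_fNeg_h₁, lie_fNeg_h₂]
  module

/-- If the lower left entry is 0, so is the diagonal. Otherwise conjugation by `1 + u E₁₂` with `u =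
M₀₀ / M₁₀` carries `M₁₀ E₂₁` to `M`. -/
theorem gl2NegHom_nilpotent {M : Matrix (Fin 2) (Fin 2) ℂ} (htr : M 0 0 + M 1 1 = 0)
    (hdet : M 0 0 * M 1 1 - M 0 1 * M 1 0 = 0) :
    (∃ b : ℂ, gl2NegHom M = b • eNeg) ∨ ∃ u b : ℂ, gl2NegHom M = X u (b • fNeg) := by
  have h11 : M 1 1 = -M 0 0 := by linear_combination htr
  by_cases h10 : M 1 0 = 0
  · left
    have h00 : M 0 0 = 0 := by
      rw [h11, h10] at hdet
      simpa using hdet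
    refine ⟨M 0 1, ?_⟩
    rw [gl2NegHom_apply, h11, h00, h10]
    module
  · right
    obtain ⟨q, h00⟩ : ∃ q, M 0 0 = q * M 1 0 := ⟨M 0 0 / M 1 0, by field_simp⟩
    refine ⟨q, M 1 0, ?_⟩
    have h01 : M 0 1 = -(q ^ 2 * M 1 0) := by
      apply mul_right_cancel₀ h10
      rw [h11, h00] at hdet
      linear_combination -hdet
    rw [map_smul, X_fNeg, gl2NegHom_apply, h11, h01, h00]
    module

theorem isLocallyAdNilpotent_iff (x : Monster) : IsLocallyAdNilpotent x ↔
    ∃ M : Matrix (Fin 2) (Fin 2) ℂ, IsNilpotent M ∧ gl2NegHom M = x := by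
  constructor
  · intro hx
    obtain ⟨M, hM, htr, hdet⟩ := exists_of_isLocallyAdNilpotent hx
    refine ⟨M, ⟨2, ?_⟩, hM⟩
    have h11 : M 1 1 = -M 0 0 := by linear_combination htr
    rw [h11] at hdet
    have hsq : M 0 0 * M 0 0 + M 0 1 * M 1 0 = 0 := by linear_combination -hdet
    ext i j
    fin_cases i <;> fin_cases j <;> simp [pow_two, Matrix.mul_apply, Fin.sum_univ_two, h11]
    · exact hsq
    · ring
    · ring
    · linear_combination hsq
  · rintro ⟨M, ⟨n, hM⟩, rfl⟩
    have htr : M 0 0 + M 1 1 = 0 := by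
      have := (Matrix.isNilpotent_trace_of_isNilpotent ⟨n, hM⟩).eq_zero
      rwa [Matrix.trace_fin_two] at this
    have hdet : M 0 0 * M 1 1 - M 0 1 * M 1 0 = 0 := by
      have hn : n ≠ 0 := by
        rintro rfl
        exact one_ne_zero hM
      have := congrArg Matrix.det hM
      rw [Matrix.det_pow, Matrix.det_zero, pow_eq_zero_iff hn, Matrix.det_fin_two] at this
      exact this
    rcases gl2NegHom_nilpotent htr hdet with ⟨b, h⟩ | ⟨u, b, h⟩
    · rw [h]
      exact eNeg_isLocallyAdNilpotent.smul b
    · rw [h]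
      exact (fNeg_isLocallyAdNilpotent.smul b).map _

/-- By the normal form above, each exponential is `X b` or that of `X u (b • fNeg)`, which equals `X
u * Y b * (X u)⁻¹` by `expAd_map`. -/
theorem inn_monster : Inn Monster = Subgroup.closure (Set.range X ∪ Set.range Y) := by
  apply le_antisymm
  · rw [Inn, Subgroup.closure_le]
    rintro _ ⟨x, hx, rfl⟩
    have hX : ∀ u, X u ∈ Subgroup.closure (Set.range X ∪ Set.range Y) := fun u =>
      Subgroup.subset_closure (Or.inl ⟨u, rfl⟩)
    have hY : ∀ u, Y u ∈ Subgroup.closure (Set.range X ∪ Set.range Y) := fun u =>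
      Subgroup.subset_closure (Or.inr ⟨u, rfl⟩)
    obtain ⟨M, rfl, htr, hdet⟩ := exists_of_isLocallyAdNilpotent hx
    have key : ∀ y (hy : IsLocallyAdNilpotent y), gl2NegHom M = y →
        expAd y hy ∈ Subgroup.closure (Set.range X ∪ Set.range Y) →
        expAd (gl2NegHom M) hx ∈ Subgroup.closure (Set.range X ∪ Set.range Y) := by
      rintro y hy rfl h
      exact h
    rcases gl2NegHom_nilpotent htr hdet with ⟨b, h⟩ | ⟨u, b, h⟩
    · exact key _ (eNeg_isLocallyAdNilpotent.smul b) h (hX b)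
    · refine key _ ((fNeg_isLocallyAdNilpotent.smul b).map _) h ?_
      rw [expAd_map (fNeg_isLocallyAdNilpotent.smul b)]
      exact mul_mem (mul_mem (hX u) (hY b)) (inv_mem (hX u))
  · rw [Subgroup.closure_le]
    rintro _ (⟨u, rfl⟩ | ⟨u, rfl⟩)
    · exact Subgroup.subset_closure ⟨_, _, rfl⟩
    · exact Subgroup.subset_closure ⟨_, _, rfl⟩

/-! ### `SL₂` is generated by elementary matrices -/

/-- The matrix `1 + u E₁₂`. -/
def upperSL (u : ℂ) : Matrix.SpecialLinearGroup (Fin 2) ℂ :=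
  ⟨!![1, u; 0, 1], by simp [Matrix.det_fin_two]⟩

/-- The matrix `1 + u E₂₁`. -/
def lowerSL (u : ℂ) : Matrix.SpecialLinearGroup (Fin 2) ℂ :=
  ⟨!![1, 0; u, 1], by simp [Matrix.det_fin_two]⟩

theorem coe_inv_upperSL (u : ℂ) : ((upperSL u)⁻¹).1 = !![1, -u; 0, 1] := by
  change Matrix.adjugate !![1, u; 0, 1] = _
  rw [Matrix.adjugate_fin_two_of, neg_zero]

theorem coe_inv_lowerSL (u : ℂ) : ((lowerSL u)⁻¹).1 = !![1, 0; -u, 1] := by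
  change Matrix.adjugate !![1, 0; u, 1] = _
  rw [Matrix.adjugate_fin_two_of, neg_zero]

theorem closure_elementary :
    Subgroup.closure (Set.range upperSL ∪ Set.range lowerSL) = ⊤ := by
  rw [eq_top_iff]
  have hX : ∀ u, upperSL u ∈ Subgroup.closure (Set.range upperSL ∪ Set.range lowerSL) := fun u =>
    Subgroup.subset_closure (Or.inl ⟨u, rfl⟩)
  have hY : ∀ u, lowerSL u ∈ Subgroup.closure (Set.range upperSL ∪ Set.range lowerSL) := fun u =>
    Subgroup.subset_closure (Or.inr ⟨u, rfl⟩)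
  have key : ∀ A : Matrix.SpecialLinearGroup (Fin 2) ℂ, A 1 0 ≠ 0 →
      A ∈ Subgroup.closure (Set.range upperSL ∪ Set.range lowerSL) := by
    intro A hA
    have hdet := A.det_coe
    rw [Matrix.det_fin_two] at hdet
    -- With a nonzero lower left entry, three elementary factors suffice. If that entry is 0,
    -- multiplication by `lowerSL 1` replaces it by `A 0 0 ≠ 0`.
    have : A = upperSL ((A 0 0 - 1) / A 1 0) * lowerSL (A 1 0) *
        upperSL ((A 1 1 - 1) / A 1 0) := by
      apply Subtype.ext
      change A.1 = !![1, (A 0 0 - 1) / A 1 0; 0, 1] * !![1, 0; A 1 0, 1] *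
        !![1, (A 1 1 - 1) / A 1 0; 0, 1]
      rw [Matrix.mul_fin_two, Matrix.mul_fin_two]
      ext i j
      fin_cases i <;> fin_cases j <;> simp <;> field_simp
      · ring
      · linear_combination -hdet
      · ring
    rw [this]
    exact mul_mem (mul_mem (hX _) (hY _)) (hX _)
  intro A _
  by_cases hA : A 1 0 = 0
  · have hdet := A.det_coe
    rw [Matrix.det_fin_two, hA, mul_zero, sub_zero] at hdet
    have h00 : A 0 0 ≠ 0 := by
      intro h
      rw [h, zero_mul] at hdet
      exact zero_ne_one hdet
    have h1 : lowerSL 1 * A ∈ Subgroup.closure (Set.range upperSL ∪ Set.range lowerSL) := by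
      apply key
      change ((!![1, 0; 1, 1] : Matrix (Fin 2) (Fin 2) ℂ) * A.1) 1 0 ≠ 0
      simpa [Matrix.mul_apply, Fin.sum_univ_two, hA] using h00
    have := mul_mem (inv_mem (hY 1)) h1
    rwa [inv_mul_cancel_left] at this
  · exact key A hA

/-! ### The action of `SL₂` on the Monster Lie algebra -/

section Veronese

variable {L : Type*} [LieRing L] [LieAlgebra ℂ L]

/-- The Veronese vector `∑ v₁^(j-1-ℓ) v₀^ℓ e_{ℓ,jk}`. -/
def veronese (p : Free →ₗ⁅ℂ⁆ L) (a : Index) (v : Fin 2 → ℂ) : L :=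
  ∑ l ∈ Finset.range ((a.j - 1).toNat + 1),
    (v 1 ^ ((a.j - 1).toNat - l) * v 0 ^ l) • posVec p l a

variable {p : Free →ₗ⁅ℂ⁆ L} (hp : KillsRelators p) {a : Index} (ha : 1 ≤ a.j)

theorem veronese_single : veronese p a ![0, 1] = p (genE a) := by
  rw [veronese, Finset.sum_eq_single 0]
  · simp [posVec_zero]
  · intro l _ hl
    simp [hl]
  · simp

include hp ha

theorem expAdFun_e_veronese (hnil : IsLocallyAdNilpotent (p (genE idxNeg))) (u : ℂ)
    (v : Fin 2 → ℂ) : expAdFun (u • p (genE idxNeg)) (veronese p a v) =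
      veronese p a ![v 0 + u * v 1, v 1] :=
  expAdFun_string (fun l => lie_e_posVec l a)
    (fun l hl => hp.posVec_eq_zero ha (by omega)) hnil u (v 1) (v 0)

theorem expAdFun_f_veronese (hnil : IsLocallyAdNilpotent (p (genF idxNeg))) (u : ℂ)
    (v : Fin 2 → ℂ) : expAdFun (u • p (genF idxNeg)) (veronese p a v) =
      veronese p a ![v 0, v 1 + u * v 0] := by
  obtain ⟨n, hn⟩ : ∃ n : ℕ, a.j = n + 1 := ⟨(a.j - 1).toNat, by omega⟩
  have hn' : (a.j - 1).toNat = n := by omega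
  -- Read backwards, the string consists of divided powers of `f_{-1}`, so `expAdFun_string` applies
  -- with the two coordinates exchanged.
  set w : ℕ → L := fun k => if k ≤ n then posVec p (n - k) a else 0 with hw
  have hrev : ∀ v : Fin 2 → ℂ, veronese p a v =
      ∑ k ∈ Finset.range (n + 1), (v 0 ^ (n - k) * v 1 ^ k) • w k := by
    intro v
    rw [veronese, hn', ← Finset.sum_range_reflect]
    refine Finset.sum_congr rfl fun k hk => ?_
    rw [Finset.mem_range] at hk
    rw [hw]
    dsimp only
    rw [if_pos (by omega), show n + 1 - 1 - k = n - k by omega, show n - (n - k) = k by omega,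
      mul_comm]
  have hstring : ∀ k, ⁅p (genF idxNeg), w k⁆ = ((k : ℂ) + 1) • w (k + 1) := by
    intro k
    rw [hw]
    dsimp only
    rcases lt_trichotomy k n with h | h | h
    · rw [if_pos h.le, if_pos (by omega), show n - k = (n - (k + 1)) + 1 by omega,
        hp.lie_f_posVec_succ ha, hn, Nat.cast_sub (by omega)]
      congr 1
      push_cast
      ring
    · rw [if_pos h.le, if_neg (by omega), h, Nat.sub_self, hp.lie_f_posVec_zero ha, smul_zero]
    · rw [if_neg (by omega), if_neg (by omega), lie_zero, smul_zero]
  rw [hrev, hrev]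
  exact expAdFun_string hstring (fun k hk => if_neg (by omega)) hnil u (v 0) (v 1)

end Veronese

/-- The pairs consisting of an automorphism of `𝔪` and a matrix in `SL₂` acting compatibly. -/
def compatiblePairs :
    Subgroup ((Monster ≃ₗ⁅ℂ⁆ Monster) × Matrix.SpecialLinearGroup (Fin 2) ℂ) where
  carrier := {x |
    (∀ M, x.1 (gl2NegHom M) = gl2NegHom (x.2.1 * M * (x.2⁻¹).1)) ∧
    (∀ a : Index, 1 ≤ a.j → ∀ v, x.1 (veronese proj a v) = veronese proj a (x.2.1.mulVec v)) ∧
    -- On the negative side `e_{-1}` and `f_{-1}` exchange roles, hence the swapped coordinates.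
    ∀ a : Index, 1 ≤ a.j → ∀ v, x.1 (veronese (proj.comp chevalley) a ![v 1, v 0]) =
      veronese (proj.comp chevalley) a ![x.2.1.mulVec v 1, x.2.1.mulVec v 0]}
  one_mem' := by
    refine ⟨fun M => ?_, fun a _ v => ?_, fun a _ v => ?_⟩
    · simp only [Prod.fst_one, Prod.snd_one, inv_one]
      change gl2NegHom M = gl2NegHom (1 * M * 1)
      rw [one_mul, mul_one]
    · change veronese proj a v = veronese proj a (Matrix.mulVec 1 v)
      rw [Matrix.one_mulVec]
    · change _ = veronese _ a ![Matrix.mulVec 1 v 1, Matrix.mulVec 1 v 0]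
      rw [Matrix.one_mulVec]
      rfl
  mul_mem' := by
    rintro ⟨g, A⟩ ⟨g', A'⟩ ⟨h1, h2, h3⟩ ⟨h1', h2', h3'⟩
    dsimp only at h1 h2 h3 h1' h2' h3'
    refine ⟨fun M => ?_, fun a ha v => ?_, fun a ha v => ?_⟩
    · change g (g' _) = gl2NegHom ((A.1 * A'.1) * M * ((A * A')⁻¹).1)
      rw [h1', h1, mul_inv_rev]
      change _ = gl2NegHom ((A.1 * A'.1) * M * ((A'⁻¹).1 * (A⁻¹).1))
      simp only [Matrix.mul_assoc]
    · change g (g' _) = veronese proj a ((A.1 * A'.1).mulVec v)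
      rw [h2' a ha, h2 a ha, Matrix.mulVec_mulVec]
    · change g (g' _) = veronese _ a ![(A.1 * A'.1).mulVec v 1, (A.1 * A'.1).mulVec v 0]
      rw [h3' a ha, h3 a ha, Matrix.mulVec_mulVec]
  inv_mem' := by
    rintro ⟨g, A⟩ ⟨h1, h2, h3⟩
    dsimp only at h1 h2 h3
    have hA : A.1 * (A⁻¹).1 = 1 := congrArg Subtype.val (mul_inv_cancel A)
    refine ⟨fun M => ?_, fun a ha v => ?_, fun a ha v => ?_⟩
    · change g.symm _ = gl2NegHom ((A⁻¹).1 * M * ((A⁻¹)⁻¹).1)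
      rw [inv_inv, LieEquiv.symm_apply_eq, h1]
      rw [show A.1 * ((A⁻¹).1 * M * A.1) * (A⁻¹).1 = (A.1 * (A⁻¹).1) * M * (A.1 * (A⁻¹).1) by
        simp only [Matrix.mul_assoc], hA, one_mul, mul_one]
    · change g.symm _ = veronese proj a ((A⁻¹).1.mulVec v)
      rw [LieEquiv.symm_apply_eq, h2 a ha, Matrix.mulVec_mulVec, hA, Matrix.one_mulVec]
    · change g.symm _ = veronese _ a ![(A⁻¹).1.mulVec v 1, (A⁻¹).1.mulVec v 0]
      rw [LieEquiv.symm_apply_eq, h3 a ha, Matrix.mulVec_mulVec, hA, Matrix.one_mulVec]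

theorem X_mem_compatiblePairs (u : ℂ) : (X u, upperSL u) ∈ compatiblePairs := by
  refine ⟨fun M => ?_, fun a ha v => ?_, fun a ha v => ?_⟩
  · change X u (gl2NegHom M) = gl2NegHom (!![1, u; 0, 1] * M * ((upperSL u)⁻¹).1)
    rw [coe_inv_upperSL, gl2NegHom_apply, gl2NegHom_apply]
    simp only [map_add, map_smul, X_h₁, X_h₂, X_eNeg, X_fNeg, Matrix.mul_apply,
      Fin.sum_univ_two, Matrix.of_apply, Matrix.cons_val', Matrix.cons_val_zero,
      Matrix.cons_val_one, Matrix.cons_val_fin_one]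
    module
  · have hv : (upperSL u).1.mulVec v = ![v 0 + u * v 1, v 1] := by
      ext i; fin_cases i <;> simp [upperSL, Matrix.mulVec, dotProduct, Fin.sum_univ_two]
    rw [hv]
    exact expAdFun_e_veronese killsRelators_proj ha eNeg_isLocallyAdNilpotent u v
  · have hv : (upperSL u).1.mulVec v = ![v 0 + u * v 1, v 1] := by
      ext i; fin_cases i <;> simp [upperSL, Matrix.mulVec, dotProduct, Fin.sum_univ_two]
    have hE : (proj.comp chevalley) (genF idxNeg) = eNeg := by simp [eNeg, e]
    have h := expAdFun_f_veronese killsRelators_proj.comp_chevalley ha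
      (by rw [hE]; exact eNeg_isLocallyAdNilpotent) u ![v 1, v 0]
    rw [hE] at h
    rw [hv]
    exact h

theorem Y_mem_compatiblePairs (u : ℂ) : (Y u, lowerSL u) ∈ compatiblePairs := by
  refine ⟨fun M => ?_, fun a ha v => ?_, fun a ha v => ?_⟩
  · change Y u (gl2NegHom M) = gl2NegHom (!![1, 0; u, 1] * M * ((lowerSL u)⁻¹).1)
    rw [coe_inv_lowerSL, gl2NegHom_apply, gl2NegHom_apply]
    simp only [map_add, map_smul, Y_h₁, Y_h₂, Y_eNeg, Y_fNeg, Matrix.mul_apply,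
      Fin.sum_univ_two, Matrix.of_apply, Matrix.cons_val', Matrix.cons_val_zero,
      Matrix.cons_val_one, Matrix.cons_val_fin_one]
    module
  · have hv : (lowerSL u).1.mulVec v = ![v 0, v 1 + u * v 0] := by
      ext i; fin_cases i <;> simp [lowerSL, Matrix.mulVec, dotProduct, Fin.sum_univ_two, add_comm]
    rw [hv]
    exact expAdFun_f_veronese killsRelators_proj ha fNeg_isLocallyAdNilpotent u v
  · have hv : (lowerSL u).1.mulVec v = ![v 0, v 1 + u * v 0] := by
      ext i; fin_cases i <;> simp [lowerSL, Matrix.mulVec, dotProduct, Fin.sum_univ_two, add_comm]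
    have hE : (proj.comp chevalley) (genE idxNeg) = fNeg := by simp [fNeg, f]
    have h := expAdFun_e_veronese killsRelators_proj.comp_chevalley ha
      (by rw [hE]; exact fNeg_isLocallyAdNilpotent) u ![v 1, v 0]
    rw [hE] at h
    rw [hv]
    exact h

/-- Such a `g` fixes the Levi part and all Veronese vectors, among them the `e_{jk}` and `f_{jk}`;
these generate `𝔪`. -/
theorem fst_eq_one_of_compatible {g : Monster ≃ₗ⁅ℂ⁆ Monster} (hg : (g, 1) ∈ compatiblePairs) :
    g = 1 := by
  obtain ⟨h1, h2, h3⟩ := hg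
  have h1' : ∀ M, g (gl2NegHom M) = gl2NegHom M := by
    intro M
    have := h1 M
    simp only [inv_one] at this
    refine this.trans ?_
    change gl2NegHom (1 * M * 1) = gl2NegHom M
    rw [one_mul, mul_one]
  let S : LieSubalgebra ℂ Monster :=
    { carrier := {x | g x = x}
      zero_mem' := map_zero g
      add_mem' := fun {x y} hx hy => by
        change g (x + y) = x + y
        rw [map_add, hx, hy]
      smul_mem' := fun t x hx => by
        change g (t • x) = t • x
        rw [map_smul, hx]
      lie_mem' := fun {x y} hx hy => by
        change g ⁅x, y⁆ = ⁅x, y⁆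
        rw [LieEquiv.map_lie, hx, hy] }
  have hlevi : ∀ x ∈ levi proj, g x = x := by
    intro x hx
    obtain ⟨M, rfl⟩ := exists_gl2NegHom_of_mem_levi hx
    exact h1' M
  have htop : S = ⊤ := by
    refine eq_top_of_generators S (fun a => ?_) (fun a => ?_) fun a => hlevi _ (h_mem_levi a)
    · rcases eq_idxNeg_or a with rfl | ha
      · exact hlevi _ e_mem_levi
      · have h : g (veronese proj a ![0, 1]) = veronese proj a (Matrix.mulVec 1 ![0, 1]) :=
          h2 a ha ![0, 1]
        rwa [Matrix.one_mulVec, veronese_single] at h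
    · rcases eq_idxNeg_or a with rfl | ha
      · exact hlevi _ f_mem_levi
      · have h : g (veronese (proj.comp chevalley) a ![0, 1]) =
            veronese (proj.comp chevalley) a
              ![(1 : Matrix (Fin 2) (Fin 2) ℂ).mulVec ![1, 0] 1,
                (1 : Matrix (Fin 2) (Fin 2) ℂ).mulVec ![1, 0] 0] := h3 a ha ![1, 0]
        rw [Matrix.one_mulVec] at h
        change g (proj (genF a)) = proj (genF a)
        simpa [veronese_single] using h
  apply LieEquiv.ext
  intro x
  have : x ∈ S := by rw [htop]; trivial
  exact this

theorem posVec_idxTwo_independent (s t : ℂ)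
    (hst : s • posVec proj 0 idxTwo + t • posVec proj 1 idxTwo = 0) : s = 0 ∧ t = 0 := by
  have h1 := congrArg (fun x => ⁅h₁, x⁆) hst
  simp only [lie_add, lie_smul, lie_zero] at h1
  rw [← proj_genH₁, killsRelators_proj.lie_h₁_posVec, killsRelators_proj.lie_h₁_posVec] at h1
  have h2 : t • posVec proj 1 idxTwo = 0 := by
    rw [← sub_eq_zero.2 (h1.trans hst.symm)]
    push_cast
    module
  have ht : t = 0 := (smul_eq_zero.1 h2).resolve_right
    (posVec_proj_ne_zero ⟨by simp [idxTwo], by simp [idxTwo]⟩)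
  rw [ht, zero_smul, add_zero] at hst
  exact ⟨(smul_eq_zero.1 hst).resolve_right
    (posVec_proj_ne_zero ⟨by simp [idxTwo], by simp [idxTwo]⟩), ht⟩

/-- For `j = 2` the Veronese map is linear and injective, so it exhibits the faithful standard
representation. Conjugation on `𝔤𝔩₂` alone would not detect `-1`. -/
theorem snd_eq_one_of_compatible {A : Matrix.SpecialLinearGroup (Fin 2) ℂ}
    (hA : (1, A) ∈ compatiblePairs) : A = 1 := by
  obtain ⟨_, h2, _⟩ := hA
  have hver : ∀ v, veronese proj idxTwo v =
      v 1 • posVec proj 0 idxTwo + v 0 • posVec proj 1 idxTwo := by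
    intro v
    rw [veronese, show (idxTwo.j - 1).toNat = 1 from rfl]
    simp [Finset.sum_range_succ]
  have hv : ∀ v, A.1.mulVec v = v := by
    intro v
    have h : veronese proj idxTwo v = veronese proj idxTwo (A.1.mulVec v) :=
      h2 idxTwo (by simp [idxTwo]) v
    rw [hver, hver] at h
    obtain ⟨e1, e0⟩ := posVec_idxTwo_independent (A.1.mulVec v 1 - v 1) (A.1.mulVec v 0 - v 0) (by
      rw [← sub_eq_zero.2 h.symm]
      module)
    ext i
    fin_cases i
    · exact sub_eq_zero.1 e0
    · exact sub_eq_zero.1 e1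
  apply Subtype.ext
  apply Matrix.ext_of_mulVec_single
  intro i
  rw [hv]
  exact (Matrix.one_mulVec _).symm

/-- The subgroup generated by the pairs `(X u, upperSL u)` and `(Y u, lowerSL u)` is the graph of
the isomorphism: both projections are injective, with images `Inn Monster` and all of `SL₂`. No
homomorphism out of `SL₂` has to be defined beforehand. -/
theorem nonempty_inn_mulEquiv_SL :
    Nonempty (Inn Monster ≃* Matrix.SpecialLinearGroup (Fin 2) ℂ) := by
  set S : Set ((Monster ≃ₗ⁅ℂ⁆ Monster) × Matrix.SpecialLinearGroup (Fin 2) ℂ) :=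
    Set.range (fun u => (X u, upperSL u)) ∪ Set.range fun u => (Y u, lowerSL u) with hS
  have hle : Subgroup.closure S ≤ compatiblePairs := by
    rw [Subgroup.closure_le]
    rintro _ (⟨u, rfl⟩ | ⟨u, rfl⟩)
    exacts [X_mem_compatiblePairs u, Y_mem_compatiblePairs u]
  let F := (MonoidHom.fst (Monster ≃ₗ⁅ℂ⁆ Monster)
    (Matrix.SpecialLinearGroup (Fin 2) ℂ)).comp (Subgroup.closure S).subtype
  let G := (MonoidHom.snd (Monster ≃ₗ⁅ℂ⁆ Monster)
    (Matrix.SpecialLinearGroup (Fin 2) ℂ)).comp (Subgroup.closure S).subtype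
  have hF : Function.Injective F := by
    rw [injective_iff_map_eq_one]
    rintro ⟨⟨g, A⟩, hgA⟩ hg
    change g = 1 at hg
    subst hg
    exact Subtype.ext (Prod.ext rfl (snd_eq_one_of_compatible (hle hgA)))
  have hG : Function.Injective G := by
    rw [injective_iff_map_eq_one]
    rintro ⟨⟨g, A⟩, hgA⟩ hA
    change A = 1 at hA
    subst hA
    exact Subtype.ext (Prod.ext (fst_eq_one_of_compatible (hle hgA)) rfl)
  have hFr : F.range = Inn Monster := by
    rw [MonoidHom.range_comp, Subgroup.range_subtype, MonoidHom.map_closure, inn_monster, hS,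
      Set.image_union, ← Set.range_comp, ← Set.range_comp]
    rfl
  have hGr : G.range = ⊤ := by
    rw [MonoidHom.range_comp, Subgroup.range_subtype, MonoidHom.map_closure, ← closure_elementary,
      hS, Set.image_union, ← Set.range_comp, ← Set.range_comp]
    rfl
  exact ⟨(MulEquiv.subgroupCongr hFr.symm).trans ((MonoidHom.ofInjective hF).symm.trans
    ((MonoidHom.ofInjective hG).trans ((MulEquiv.subgroupCongr hGr).trans Subgroup.topEquiv)))⟩

/-! ### The subalgebras `𝔤𝔩₂(ℓ,j,k)` -/

theorem posVec_proj_comp_chevalley (l : ℕ) (a : Index) :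
    posVec (proj.comp chevalley) l a = fExt l a := by
  simp [posVec, fExt, fNeg, f]

theorem lie_eNeg_eExt (l : ℕ) (a : Index) : ⁅eNeg, eExt l a⁆ = ((l : ℂ) + 1) • eExt (l + 1) a :=
  lie_e_posVec l a

theorem lie_fNeg_fExt (l : ℕ) (a : Index) : ⁅fNeg, fExt l a⁆ = ((l : ℂ) + 1) • fExt (l + 1) a := by
  have h := lie_e_posVec (p := proj.comp chevalley) l a
  rw [LieHom.comp_apply, chevalley_genE] at h
  rw [posVec_proj_comp_chevalley, posVec_proj_comp_chevalley] at h
  exact h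

theorem lie_h₁_eExt (l : ℕ) (a : Index) : ⁅h₁, eExt l a⁆ = ((l : ℂ) + 1) • eExt l a := by
  rw [← proj_genH₁]
  exact killsRelators_proj.lie_h₁_posVec l a

theorem lie_h₂_eExt (l : ℕ) (a : Index) : ⁅h₂, eExt l a⁆ = ((a.j : ℂ) - l) • eExt l a := by
  rw [← proj_genH₂]
  exact killsRelators_proj.lie_h₂_posVec l a

theorem lie_h₁_fExt (l : ℕ) (a : Index) : ⁅h₁, fExt l a⁆ = -(((l : ℂ) + 1) • fExt l a) := by
  have h := killsRelators_proj.comp_chevalley.lie_h₁_posVec l a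
  rw [LieHom.comp_apply, chevalley_genH₁, map_neg, proj_genH₁, neg_lie,
    posVec_proj_comp_chevalley] at h
  rw [← h, neg_neg]

theorem lie_h₂_fExt (l : ℕ) (a : Index) : ⁅h₂, fExt l a⁆ = -(((a.j : ℂ) - l) • fExt l a) := by
  have h := killsRelators_proj.comp_chevalley.lie_h₂_posVec l a
  rw [LieHom.comp_apply, chevalley_genH₂, map_neg, proj_genH₂, neg_lie,
    posVec_proj_comp_chevalley] at h
  rw [← h, neg_neg]

/-! ### Brackets of `e_{ℓ,jk}` with `f_{ℓ,jk}`. -/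

section

variable {a : Index} (ha : 1 ≤ a.j)
include ha

theorem lie_fNeg_eExt_zero : ⁅fNeg, eExt 0 a⁆ = 0 := killsRelators_proj.lie_f_posVec_zero ha

theorem lie_fNeg_eExt_succ (l : ℕ) : ⁅fNeg, eExt (l + 1) a⁆ = ((a.j : ℂ) - l - 1) • eExt l a :=
  killsRelators_proj.lie_f_posVec_succ ha l

theorem lie_eNeg_fExt_succ (l : ℕ) : ⁅eNeg, fExt (l + 1) a⁆ = ((a.j : ℂ) - l - 1) • fExt l a := by
  have h := killsRelators_proj.comp_chevalley.lie_f_posVec_succ ha l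
  rw [posVec_proj_comp_chevalley, posVec_proj_comp_chevalley, LieHom.comp_apply,
    chevalley_genF] at h
  exact h

/-- The second bracket is carried along for the induction: applying `ad e_{-1}` to it gives the next
diagonal bracket, and applying `ad f_{-1}` to that gives the next mixed one. The constant is
multiplied by `-(j - 1 - ℓ) / (ℓ + 1)` at each step, which is nonzero while `ℓ + 1 < j`. -/
theorem lie_eExt_fExt (l : ℕ) (hl : (l : ℤ) < a.j) : ∃ κ : ℂ, κ ≠ 0 ∧
    ⁅eExt l a, fExt l a⁆ = κ • (((l : ℂ) + 1) • h₂ + ((a.j : ℂ) - l) • h₁) ∧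
    ⁅eExt l a, fExt (l + 1) a⁆ = (((a.j : ℂ) - 1 - l) * κ) • fNeg := by
  induction l with
  | zero =>
    have h0 : ⁅eExt 0 a, fExt 0 a⁆ = -(h₂ + (a.j : ℂ) • h₁) := by
      rw [← proj_genH]
      simp only [eExt, fExt, Nat.factorial_zero, Nat.cast_one, inv_one, pow_zero, one_smul,
        Module.End.one_apply]
      exact lie_e_f_self a
    refine ⟨-1, by simp, ?_, ?_⟩
    · rw [h0]
      push_cast
      module
    · have h1 := lie_fNeg_fExt 0 a
      rw [Nat.cast_zero, zero_add, one_smul] at h1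
      have h := leibniz_lie fNeg (eExt 0 a) (fExt 0 a)
      rw [lie_fNeg_eExt_zero ha, zero_lie, zero_add, h1, h0, lie_neg, lie_add, lie_smul,
        lie_fNeg_h₁, lie_fNeg_h₂] at h
      rw [zero_add, ← h]
      push_cast
      module
  | succ l ih =>
    have hl0 : (l : ℂ) + 1 ≠ 0 := by exact_mod_cast Nat.succ_ne_zero l
    have hl1 : (l : ℂ) + 2 ≠ 0 := by exact_mod_cast Nat.succ_ne_zero (l + 1)
    have hj : (a.j : ℂ) - 1 - l ≠ 0 := by
      have : a.j - 1 - l ≠ 0 := by push_cast at hl; omega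
      exact_mod_cast this
    obtain ⟨κ, hκ, h1, h2⟩ := ih (by push_cast at hl; omega)
    have key1 : ⁅eExt (l + 1) a, fExt (l + 1) a⁆ = (-(((a.j : ℂ) - 1 - l) * κ) / ((l : ℂ) + 1)) •
        ((((l + 1 : ℕ) : ℂ) + 1) • h₂ + ((a.j : ℂ) - (l + 1 : ℕ)) • h₁) := by
      have h := leibniz_lie eNeg (eExt l a) (fExt (l + 1) a)
      rw [h2, lie_smul, isGl2Tuple_neg.lie_e_f, lie_eNeg_eExt, smul_lie, lie_eNeg_fExt_succ ha,
        lie_smul, h1, ← sub_eq_iff_eq_add] at h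
      apply smul_right_injective _ hl0
      dsimp only
      rw [← h]
      match_scalars <;> field_simp <;> ring
    refine ⟨_, div_ne_zero (neg_ne_zero.2 (mul_ne_zero hj hκ)) hl0, key1, ?_⟩
    have h := leibniz_lie fNeg (eExt (l + 1) a) (fExt (l + 1) a)
    rw [key1, lie_smul, lie_add, lie_smul, lie_smul, lie_fNeg_h₁, lie_fNeg_h₂,
      lie_fNeg_eExt_succ ha, smul_lie, h2, lie_fNeg_fExt, lie_smul, ← sub_eq_iff_eq_add'] at h
    apply smul_right_injective _ hl1
    dsimp only
    rw [show (l : ℂ) + 2 = ((l + 1 : ℕ) : ℂ) + 1 by push_cast; ring, ← h]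
    match_scalars
    field_simp
    ring

/-- With `m = ℓ + 1` and `n = j - ℓ` the weights of `e_{ℓ,jk}` under `h₁, h₂`, the diagonal units
are `h₁ / m` and `-h₂ / n`. Dividing `f_{ℓ,jk}` by `κ m n` turns the bracket `κ (m h₂ + n h₁)` into
their difference. -/
theorem nonempty_gl2Equiv_gl2Im {l : ℕ} (hl : (l : ℤ) < a.j) :
    Nonempty (Matrix (Fin 2) (Fin 2) ℂ ≃ₗ⁅ℂ⁆ gl2Im l a) := by
  obtain ⟨κ, hκ, hEF, -⟩ := lie_eExt_fExt ha l hl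
  obtain ⟨m, hm⟩ : ∃ m : ℂ, m = (l : ℂ) + 1 := ⟨_, rfl⟩
  obtain ⟨n, hn⟩ : ∃ n : ℂ, n = (a.j : ℂ) - l := ⟨_, rfl⟩
  have hm0 : m ≠ 0 := by rw [hm]; exact_mod_cast Nat.succ_ne_zero l
  have hn0 : n ≠ 0 := by
    have : a.j - l ≠ 0 := by omega
    rw [hn]
    exact_mod_cast this
  have h1e := lie_h₁_eExt l a
  have h2e := lie_h₂_eExt l a
  have h1f := lie_h₁_fExt l a
  have h2f := lie_h₂_fExt l a
  rw [← hm, ← hn] at hEF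
  rw [← hm] at h1e h1f
  rw [← hn] at h2e h2f
  have h12 := isGl2Tuple_neg.lie_a_b
  have h21 : ⁅h₂, h₁⁆ = 0 := by rw [← lie_skew, h12, neg_zero]
  have H : IsGl2Tuple (m⁻¹ • h₁) (-(n⁻¹ • h₂)) (eExt l a) ((κ * m * n)⁻¹ • fExt l a) :=
    { lie_a_b := by simp [h12]
      lie_a_e := by rw [smul_lie, h1e, smul_smul, inv_mul_cancel₀ hm0, one_smul]
      lie_a_f := by
        rw [smul_lie, lie_smul, h1f]
        match_scalars
        field_simp
      lie_b_e := by rw [neg_lie, smul_lie, h2e, smul_smul, inv_mul_cancel₀ hn0, one_smul]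
      lie_b_f := by
        rw [neg_lie, smul_lie, lie_smul, h2f]
        match_scalars
        field_simp
      lie_e_f := by
        rw [lie_smul, hEF]
        match_scalars <;> field_simp }
  have hab : ∀ s t : ℂ, s • m⁻¹ • h₁ + t • -(n⁻¹ • h₂) = 0 → s = 0 ∧ t = 0 := by
    intro s t hst
    obtain ⟨hs, ht⟩ := h₁_h₂_independent (s * m⁻¹) (-(t * n⁻¹)) (by rw [← hst]; module)
    simpa [hm0, hn0] using And.intro hs ht
  have hK : LieSubalgebra.lieSpan ℂ Monster
      {eExt l a, (κ * m * n)⁻¹ • fExt l a, m⁻¹ • h₁, -(n⁻¹ • h₂)} = gl2Im l a := by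
    have hc : κ * m * n ≠ 0 := mul_ne_zero (mul_ne_zero hκ hm0) hn0
    apply le_antisymm
    · rw [LieSubalgebra.lieSpan_le]
      have hx : ∀ x ∈ ({eExt l a, fExt l a, h₁, h₂} : Set Monster), x ∈ gl2Im l a := fun x hx =>
        LieSubalgebra.subset_lieSpan hx
      rintro x (rfl | rfl | rfl | rfl)
      exacts [hx _ (by simp), (gl2Im l a).smul_mem _ (hx _ (by simp)),
        (gl2Im l a).smul_mem _ (hx _ (by simp)),
        neg_mem ((gl2Im l a).smul_mem _ (hx _ (by simp)))]
    · rw [gl2Im, LieSubalgebra.lieSpan_le]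
      set K := LieSubalgebra.lieSpan ℂ Monster
        {eExt l a, (κ * m * n)⁻¹ • fExt l a, m⁻¹ • h₁, -(n⁻¹ • h₂)} with hKdef
      have hx : ∀ x ∈ ({eExt l a, (κ * m * n)⁻¹ • fExt l a, m⁻¹ • h₁, -(n⁻¹ • h₂)} : Set Monster),
        x ∈ K := fun x hx => LieSubalgebra.subset_lieSpan hx
      have hf : fExt l a = (κ * m * n) • (κ * m * n)⁻¹ • fExt l a := by
        rw [smul_smul, mul_inv_cancel₀ hc, one_smul]
      have hh₁ : h₁ = m • m⁻¹ • h₁ := by rw [smul_smul, mul_inv_cancel₀ hm0, one_smul]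
      have hh₂ : h₂ = -(n • -(n⁻¹ • h₂)) := by
        rw [smul_neg, neg_neg, smul_smul, mul_inv_cancel₀ hn0, one_smul]
      have mf : fExt l a ∈ K := by rw [hf]; exact K.smul_mem _ (hx _ (by simp))
      have mh₁ : h₁ ∈ K := by rw [hh₁]; exact K.smul_mem _ (hx _ (by simp))
      have mh₂ : h₂ ∈ K := by rw [hh₂]; exact neg_mem (K.smul_mem _ (hx _ (by simp)))
      rintro x (rfl | rfl | rfl | rfl)
      exacts [hx _ (by simp), mf, mh₁, mh₂]
  obtain ⟨φ, -⟩ := exists_gl2Equiv H hab hK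
  exact ⟨φ⟩

end

/-! ### The inner automorphisms of `𝔤𝔩₂` -/

section Conj

variable {L L' : Type*} [LieRing L] [LieAlgebra ℂ L] [LieRing L'] [LieAlgebra ℂ L']

/-- Conjugation by an isomorphism, as an isomorphism of automorphism groups. -/
def autCongr (ψ : L ≃ₗ⁅ℂ⁆ L') : (L ≃ₗ⁅ℂ⁆ L) ≃* (L' ≃ₗ⁅ℂ⁆ L') where
  toFun g := ψ.symm.trans (g.trans ψ)
  invFun g := ψ.trans (g.trans ψ.symm)
  left_inv g := LieEquiv.ext fun x => by simp
  right_inv g := LieEquiv.ext fun x => by simp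
  map_mul' g g' := LieEquiv.ext fun x => by
    change ψ (g (g' (ψ.symm x))) = ψ (g (ψ.symm (ψ (g' (ψ.symm x)))))
    rw [LieEquiv.symm_apply_apply]

theorem autCongr_expAd (ψ : L ≃ₗ⁅ℂ⁆ L') {x : L} (hx : IsLocallyAdNilpotent x) :
    autCongr ψ (expAd x hx) = expAd (ψ x) (hx.map ψ) := by
  apply LieEquiv.ext
  intro y
  change ψ (expAdFun x (ψ.symm y)) = expAdFun (ψ x) y
  rw [← expAdFun_map hx, LieEquiv.apply_symm_apply]

theorem map_autCongr_inn (ψ : L ≃ₗ⁅ℂ⁆ L') : (Inn L).map (autCongr ψ).toMonoidHom = Inn L' := by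
  rw [Inn, Inn, MonoidHom.map_closure]
  congr 1
  ext g
  constructor
  · rintro ⟨_, ⟨x, hx, rfl⟩, rfl⟩
    exact ⟨ψ x, hx.map ψ, autCongr_expAd ψ hx⟩
  · rintro ⟨y, hy, rfl⟩
    refine ⟨expAd (ψ.symm y) (hy.map ψ.symm), ⟨_, _, rfl⟩, ?_⟩
    refine (autCongr_expAd ψ (hy.map ψ.symm)).trans ?_
    simp

theorem nonempty_inn_mulEquiv (ψ : L ≃ₗ⁅ℂ⁆ L') : Nonempty (Inn L ≃* Inn L') := by
  rw [← map_autCongr_inn ψ]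
  exact ⟨(autCongr ψ).subgroupMap (Inn L)⟩

end Conj

/-- The action of `GL₂` on `2 × 2` matrices by conjugation. -/
def conjGL : GL (Fin 2) ℂ →*
    (Matrix (Fin 2) (Fin 2) ℂ ≃ₗ⁅ℂ⁆ Matrix (Fin 2) (Fin 2) ℂ) where
  toFun g :=
    { toFun := fun M => g.1 * M * (g⁻¹).1
      map_add' := fun M N => by rw [mul_add, add_mul]
      map_smul' := fun t M => by simp
      map_lie' := fun {M N} => by
        simp only [Ring.lie_def, mul_sub, sub_mul, Matrix.mul_assoc, Units.inv_mul_cancel_left]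
      invFun := fun M => (g⁻¹).1 * M * g.1
      left_inv := fun M => by simp [Matrix.mul_assoc]
      right_inv := fun M => by simp [Matrix.mul_assoc] }
  map_one' := LieEquiv.ext fun M => by
    change 1 * M * ((1 : GL (Fin 2) ℂ)⁻¹).1 = M
    simp
  map_mul' g g' := LieEquiv.ext fun M => by
    change (g.1 * g'.1) * M * ((g * g')⁻¹).1 = g.1 * (g'.1 * M * (g'⁻¹).1) * (g⁻¹).1
    rw [mul_inv_rev, Units.val_mul]
    simp only [Matrix.mul_assoc]

theorem conjGL_apply (g : GL (Fin 2) ℂ) (M : Matrix (Fin 2) (Fin 2) ℂ) :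
    conjGL g M = g.1 * M * (g⁻¹).1 := rfl

theorem conjGL_ker : conjGL.ker = Subgroup.center (GL (Fin 2) ℂ) := by
  ext g
  rw [MonoidHom.mem_ker, Matrix.GeneralLinearGroup.mem_center_iff_val_mem_range_scalar]
  constructor
  · intro h
    rw [Matrix.mem_range_scalar_iff_commute_single']
    intro i j
    have h1 : g.1 * Matrix.single i j 1 * (g⁻¹).1 = Matrix.single i j 1 :=
      congrArg (fun φ : Matrix (Fin 2) (Fin 2) ℂ ≃ₗ⁅ℂ⁆ _ => φ (Matrix.single i j 1)) h
    have h2 := congrArg (fun M => M * g.1) h1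
    simp only [Matrix.mul_assoc, Units.inv_mul, mul_one] at h2
    exact h2.symm
  · rintro ⟨c, hc⟩
    refine LieEquiv.ext fun M => ?_
    rw [conjGL_apply, ← hc, (Matrix.scalar_commute c (fun r => mul_comm _ _) M).eq, hc,
      Matrix.mul_assoc, Units.mul_inv, mul_one]
    rfl

/-! ### Exponentials of matrices as conjugations. -/

theorem lie_lie_of_sq_zero {x : Matrix (Fin 2) (Fin 2) ℂ} (hx : x * x = 0)
    (y : Matrix (Fin 2) (Fin 2) ℂ) : ⁅x, ⁅x, y⁆⁆ = -(2 : ℂ) • (x * y * x) := by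
  have h1 : x * (x * y) = 0 := by rw [← mul_assoc, hx, zero_mul]
  have h2 : y * x * x = 0 := by rw [mul_assoc, hx, mul_zero]
  rw [Ring.lie_def, Ring.lie_def, mul_sub, sub_mul, h1, h2, ← mul_assoc]
  module

theorem ad_pow_three_of_sq_zero {x : Matrix (Fin 2) (Fin 2) ℂ} (hx : x * x = 0)
    (y : Matrix (Fin 2) (Fin 2) ℂ) : (LieAlgebra.ad ℂ _ x ^ 3) y = 0 := by
  rw [show 3 = 0 + 1 + 1 + 1 from rfl, ad_pow_succ_apply, ad_pow_succ_apply, ad_pow_succ_apply,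
    pow_zero, Module.End.one_apply, lie_lie_of_sq_zero hx, Ring.lie_def,
    mul_sub, ← mul_assoc, ← mul_assoc, hx, zero_mul, zero_sub, neg_mul, mul_assoc (x * y), hx,
    mul_zero, neg_zero, smul_zero]

theorem isLocallyAdNilpotent_of_sq_zero {x : Matrix (Fin 2) (Fin 2) ℂ} (hx : x * x = 0) :
    IsLocallyAdNilpotent x := fun y => ⟨3, ad_pow_three_of_sq_zero hx y⟩

/-- The invertible matrix `1 + x` with inverse `1 - x`, for `x ^ 2 = 0`. -/
def oneAdd (x : Matrix (Fin 2) (Fin 2) ℂ) (hx : x * x = 0) : GL (Fin 2) ℂ where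
  val := 1 + x
  inv := 1 - x
  val_inv := by rw [mul_sub, add_mul, add_mul, hx]; simp
  inv_val := by rw [sub_mul, mul_add, mul_add, hx]; simp

/-- The product `(1 + x) y (1 - x)` is `y + [x, y] - x y x`, and `-x y x` is half of `[x, [x, y]]`
when `x² = 0`. -/
theorem conjGL_oneAdd {x : Matrix (Fin 2) (Fin 2) ℂ} (hx : x * x = 0) :
    conjGL (oneAdd x hx) = expAd x (isLocallyAdNilpotent_of_sq_zero hx) := by
  apply LieEquiv.ext
  intro y
  change (1 + x) * y * (1 - x) = expAdFun x y
  rw [expAdFun_eq (ad_pow_three_of_sq_zero hx y)]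
  simp only [Finset.sum_range_succ, Finset.sum_range_zero, zero_add]
  rw [pow_two, Module.End.mul_apply, pow_one, LieAlgebra.ad_apply, LieAlgebra.ad_apply, pow_zero,
    Module.End.one_apply, lie_lie_of_sq_zero hx, smul_smul, Ring.lie_def]
  simp only [Nat.factorial, add_mul, mul_sub, one_mul, mul_one]
  push_cast
  norm_num
  module

/-- A locally ad-nilpotent matrix is the sum of a scalar and a matrix of square zero. -/
theorem exists_scalar_add_sq_zero {x : Matrix (Fin 2) (Fin 2) ℂ} (hx : IsLocallyAdNilpotent x) :
    ∃ (t : ℂ) (z : Matrix (Fin 2) (Fin 2) ℂ), x = t • 1 + z ∧ z * z = 0 := by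
  -- Removing half the trace leaves a traceless `z`, whose square is the scalar `δ = -det z`.
  obtain ⟨t, ht⟩ : ∃ t, t = (x 0 0 + x 1 1) / 2 := ⟨_, rfl⟩
  obtain ⟨z, hz⟩ : ∃ z, z = x - t • 1 := ⟨_, rfl⟩
  have hxz : x = t • 1 + z := by rw [hz]; abel
  have h11 : z 1 1 = -z 0 0 := by
    rw [hz, ht]
    simp
    ring
  obtain ⟨δ, hδ⟩ : ∃ δ, δ = z 0 0 ^ 2 + z 0 1 * z 1 0 := ⟨_, rfl⟩
  have hsq : z * z = δ • 1 := by
    rw [hδ]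
    ext i j
    fin_cases i <;> fin_cases j <;> simp [Matrix.mul_apply, Fin.sum_univ_two, h11] <;> ring
  have had : ∀ y, ⁅x, y⁆ = z * y - y * z := by
    intro y
    rw [hxz, Ring.lie_def, add_mul, mul_add, smul_mul_assoc, mul_smul_comm, one_mul, mul_one]
    abel
  refine ⟨t, z, hxz, ?_⟩
  by_cases hδ0 : δ = 0
  · rw [hsq, hδ0, zero_smul]
  -- If `δ ≠ 0`, the identity `(ad x)³ = 4δ ad x` and local nilpotency force `ad x = 0`. Then `z`
  -- commutes with `E₁₂`, which gives `z₀₀ = z₁₀ = 0` and hence `z² = 0` again.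
  have hcube : ∀ y : Matrix (Fin 2) (Fin 2) ℂ, ⁅x, ⁅x, ⁅x, y⁆⁆⁆ = (4 * δ) • ⁅x, y⁆ := by
    intro y
    have e1 : z * (z * y) = δ • y := by rw [← mul_assoc, hsq, smul_mul_assoc, one_mul]
    have e2 : ∀ w, w * z * z = δ • w := by
      intro w
      rw [mul_assoc, hsq, mul_smul_comm, mul_one]
    have e3 : z * (z * y * z) = δ • (y * z) := by
      rw [mul_assoc, ← mul_assoc, hsq, smul_mul_assoc, one_mul]
    have e4 : z * (y * z) = z * y * z := (mul_assoc _ _ _).symm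
    simp only [had, mul_sub, sub_mul, e1, e2, e4, e3, mul_smul_comm, smul_mul_assoc]
    module
  have hpow : ∀ n y, (LieAlgebra.ad ℂ _ x ^ (2 * n + 1)) y = (4 * δ) ^ n • ⁅x, y⁆ := by
    intro n y
    induction n with
    | zero => simp
    | succ n ih =>
      rw [show 2 * (n + 1) + 1 = 2 * n + 1 + 1 + 1 by ring, ad_pow_succ_apply, ad_pow_succ_apply,
        ih, lie_smul, lie_smul, hcube, smul_smul, pow_succ]
  have hcomm : ∀ y, z * y = y * z := by
    intro y
    obtain ⟨n, hn⟩ := hx y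
    have h := pow_apply_eq_zero_of_le (show n ≤ 2 * n + 1 by omega) hn
    rw [hpow, smul_eq_zero] at h
    have h := h.resolve_left (pow_ne_zero _ (mul_ne_zero (by norm_num) hδ0))
    rw [had] at h
    exact sub_eq_zero.1 h
  have c1 := congrFun (congrFun (hcomm (Matrix.single 0 1 1)) 0) 1
  have c2 := congrFun (congrFun (hcomm (Matrix.single 0 1 1)) 1) 1
  simp [Matrix.mul_apply, Fin.sum_univ_two, h11] at c1 c2
  have h00 : z 0 0 = 0 := by linear_combination c1 / 2
  rw [hsq, hδ, h00, c2]
  simp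

/-- Dividing by a square root of the determinant writes an invertible matrix as a scalar, acting
trivially, times an element of `SL₂`, a product of elementary matrices `1 + x` with `x² = 0` and
their inverses. Conversely, the scalar part of a locally ad-nilpotent matrix does not affect its
`ad`. -/
theorem conjGL_range : conjGL.range = Inn (Matrix (Fin 2) (Fin 2) ℂ) := by
  apply le_antisymm
  · have hSL : ∀ A : Matrix.SpecialLinearGroup (Fin 2) ℂ,
        conjGL (Matrix.SpecialLinearGroup.toGL A) ∈ Inn (Matrix (Fin 2) (Fin 2) ℂ) := by
      intro A
      have hle : Subgroup.closure (Set.range upperSL ∪ Set.range lowerSL) ≤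
          (Inn (Matrix (Fin 2) (Fin 2) ℂ)).comap
            (conjGL.comp Matrix.SpecialLinearGroup.toGL) := by
        rw [Subgroup.closure_le]
        rintro _ (⟨u, rfl⟩ | ⟨u, rfl⟩)
        · have hx : (!![0, u; 0, 0] : Matrix (Fin 2) (Fin 2) ℂ) * !![0, u; 0, 0] = 0 := by
            rw [Matrix.mul_fin_two]
            ext i j
            fin_cases i <;> fin_cases j <;> simp
          refine Subgroup.subset_closure ⟨_, isLocallyAdNilpotent_of_sq_zero hx, ?_⟩
          rw [← conjGL_oneAdd hx]
          refine congrArg conjGL (Units.ext ?_)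
          ext i j
          fin_cases i <;> fin_cases j <;> simp [upperSL, oneAdd, Matrix.SpecialLinearGroup.toGL]
        · have hx : (!![0, 0; u, 0] : Matrix (Fin 2) (Fin 2) ℂ) * !![0, 0; u, 0] = 0 := by
            rw [Matrix.mul_fin_two]
            ext i j
            fin_cases i <;> fin_cases j <;> simp
          refine Subgroup.subset_closure ⟨_, isLocallyAdNilpotent_of_sq_zero hx, ?_⟩
          rw [← conjGL_oneAdd hx]
          refine congrArg conjGL (Units.ext ?_)
          ext i j
          fin_cases i <;> fin_cases j <;> simp [lowerSL, oneAdd, Matrix.SpecialLinearGroup.toGL]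
      rw [closure_elementary] at hle
      exact hle (Subgroup.mem_top A)
    rintro _ ⟨g, rfl⟩
    obtain ⟨s, hs⟩ := IsAlgClosed.exists_pow_nat_eq (Matrix.det g.1) two_pos
    have hdet : Matrix.det g.1 ≠ 0 := ((Matrix.isUnit_iff_isUnit_det _).1 g.isUnit).ne_zero
    have hs0 : s ≠ 0 := by
      rintro rfl
      exact hdet (by rw [← hs]; simp)
    have hA : Matrix.det (s⁻¹ • g.1) = 1 := by
      rw [Matrix.det_smul, Fintype.card_fin, ← hs]
      field_simp
    have hg : g = Matrix.GeneralLinearGroup.scalar (Fin 2) (Units.mk0 s hs0) *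
        Matrix.SpecialLinearGroup.toGL ⟨s⁻¹ • g.1, hA⟩ := by
      apply Units.ext
      change g.1 = Matrix.scalar (Fin 2) s * (s⁻¹ • g.1)
      rw [Matrix.scalar_apply, ← Matrix.smul_one_eq_diagonal, smul_mul_assoc, one_mul, smul_smul,
        mul_inv_cancel₀ hs0, one_smul]
    have hker : conjGL (Matrix.GeneralLinearGroup.scalar (Fin 2) (Units.mk0 s hs0)) = 1 := by
      rw [← MonoidHom.mem_ker, conjGL_ker, Matrix.GeneralLinearGroup.center_eq_range_scalar]
      exact ⟨_, rfl⟩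
    rw [hg, map_mul, hker, one_mul]
    exact hSL _
  · rw [Inn, Subgroup.closure_le]
    rintro _ ⟨x, hx, rfl⟩
    obtain ⟨t, z, hxz, hz⟩ := exists_scalar_add_sq_zero hx
    refine ⟨oneAdd z hz, ?_⟩
    rw [conjGL_oneAdd]
    have had : LieAlgebra.ad ℂ _ z = LieAlgebra.ad ℂ _ x := by
      ext1 y
      rw [LieAlgebra.ad_apply, LieAlgebra.ad_apply, hxz, add_lie, smul_lie, Ring.lie_def 1]
      simp
    apply LieEquiv.ext
    intro y
    change expAdFun z y = expAdFun x y
    rw [expAdFun_eq (ad_pow_three_of_sq_zero hz y),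
      expAdFun_eq (x := x) (N := 3) (by rw [← had]; exact ad_pow_three_of_sq_zero hz y), had]

theorem nonempty_inn_matrix_mulEquiv :
    Nonempty (Inn (Matrix (Fin 2) (Fin 2) ℂ) ≃* Matrix.ProjGenLinGroup (Fin 2) ℂ) := by
  rw [← conjGL_range]
  exact ⟨((QuotientGroup.quotientMulEquivOfEq conjGL_ker.symm).trans
    (QuotientGroup.quotientKerEquivRange conjGL)).symm⟩

end

end MonsterLie

theorem mainTheorem8 :
    (∃ φ : Matrix (Fin 2) (Fin 2) ℂ ≃ₗ⁅ℂ⁆ MonsterLie.gl2Neg,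
      (φ (Matrix.single 0 1 1) : MonsterLie.Monster) = MonsterLie.eNeg ∧
      (φ (Matrix.single 1 0 1) : MonsterLie.Monster) = MonsterLie.fNeg ∧
      (φ (Matrix.single 0 0 1) : MonsterLie.Monster) = MonsterLie.h₁ ∧
      (φ (Matrix.single 1 1 1) : MonsterLie.Monster) = MonsterLie.h₂ ∧
      ∀ x : MonsterLie.Monster, MonsterLie.IsLocallyAdNilpotent x ↔
        ∃ M : Matrix (Fin 2) (Fin 2) ℂ, IsNilpotent M ∧ (φ M : MonsterLie.Monster) = x) ∧
    MonsterLie.Inn MonsterLie.Monster =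
      Subgroup.closure (Set.range MonsterLie.X ∪ Set.range MonsterLie.Y) ∧
    Nonempty (MonsterLie.Inn MonsterLie.Monster ≃* Matrix.SpecialLinearGroup (Fin 2) ℂ) ∧
    (∀ (a : MonsterLie.Index) (l : ℕ), 1 ≤ a.j → (l : ℤ) < a.j →
      Nonempty (MonsterLie.Inn (MonsterLie.gl2Im l a) ≃*
        Matrix.ProjGenLinGroup (Fin 2) ℂ)) := by
  refine ⟨?_, MonsterLie.inn_monster, MonsterLie.nonempty_inn_mulEquiv_SL, fun a l ha hl => ?_⟩
  · obtain ⟨φ, hφ⟩ := MonsterLie.exists_gl2Equiv MonsterLie.isGl2Tuple_neg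
      MonsterLie.h₁_h₂_independent (K := MonsterLie.gl2Neg) rfl
    refine ⟨φ, (hφ _).trans (MonsterLie.gl2Hom_single _ 0 1),
      (hφ _).trans (MonsterLie.gl2Hom_single _ 1 0),
      (hφ _).trans (MonsterLie.gl2Hom_single _ 0 0),
      (hφ _).trans (MonsterLie.gl2Hom_single _ 1 1), fun x => ?_⟩
    rw [MonsterLie.isLocallyAdNilpotent_iff]
    simp only [hφ]
    rfl
  · obtain ⟨ψ⟩ := MonsterLie.nonempty_gl2Equiv_gl2Im ha hl
    obtain ⟨F⟩ := MonsterLie.nonempty_inn_mulEquiv ψ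
    obtain ⟨G⟩ := MonsterLie.nonempty_inn_matrix_mulEquiv
    exact ⟨F.symm.trans G⟩
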